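/- Let $(M^{1+m},g)$, $m\ge 0$, be a closed (compact, boundaryless) smooth Riemannian manifold with Levi-Civita connection $\nabla$ and curvature $R(X,Y)Z=\nabla_X\nabla_YZ-\nabla_Y\nabla_XZ-\nabla_{[X,Y]}Z$. Let $g_S$ be the Sasaki metric of $TM$, $g_S(\xi,\eta)=g(\pi_*\xi,\pi_*\eta)+g(K\xi,K\eta)$, where $\pi:TM\to M$ is the projection and $K$ is the connection operator of $\nabla$. The volume of a smooth vector field $v$ is the total volume of $M$ in the metric $g(v)$ obtained by pulling back $g_S$ by the section $p\mapsto(p,v(p))$. The field $v$ is called minimal if it is a critical point of the volume among all smooth vector fields, and minimal unit if it is a unit field and a critical point of the volume among all smooth unit vector fields (critical with respect to smooth paths $v_t$ with $v_0=v$). Let $C_v=\nabla v$, $C_v(X)=\nabla_Xv$, and let $C_v^t$ be its pointwise $g$-adjoint. Let $v$ be a smooth unit vector field on $M$. For $p\in M$, call an eigenframe at $p$ a smooth local orthonormal frame $\{e_i\}_{i=0}^m$ of $TM$ about $p$ such that the vectors $e_i(p)$ are eigenvectors of $C_v^tC_v$ at $p$, and for it set $\lambda_i^2=\|\nabla_{e_i}v\|^2$,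 $c_i^2=1/(1+\lambda_i^2)$. Consider the identity at $p$ $$\sum_{i=0}^m c_i^2\left(\nabla_{e_i}\nabla_{e_i}-\nabla_{\nabla_{e_i}e_i}-\nabla_{R(v,\nabla_{e_i}v)e_i}\right)v=\lambda v,\qquad \lambda=-\sum_{i=0}^m\frac{\lambda_i^2}{1+\lambda_i^2}.\qquad(*)$$ Then: (a) $v$ is a minimal unit vector field if and only if, for every $p\in M$, $(*)$ holds at $p$ for every eigenframe at $p$. (b) $v$ is a minimal unit vector field if and only if, for every $p\in M$, there is an eigenframe at $p$ for which $(*)$ holds at $p$. (c) If at every $p\in M$ there is an eigenframe with $e_0=v$ near $p$, then $v$ is a minimal unit vector field if and only if, for every $p\in M$, $(*)$ holds at $p$ for every eigenframe at $p$ with $e_0=v$ near $p$. Moreover, a vector field that is both minimal and minimal unit is a parallel vector field of unit norm. -/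

import Mathlib

open scoped Manifold ContDiff Bundle

noncomputable section

namespace UnitFields

/-- Euclidean `n`-space, the model of `n`-dimensional manifolds. -/
abbrev Model (n : ℕ) : Type := EuclideanSpace ℝ (Fin n)

/-- The standard basis of the model space. -/
abbrev stdBasis {n : ℕ} (i : Fin n) : Model n := EuclideanSpace.basisFun (Fin n) ℝ i

section Field

variable {n : ℕ} {M : Type*} [TopologicalSpace M] [ChartedSpace (Model n) M]

/-- Vector fields (not necessarily continuous) on the `n`-manifold `M`. -/
abbrev VField (n : ℕ) (M : Type*) [TopologicalSpace M] [ChartedSpace (Model n) M] :=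
  (p : M) → TangentSpace 𝓘(ℝ, Model n) p

/-- The section `p ↦ (p, v p)` of the tangent bundle defined by a vector field. -/
def sectionMap (v : VField n M) : M → TangentBundle 𝓘(ℝ, Model n) M := fun p => ⟨p, v p⟩

/-- The coordinate representation `(h_{ij}(y))`, in the chart centred at `x`, of a field `h` of
bilinear forms: its entries are `h(∂_i, ∂_j)` at the point with coordinates `y`. -/
def coordMatrix
    (h : (p : M) → TangentSpace 𝓘(ℝ, Model n) p → TangentSpace 𝓘(ℝ, Model n) p → ℝ)
    (x : M) (y : Model n) : Matrix (Fin n) (Fin n) ℝ :=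
  Matrix.of fun i j =>
    h ((extChartAt 𝓘(ℝ, Model n) x).symm y)
      (mfderiv 𝓘(ℝ, Model n) 𝓘(ℝ, Model n) (extChartAt 𝓘(ℝ, Model n) x).symm y (stdBasis i))
      (mfderiv 𝓘(ℝ, Model n) 𝓘(ℝ, Model n) (extChartAt 𝓘(ℝ, Model n) x).symm y (stdBasis j))

end Field

section Manifold

variable {n : ℕ} {M : Type*} [TopologicalSpace M] [ChartedSpace (Model n) M]
  [IsManifold 𝓘(ℝ, Model n) ∞ M]

/-- Smooth Riemannian metrics on the `n`-manifold `M`. -/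
abbrev Metric (n : ℕ) (M : Type*) [TopologicalSpace M] [ChartedSpace (Model n) M]
    [IsManifold 𝓘(ℝ, Model n) ∞ M] :=
  Bundle.ContMDiffRiemannianMetric 𝓘(ℝ, Model n) ∞ (Model n)
    (fun p : M => TangentSpace 𝓘(ℝ, Model n) p)

/-- The partial derivative `∂_k g_{ij}` at `p`, in the chart centred at `p`. -/
def dMetric (g : Metric n M) (p : M) (k i j : Fin n) : ℝ :=
  fderiv ℝ (fun y => coordMatrix (fun q X Y => g.inner q X Y) p y i j)
    (extChartAt 𝓘(ℝ, Model n) p p) (stdBasis k)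

/-- The Christoffel symbol
`Γ^l_{ij} = ½ ∑_k g^{lk} (∂_i g_{jk} + ∂_j g_{ik} - ∂_k g_{ij})`
of the Levi-Civita connection at `p`, in the chart centred at `p`. -/
def christoffel (g : Metric n M) (p : M) (l i j : Fin n) : ℝ :=
  (1 / 2) * ∑ k,
    (coordMatrix (fun q X Y => g.inner q X Y) p (extChartAt 𝓘(ℝ, Model n) p p))⁻¹ l k *
      (dMetric g p i j k + dMetric g p j i k - dMetric g p k i j)

/-- The connection operator `K : T_{(p,u)} TM → T_p M` of the Levi-Civita connection.
A tangent vector `ξ` of `TM` at `w = (p, u)` is, in the chart of `TM` induced by the chart of `M`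
centred at `p`, a pair `(X, V)`; then `K ξ` has the components `V^l + Γ^l_{ij} X^i u^j`. -/
def connector (g : Metric n M) (w : TangentBundle 𝓘(ℝ, Model n) M)
    (ξ : TangentSpace 𝓘(ℝ, Model n).tangent w) : TangentSpace 𝓘(ℝ, Model n) w.proj :=
  let ξ' : Model n × Model n := ξ
  let u : Model n := w.snd
  let r : Model n := ξ'.2 + ∑ l, (∑ i, ∑ j, christoffel g w.proj l i j * ξ'.1 i * u j) • stdBasis l
  r

/-- The Levi-Civita covariant derivative `(∇_X v)(p)`, `X ∈ T_p M`: the connection operator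
applied to the derivative of the section `v` in the direction `X`. -/
def nabla (g : Metric n M) (v : VField n M) (p : M) (X : TangentSpace 𝓘(ℝ, Model n) p) :
    TangentSpace 𝓘(ℝ, Model n) p :=
  connector g (sectionMap v p)
    (mfderiv 𝓘(ℝ, Model n) 𝓘(ℝ, Model n).tangent (sectionMap v) p X)

/-- The vector field `∇_X v`, for vector fields `X`, `v`. -/
def cov (g : Metric n M) (X v : VField n M) : VField n M := fun p => nabla g v p (X p)

/-- The curvature `R(X, Y) Z = ∇_X ∇_Y Z - ∇_Y ∇_X Z - ∇_{[X, Y]} Z`. -/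
def curvature (g : Metric n M) (X Y Z : VField n M) : VField n M := fun p =>
  cov g X (cov g Y Z) p - cov g Y (cov g X Z) p -
    nabla g Z p (VectorField.mlieBracket 𝓘(ℝ, Model n) X Y p)

/-- The Sasaki metric of `TM`: `g_S(ξ, η) = g(π_* ξ, π_* η) + g(K ξ, K η)`. -/
def sasaki (g : Metric n M) (w : TangentBundle 𝓘(ℝ, Model n) M)
    (ξ η : TangentSpace 𝓘(ℝ, Model n).tangent w) : ℝ :=
  g.inner w.proj
      (mfderiv 𝓘(ℝ, Model n).tangent 𝓘(ℝ, Model n)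
        (fun w' : TangentBundle 𝓘(ℝ, Model n) M => w'.proj) w ξ)
      (mfderiv 𝓘(ℝ, Model n).tangent 𝓘(ℝ, Model n)
        (fun w' : TangentBundle 𝓘(ℝ, Model n) M => w'.proj) w η) +
    g.inner w.proj (connector g w ξ) (connector g w η)

/-- The metric `g(v)` on `M`: the pull-back of the Sasaki metric by the section `p ↦ (p, v p)`. -/
def inducedMetric (g : Metric n M) (v : VField n M) (p : M)
    (X Y : TangentSpace 𝓘(ℝ, Model n) p) : ℝ :=
  sasaki g (sectionMap v p)
    (mfderiv 𝓘(ℝ, Model n) 𝓘(ℝ, Model n).tangent (sectionMap v) p X)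
    (mfderiv 𝓘(ℝ, Model n) 𝓘(ℝ, Model n).tangent (sectionMap v) p Y)

/-- A smooth partition of unity on `M` subordinate to the charts. -/
def chartPartition (n : ℕ) (M : Type*) [TopologicalSpace M] [ChartedSpace (Model n) M]
    [IsManifold 𝓘(ℝ, Model n) ∞ M] [T2Space M] [CompactSpace M] :
    SmoothPartitionOfUnity M 𝓘(ℝ, Model n) M Set.univ :=
  (SmoothPartitionOfUnity.exists_isSubordinate_chartAt_source 𝓘(ℝ, Model n) M).choose

/-- The total volume of a compact manifold `M` with the Riemannian metric `h`: the sum over the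
charts, weighted with a subordinate partition of unity, of the integrals of the Riemannian
density `√(det (h_{ij}))` against Lebesgue measure. -/
def totalVolume [T2Space M] [CompactSpace M]
    (h : (p : M) → TangentSpace 𝓘(ℝ, Model n) p → TangentSpace 𝓘(ℝ, Model n) p → ℝ) : ℝ :=
  ∑ᶠ x : M, ∫ y in (extChartAt 𝓘(ℝ, Model n) x).target,
    chartPartition n M x ((extChartAt 𝓘(ℝ, Model n) x).symm y) *
      Real.sqrt (coordMatrix h x y).det

/-- The volume of the vector field `v`, that is, of the cycle `{(p, v p)}` in `TM` with the metric
induced by the Sasaki metric. -/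
def fieldVolume [T2Space M] [CompactSpace M] (g : Metric n M) (v : VField n M) : ℝ :=
  totalVolume (inducedMetric g v)

/-- Smooth vector fields. -/
def IsSmooth (v : VField n M) : Prop :=
  ContMDiff 𝓘(ℝ, Model n) 𝓘(ℝ, Model n).tangent ∞ (sectionMap v)

/-- Fields of unit vectors. -/
def IsUnitField (g : Metric n M) (v : VField n M) : Prop := ∀ p, g.inner p (v p) (v p) = 1

/-- Smooth paths `t ↦ w t` of vector fields (smooth jointly in `t` and the point). -/
def IsSmoothPath (w : ℝ → VField n M) : Prop :=
  ContMDiff (𝓘(ℝ, ℝ).prod 𝓘(ℝ, Model n)) 𝓘(ℝ, Model n).tangent ∞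
    (fun x : ℝ × M => sectionMap (w x.1) x.2)

/-- Minimal vector fields: smooth critical points of the volume among all smooth fields. -/
def IsMinimal [T2Space M] [CompactSpace M] (g : Metric n M) (v : VField n M) : Prop :=
  IsSmooth v ∧ ∀ w : ℝ → VField n M, IsSmoothPath w → w 0 = v →
    HasDerivAt (fun t => fieldVolume g (w t)) 0 0

/-- Minimal unit vector fields: smooth unit fields that are critical points of the volume among
all smooth unit fields. -/
def IsMinimalUnit [T2Space M] [CompactSpace M] (g : Metric n M) (v : VField n M) : Prop :=
  IsSmooth v ∧ IsUnitField g v ∧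
    ∀ w : ℝ → VField n M, IsSmoothPath w → (∀ t, IsUnitField g (w t)) → w 0 = v →
      HasDerivAt (fun t => fieldVolume g (w t)) 0 0

/-- Parallel vector fields. -/
def IsParallel (g : Metric n M) (v : VField n M) : Prop := ∀ p X, nabla g v p X = 0

/-- `e` restricts to a smooth orthonormal frame of `TM` on the set `U`. -/
def IsOrthonormalFrameOn (g : Metric n M) (e : Fin n → VField n M) (U : Set M) : Prop :=
  (∀ i, ContMDiffOn 𝓘(ℝ, Model n) 𝓘(ℝ, Model n).tangent ∞ (sectionMap (e i)) U) ∧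
    ∀ q ∈ U, ∀ i j, g.inner q (e i q) (e j q) = if i = j then 1 else 0

/-- `X ∈ T_p M` is an eigenvector of `C_v^t C_v`, where `C_v = ∇v : T_p M → T_p M`; the
eigenvalue equation `C_v^t C_v X = μ X` is tested against all `Y ∈ T_p M`. -/
def IsEigenvector (g : Metric n M) (v : VField n M) (p : M)
    (X : TangentSpace 𝓘(ℝ, Model n) p) : Prop :=
  X ≠ 0 ∧ ∃ μ : ℝ, ∀ Y : TangentSpace 𝓘(ℝ, Model n) p,
    g.inner p (nabla g v p X) (nabla g v p Y) = μ * g.inner p X Y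

/-- `e` is a smooth orthonormal frame about `p`, made at `p` of eigenvectors of `C_v^t C_v`. -/
def IsEigenframeAt (g : Metric n M) (v : VField n M) (p : M) (e : Fin n → VField n M) : Prop :=
  (∃ U : Set M, IsOpen U ∧ p ∈ U ∧ IsOrthonormalFrameOn g e U) ∧
    ∀ i, IsEigenvector g v p (e i p)

/-- `λ_i² = ‖∇_{e_i} v‖²` at `p`. -/
def lamSq (g : Metric n M) (v : VField n M) (e : Fin n → VField n M) (p : M) (i : Fin n) : ℝ :=
  g.inner p (nabla g v p (e i p)) (nabla g v p (e i p))

/-- The identity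
`∑ c_i² (∇_{e_i} ∇_{e_i} - ∇_{∇_{e_i} e_i} - ∇_{R(v, ∇_{e_i} v) e_i}) v = λ v` at `p`, where
`c_i² = 1 / (1 + λ_i²)` and `λ = - ∑ λ_i² / (1 + λ_i²)`. -/
def MinimalUnitEquation (g : Metric n M) (v : VField n M) (e : Fin n → VField n M) (p : M) :
    Prop :=
  ∑ i, (1 / (1 + lamSq g v e p i)) •
      (cov g (e i) (cov g (e i) v) p
        - cov g (cov g (e i) (e i)) v p
        - cov g (curvature g v (cov g (e i) v) (e i)) v p)
    = (-∑ i, lamSq g v e p i / (1 + lamSq g v e p i)) • v p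

end Manifold

end UnitFields

end

/-! Write `C = ∇v` and let `H = g + g(C·, C·)` be the induced metric. The volume density is `√det
H`, and by Jacobi's formula its variation in the direction `w` is `√det H · tr(H⁻¹ g(C·, ∇w·))`. Let
`Z` be the field with `H(Z, ·) = g(C·, w)`. Subtracting the coordinate divergence of `√det H · Z`
leaves the Euler-Lagrange expression, which depends on `w` only through its value `u` at each point
(`sum_fderiv_flatFlux`).

This expression simplifies after the substitution `u = (1 + C Cᵗ) u'`. Then `Z = Cᵗ u'`, and the
Ricci identity together with the pair symmetry of the curvature turn it into `-√det H · g(T, u')`,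
where `T = ∑ c_i² (∇²_{e_i,e_i} v - ∇_{R(v, ∇_{e_i} v) e_i} v)` (`eulerLagrange_quadratic`,
`flatEulerLagrange_eq`). The weights appear because an eigenframe is `H`-orthogonal with `H(e_i,
e_i) = 1 + λ_i²`. If `|v| = 1`, the image of `C` is orthogonal to `v`, so `u ⊥ v` exactly when `u' ⊥
v`. Hence the expression vanishes on `v^⊥` if and only if `T` is a multiple of `v`; differentiating
`g(∇_a v, v) = 0` identifies the factor as `-∑ λ_i² c_i²` (`eulerLagrange_iff`). The vanishing on
`v^⊥` involves no frame, and this is why one eigenframe, all eigenframes, or those with `e_0 = v`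
(where they exist) give equivalent conditions.

Globally, the first variation transforms like a density under changes of charts. For a direction
supported in one chart the partition of unity in the definition of the volume therefore disappears,
and integration by parts takes place in that chart (`volumeVariation_eq_integral`). General
directions are cut up by the partition of unity. Conversely, every smooth `w ⊥ v` is the velocity of
the unit fields `(v + t w) / √(1 + t² |w|²)`, so the fundamental lemma of the calculus of variations
gives the pointwise equation (`IsMinimalUnit.isCriticalField`).

For the last claim, the path `(1 + t) v` shows that a minimal field has zero first variation in its
own direction. That variation is the integral of `√det H · ∑ λ_i² / (1 + λ_i²) ≥ 0`, so all `λ_i`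
vanish and `v` is parallel. -/

noncomputable section

set_option maxSynthPendingDepth 3

namespace UnitFields

/-! ### Tensor calculus of the Levi-Civita connection in coordinates. -/

section Flat

variable {E : Type*} [NormedAddCommGroup E] [NormedSpace ℝ E]

/-- `G` is a smooth Riemannian metric on the open set `U` of a vector space, and `Γ` is the
Christoffel map of its Levi-Civita connection. -/
structure IsLeviCivitaOn (U : Set E) (G : E → E →L[ℝ] E →L[ℝ] ℝ) (Γ : E → E →L[ℝ] E →L[ℝ] E) :
    Prop where
  isOpen : IsOpen U
  contDiffOn_metric : ContDiffOn ℝ ∞ G U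
  contDiffOn_christoffel : ContDiffOn ℝ ∞ Γ U
  metric_symm : ∀ y ∈ U, ∀ a b, G y a b = G y b a
  metric_pos : ∀ y ∈ U, ∀ a, a ≠ 0 → 0 < G y a a
  symm : ∀ y ∈ U, ∀ a b, Γ y a b = Γ y b a
  compat : ∀ y ∈ U, ∀ c a b, fderiv ℝ G y c a b = G y (Γ y c a) b + G y a (Γ y c b)

/-- The covariant derivative `a ↦ ∇_a V` in coordinates. -/
def flatNabla (Γ : E → E →L[ℝ] E →L[ℝ] E) (V : E → E) (y : E) : E →L[ℝ] E :=
  fderiv ℝ V y + (Γ y).flip (V y)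

/-- The vector field `∇_X V` in coordinates. -/
def flatCov (Γ : E → E →L[ℝ] E →L[ℝ] E) (X V : E → E) (y : E) : E := flatNabla Γ V y (X y)

/-- The second covariant derivative `∇²_{b,a} V` in coordinates. -/
def flatNabla₂ (Γ : E → E →L[ℝ] E →L[ℝ] E) (V : E → E) (y b a : E) : E :=
  fderiv ℝ (flatNabla Γ V) y b a + Γ y b (flatNabla Γ V y a) - flatNabla Γ V y (Γ y b a)

/-- The curvature tensor in coordinates. -/
def flatCurv (Γ : E → E →L[ℝ] E →L[ℝ] E) (y a b c : E) : E :=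
  fderiv ℝ Γ y a b c - fderiv ℝ Γ y b a c + Γ y a (Γ y b c) - Γ y b (Γ y a c)

/-- The metric induced by the section `V`, in coordinates. -/
def flatInduced (G : E → E →L[ℝ] E →L[ℝ] ℝ) (Γ : E → E →L[ℝ] E →L[ℝ] E) (V : E → E) (y : E) :
    E →L[ℝ] E →L[ℝ] ℝ :=
  G y + (G y).bilinearComp (flatNabla Γ V y) (flatNabla Γ V y)

/-- The integrand `∇²_{e,e} V - ∇_{R(V, ∇_e V) e} V` of the minimality equation. -/
def flatTension (Γ : E → E →L[ℝ] E →L[ℝ] E) (V : E → E) (y e : E) : E :=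
  flatNabla₂ Γ V y e e - flatNabla Γ V y (flatCurv Γ y (V y) (flatNabla Γ V y e) e)

variable {U : Set E} {G : E → E →L[ℝ] E →L[ℝ] ℝ} {Γ : E → E →L[ℝ] E →L[ℝ] E} {V X Y Z : E → E}
  {y : E}

@[simp] lemma flatNabla_apply (a : E) : flatNabla Γ V y a = fderiv ℝ V y a + Γ y a (V y) := rfl

@[simp] lemma flatInduced_apply (a b : E) :
    flatInduced G Γ V y a b = G y a b + G y (flatNabla Γ V y a) (flatNabla Γ V y b) := rfl

lemma two_le_infty : minSmoothness ℝ 2 ≤ (∞ : ℕ∞ω) := by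
  rw [minSmoothness_of_isRCLikeNormedField]
  exact WithTop.coe_le_coe.2 le_top

lemma contDiffAt_flatNabla (hΓ : ContDiffAt ℝ ∞ Γ y) (hV : ContDiffAt ℝ ∞ V y) :
    ContDiffAt ℝ ∞ (flatNabla Γ V) y := by
  have h1 : ContDiffAt ℝ ∞ (fderiv ℝ V) y := hV.fderiv_right (by simp)
  have h2 : ContDiffAt ℝ ∞ (fun y => (Γ y).flip) y :=
    (ContinuousLinearMap.flipₗᵢ ℝ E E E).toContinuousLinearEquiv.contDiff.contDiffAt.comp y hΓ
  exact h1.add (h2.clm_apply hV)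

lemma contDiffAt_flatInduced (hG : ContDiffAt ℝ ∞ G y) (hΓ : ContDiffAt ℝ ∞ Γ y)
    (hV : ContDiffAt ℝ ∞ V y) : ContDiffAt ℝ ∞ (flatInduced G Γ V) y := by
  have hC := contDiffAt_flatNabla hΓ hV
  have h1 : ContDiffAt ℝ ∞ (fun z => (G z).comp (flatNabla Γ V z)) y := hG.clm_comp hC
  have hf : ContDiff ℝ ∞ (fun L : E →L[ℝ] E →L[ℝ] ℝ => L.flip) :=
    (ContinuousLinearMap.flipₗᵢ ℝ E E ℝ).toContinuousLinearEquiv.contDiff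
  have h2 := hf.contDiffAt.comp y ((hf.contDiffAt.comp y h1).clm_comp hC)
  exact hG.add h2

lemma contDiffAt_flatCov (hΓ : ContDiffAt ℝ ∞ Γ y) (hX : ContDiffAt ℝ ∞ X y)
    (hV : ContDiffAt ℝ ∞ V y) : ContDiffAt ℝ ∞ (flatCov Γ X V) y :=
  (contDiffAt_flatNabla hΓ hV).clm_apply hX

/-- Product rule for `∇V` applied to `X`; adding and subtracting `∇V(Γ(b, X))` separates the part
tensorial in `X` from the part containing `∇X`. -/
lemma flatNabla_flatCov (hΓ : ContDiffAt ℝ ∞ Γ y) (hX : ContDiffAt ℝ ∞ X y)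
    (hV : ContDiffAt ℝ ∞ V y) (b : E) :
    flatNabla Γ (flatCov Γ X V) y b = flatNabla₂ Γ V y b (X y) + flatNabla Γ V y (flatNabla Γ X y b)
    := by
  have h1 := ((contDiffAt_flatNabla hΓ hV).differentiableAt (by simp)).hasFDerivAt
  have h2 := (hX.differentiableAt (by simp)).hasFDerivAt
  have h3 : fderiv ℝ (flatCov Γ X V) y = _ := (h1.clm_apply h2).fderiv
  rw [flatNabla_apply, h3, flatNabla₂]
  simp only [flatCov, add_apply, ContinuousLinearMap.comp_apply,
    ContinuousLinearMap.flip_apply]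
  rw [flatNabla_apply (V := X), map_add]
  abel

lemma fderiv_flatNabla (hΓ : ContDiffAt ℝ ∞ Γ y) (hV : ContDiffAt ℝ ∞ V y) (b a : E) :
    fderiv ℝ (flatNabla Γ V) y b a =
      fderiv ℝ (fderiv ℝ V) y b a + fderiv ℝ Γ y b a (V y) + Γ y a (fderiv ℝ V y b) := by
  have hL : ContDiffAt ℝ ∞ (flatNabla Γ V) y := contDiffAt_flatNabla hΓ hV
  have e1 : fderiv ℝ (flatNabla Γ V) y b a = fderiv ℝ (fun z => flatNabla Γ V z a) y b := by
    rw [((hL.differentiableAt (by simp)).hasFDerivAt.clm_apply (hasFDerivAt_const a y)).fderiv]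
    simp
  have h1 : ContDiffAt ℝ ∞ (fderiv ℝ V) y := hV.fderiv_right (by simp)
  have h2 := ((h1.differentiableAt (by simp)).hasFDerivAt.clm_apply (hasFDerivAt_const a y))
  have h3 := ((hΓ.differentiableAt (by simp)).hasFDerivAt.clm_apply (hasFDerivAt_const a y)).clm_apply
    (hV.differentiableAt (by simp)).hasFDerivAt
  rw [e1, show (fun z => flatNabla Γ V z a) = (fun z => fderiv ℝ V z a) + fun z => Γ z a (V z) from rfl,
    (h2.add h3).fderiv]
  simp only [add_apply, ContinuousLinearMap.comp_apply,
    ContinuousLinearMap.flip_apply, map_zero, zero_add, zero_apply]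
  abel

/-- The Ricci identity. -/
lemma flatNabla₂_sub_comm (hΓ : ContDiffAt ℝ ∞ Γ y) (hV : ContDiffAt ℝ ∞ V y)
    (hs : ∀ a b, Γ y a b = Γ y b a) (b a : E) :
    flatNabla₂ Γ V y b a - flatNabla₂ Γ V y a b = flatCurv Γ y b a (V y) := by
  have h : IsSymmSndFDerivAt ℝ V y := hV.isSymmSndFDerivAt two_le_infty
  simp only [flatNabla₂, fderiv_flatNabla hΓ hV, flatCurv, flatNabla_apply, map_add, h b a, hs a b]
  abel

/-- The twelve terms cancel in pairs. Symmetry of the derivative of `Γ` is a separate hypothesis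
because symmetry of `Γ` at the single point `y` does not imply it. -/
lemma flatCurv_bianchi (hd : ∀ a b c, fderiv ℝ Γ y c a b = fderiv ℝ Γ y c b a)
    (hs : ∀ a b, Γ y a b = Γ y b a) (a b c : E) :
    flatCurv Γ y a b c + flatCurv Γ y b c a + flatCurv Γ y c a b = 0 := by
  simp only [flatCurv, hd b a c, hd c a b, hd c b a, hs c b, hs c a, hs b a]
  rw [hd a c b]
  abel

namespace IsLeviCivitaOn

variable (h : IsLeviCivitaOn U G Γ) (hy : y ∈ U)
include h hy

lemma mem_nhds : U ∈ nhds y := h.isOpen.mem_nhds hy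

lemma contDiffAt_metric : ContDiffAt ℝ ∞ G y := h.contDiffOn_metric.contDiffAt (h.mem_nhds hy)

lemma contDiffAt_christoffel : ContDiffAt ℝ ∞ Γ y :=
  h.contDiffOn_christoffel.contDiffAt (h.mem_nhds hy)

lemma fderiv_christoffel_symm (a b c : E) : fderiv ℝ Γ y c a b = fderiv ℝ Γ y c b a := by
  have hΓ := ((h.contDiffAt_christoffel hy).differentiableAt (by simp)).hasFDerivAt
  have key : ∀ a b : E, fderiv ℝ Γ y c a b = fderiv ℝ (fun z => Γ z a b) y c := by
    intro a b
    rw [((hΓ.clm_apply (hasFDerivAt_const a y)).clm_apply (hasFDerivAt_const b y)).fderiv]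
    simp
  rw [key, key]
  congr 1
  apply Filter.EventuallyEq.fderiv_eq
  filter_upwards [h.mem_nhds hy] with z hz using h.symm z hz a b

/-- Differentiating metric compatibility expresses the second derivative of `G` through `Γ` and its
derivative; the symmetry of that second derivative in `a`, `b` is the claim. -/
lemma curv_skew (a b c d : E) :
    G y (flatCurv Γ y a b c) d = - G y c (flatCurv Γ y a b d) := by
  have hΓ := ((h.contDiffAt_christoffel hy).differentiableAt (by simp)).hasFDerivAt
  have hG := ((h.contDiffAt_metric hy).differentiableAt (by simp)).hasFDerivAt
  have hG1 : ContDiffAt ℝ ∞ (fderiv ℝ G) y := (h.contDiffAt_metric hy).fderiv_right (by simp)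
  have hG2 := (hG1.differentiableAt (by simp)).hasFDerivAt
  have hsymm : IsSymmSndFDerivAt ℝ G y := (h.contDiffAt_metric hy).isSymmSndFDerivAt two_le_infty
  have key : ∀ a b : E, fderiv ℝ (fderiv ℝ G) y a b c d =
      fderiv ℝ G y a (Γ y b c) d + G y (fderiv ℝ Γ y a b c) d +
      (fderiv ℝ G y a c (Γ y b d) + G y c (fderiv ℝ Γ y a b d)) := by
    intro a b
    have k (v : E) := (hΓ.clm_apply (hasFDerivAt_const b y)).clm_apply (hasFDerivAt_const v y)
    have e1 : fderiv ℝ (fderiv ℝ G) y a b c d = fderiv ℝ (fun z => fderiv ℝ G z b c d) y a := by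
      rw [(((hG2.clm_apply (hasFDerivAt_const b y)).clm_apply (hasFDerivAt_const c y)).clm_apply
        (hasFDerivAt_const d y)).fderiv]
      simp
    have e2 : (fun z => fderiv ℝ G z b c d) =ᶠ[nhds y]
        fun z => G z (Γ z b c) d + G z c (Γ z b d) := by
      filter_upwards [h.mem_nhds hy] with z hz using h.compat z hz b c d
    rw [e1, e2.fderiv_eq, (((hG.clm_apply (k c)).clm_apply (hasFDerivAt_const d y)).fun_add
      ((hG.clm_apply (hasFDerivAt_const c y)).clm_apply (k d))).fderiv]
    simp
    abel
  have := hsymm a b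
  have h2 := congrArg (fun L : E →L[ℝ] E →L[ℝ] ℝ => L c d) this
  simp only [key, h.compat y hy] at h2
  simp only [flatCurv, map_add, map_sub, add_apply,
    sub_apply]
  linarith

/-- Pure algebra: four instances of the Bianchi identity, combined with skewness in the first and in
the last pair of arguments. -/
lemma curv_pair (a b c d : E) :
    G y (flatCurv Γ y a b c) d = G y (flatCurv Γ y c d a) b := by
  have sk : ∀ a b c d, G y (flatCurv Γ y a b c) d = - G y (flatCurv Γ y a b d) c := by
    intro a b c d
    rw [h.curv_skew hy, h.metric_symm y hy]
  have sk' : ∀ a b c d, G y (flatCurv Γ y a b c) d = - G y (flatCurv Γ y b a c) d := by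
    intro a b c d
    rw [← neg_apply, ← map_neg]
    congr 2
    simp only [flatCurv]
    abel
  have bi : ∀ a b c d, G y (flatCurv Γ y a b c) d + G y (flatCurv Γ y b c a) d +
      G y (flatCurv Γ y c a b) d = 0 := by
    intro a b c d
    rw [← add_apply, ← map_add, ← add_apply, ← map_add,
      flatCurv_bianchi (h.fderiv_christoffel_symm hy) (h.symm y hy)]
    simp
  linarith [bi a b c d, bi b c d a, bi c d a b, bi d a b c, sk a b c d, sk b c a d, sk c a b d,
    sk b c d a, sk c d b a, sk d b c a, sk c d a b, sk d a c b, sk a c d b, sk d a b c,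
    sk a b d c, sk b d a c, sk' a b c d, sk' b c a d, sk' c a b d, sk' c d a b, sk' d a b c,
    sk' a c d b, sk' b d a c, sk' d b c a, sk' c d b a, sk' a b d c, sk' d a c b, sk' b c d a]

lemma flatInduced_symm (a b : E) : flatInduced G Γ V y a b = flatInduced G Γ V y b a := by
  rw [flatInduced_apply, flatInduced_apply, h.metric_symm y hy,
    h.metric_symm y hy (flatNabla Γ V y a)]

lemma flatInduced_pos {a : E} (ha : a ≠ 0) : 0 < flatInduced G Γ V y a a := by
  have h1 := h.metric_pos y hy a ha
  have h2 : 0 ≤ G y (flatNabla Γ V y a) (flatNabla Γ V y a) := by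
    by_cases h0 : flatNabla Γ V y a = 0
    · simp [h0]
    · exact (h.metric_pos y hy _ h0).le
  rw [flatInduced_apply]
  linarith

/-- Since `G` is parallel, only the Christoffel terms and the derivatives of the two factors `∇V`
remain. -/
lemma fderiv_flatInduced (hV : ContDiffAt ℝ ∞ V y) (c a b : E) :
    fderiv ℝ (flatInduced G Γ V) y c a b =
      flatInduced G Γ V y (Γ y c a) b + flatInduced G Γ V y a (Γ y c b) +
      G y (flatNabla₂ Γ V y c a) (flatNabla Γ V y b) +
      G y (flatNabla Γ V y a) (flatNabla₂ Γ V y c b) := by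
  have hG := ((h.contDiffAt_metric hy).differentiableAt (by simp)).hasFDerivAt
  have hC := ((contDiffAt_flatNabla (h.contDiffAt_christoffel hy) hV).differentiableAt
    (by simp)).hasFDerivAt
  have hCv (v : E) := hC.clm_apply (hasFDerivAt_const v y)
  have hH := ((contDiffAt_flatInduced (h.contDiffAt_metric hy) (h.contDiffAt_christoffel hy)
    hV).differentiableAt (by simp)).hasFDerivAt
  have e1 : fderiv ℝ (flatInduced G Γ V) y c a b =
      fderiv ℝ (fun z => G z a b + G z (flatNabla Γ V z a) (flatNabla Γ V z b)) y c := by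
    change _ = fderiv ℝ (fun z => flatInduced G Γ V z a b) y c
    rw [((hH.clm_apply (hasFDerivAt_const a y)).clm_apply (hasFDerivAt_const b y)).fderiv]
    simp
  rw [e1, (((hG.clm_apply (hasFDerivAt_const a y)).clm_apply (hasFDerivAt_const b y)).fun_add
    ((hG.clm_apply (hCv a)).clm_apply (hCv b))).fderiv]
  simp only [add_apply, ContinuousLinearMap.comp_apply, ContinuousLinearMap.flip_apply,
    map_zero, zero_add, zero_apply, h.compat y hy, flatNabla₂, flatInduced_apply, map_add,
    map_sub, sub_apply]
  ring

/-- The pointwise identity behind the Euler-Lagrange equation: here `Z = C^t u'` and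
`u = u' + C Z`, where `C = ∇V`. -/
lemma eulerLagrange_quadratic (hV : ContDiffAt ℝ ∞ V y) {Z u' : E}
    (hZ : ∀ a, G y Z a = G y (flatNabla Γ V y a) u') (e : E) :
    -(1 / 2) * fderiv ℝ (flatInduced G Γ V) y Z e e + fderiv ℝ (flatInduced G Γ V) y e e Z
      - fderiv ℝ (fun z => G z (flatNabla Γ V z e) (u' + flatNabla Γ V y Z)) y e
      + G y (flatNabla Γ V y e) (Γ y e (u' + flatNabla Γ V y Z)) =
    - G y (flatTension Γ V y e) u' := by
  set u := u' + flatNabla Γ V y Z with hu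
  have hΓ := h.contDiffAt_christoffel hy
  have hG := ((h.contDiffAt_metric hy).differentiableAt (by simp)).hasFDerivAt
  have hC := ((contDiffAt_flatNabla hΓ hV).differentiableAt (by simp)).hasFDerivAt
  have e1 : fderiv ℝ (fun z => G z (flatNabla Γ V z e) u) y e =
      G y (flatNabla₂ Γ V y e e) u + G y (flatNabla Γ V y (Γ y e e)) u +
        G y (flatNabla Γ V y e) (Γ y e u) := by
    rw [((hG.clm_apply (hC.clm_apply (hasFDerivAt_const e y))).clm_apply
      (hasFDerivAt_const u y)).fderiv]
    simp only [add_apply, ContinuousLinearMap.comp_apply, ContinuousLinearMap.flip_apply,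
      map_zero, zero_add, zero_apply, h.compat y hy, flatNabla₂, map_add, map_sub, sub_apply]
    ring
  -- The purpose of `u = u' + C Z`: the vector `Z` represents `G(C·, u)` with respect to `H`, so the
  -- terms with `Γ(e, e)` cancel.
  have hHZ : ∀ a, flatInduced G Γ V y Z a = G y (flatNabla Γ V y a) u := by
    intro a
    rw [flatInduced_apply, hZ, hu, map_add, h.metric_symm y hy (flatNabla Γ V y Z)]
  have hHs := h.flatInduced_symm (Γ := Γ) (V := V) hy
  -- `∂_Z H(e, e)` contributes `∇²_{Z,e} V` and `∂_e H(e, Z)` contributes `∇²_{e,Z} V`; their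
  -- difference is the only source of curvature.
  have hric := flatNabla₂_sub_comm hΓ hV (h.symm y hy) e Z
  -- Pair symmetry moves `Z` out of the curvature, where `Z = Cᵗ u'` can be used.
  have hR : G y (flatCurv Γ y e Z (V y)) (flatNabla Γ V y e) =
      G y (flatNabla Γ V y (flatCurv Γ y (V y) (flatNabla Γ V y e) e)) u' := by
    rw [h.curv_pair hy, ← hZ, h.metric_symm y hy]
  rw [e1, h.fderiv_flatInduced hy hV, h.fderiv_flatInduced hy hV, hHs _ Z, hHZ,
    h.symm y hy Z e, hHs (Γ y e Z) e,
    flatTension, map_sub, sub_apply, ← hR, ← hric, map_sub, sub_apply, hu, map_add,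
    h.metric_symm y hy (flatNabla Γ V y e) (flatNabla₂ Γ V y Z e),
    h.metric_symm y hy (flatNabla Γ V y e) (flatNabla₂ Γ V y e Z)]
  simp only [map_add]
  ring

end IsLeviCivitaOn

end Flat

/-! ### Derivatives of determinants and inverses of matrices. -/

section MatrixCalculus

variable {E : Type*} [NormedAddCommGroup E] [NormedSpace ℝ E] {ι : Type*} [Fintype ι]
  [DecidableEq ι] {A : E → Matrix ι ι ℝ} {A' : ι → ι → E →L[ℝ] ℝ} {y : E}

lemma contDiffAt_matrix_det {k : ℕ∞ω} (hA : ∀ i j, ContDiffAt ℝ k (fun z => A z i j) y) :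
    ContDiffAt ℝ k (fun z => (A z).det) y := by
  simp only [Matrix.det_apply']
  exact ContDiffAt.sum fun σ _ => contDiffAt_const.mul (contDiffAt_prod fun i _ => hA _ _)

lemma contDiffAt_matrix_inv {k : ℕ∞ω} (hA : ∀ i j, ContDiffAt ℝ k (fun z => A z i j) y)
    (h0 : (A y).det ≠ 0) (i j : ι) : ContDiffAt ℝ k (fun z => (A z)⁻¹ i j) y := by
  simp only [Matrix.inv_def, Ring.inverse_eq_inv', Matrix.smul_apply, smul_eq_mul,
    Matrix.adjugate_apply]
  refine ((contDiffAt_matrix_det hA).inv h0).mul (contDiffAt_matrix_det fun k l => ?_)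
  simp only [Matrix.updateRow_apply]
  split_ifs
  · exact contDiffAt_const
  · exact hA k l

/-- Jacobi's formula. -/
lemma hasFDerivAt_matrix_det (hA : ∀ i j, HasFDerivAt (fun z => A z i j) (A' i j) y) :
    ∃ L : E →L[ℝ] ℝ, HasFDerivAt (fun z => (A z).det) L y ∧
      ∀ c, L c = ((A y).adjugate * Matrix.of fun i j => A' i j c).trace := by
  -- The determinant as a multilinear map of the rows: its derivative is the sum over `i` of
  -- determinants with the `i`-th row replaced, and Cramer's rule identifies these with entries of
  -- the adjugate product.
  let D : ContinuousMultilinearMap ℝ (fun _ : ι => ι → ℝ) ℝ :=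
    { (Matrix.detRowAlternating (n := ι) (R := ℝ)).toMultilinearMap with
      cont := (continuous_id (X := Matrix ι ι ℝ)).matrix_det }
  have hD : ∀ N : Matrix ι ι ℝ, D N = N.det := fun _ => rfl
  have hrow : ∀ i, HasFDerivAt (fun z => A z i) (ContinuousLinearMap.pi (A' i)) y :=
    fun i => hasFDerivAt_pi.2 fun j => hA i j
  have key := HasFDerivAt.multilinear_comp D hrow
  refine ⟨_, key, fun c => ?_⟩
  simp only [Matrix.trace, Matrix.diag, Matrix.mul_apply, sum_apply,
    ContinuousLinearMap.comp_apply]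
  rw [Finset.sum_comm]
  refine Finset.sum_congr rfl fun i _ => ?_
  have h1 : D.toContinuousLinearMap (A y ·) i (ContinuousLinearMap.pi (A' i) c) =
      ((A y).updateRow i fun j => A' i j c).det := rfl
  rw [h1, ← Matrix.cramer_transpose_apply, Matrix.cramer_eq_adjugate_mulVec,
    ← Matrix.adjugate_transpose]
  rfl

/-- Jacobi's formula with `adj A = det A · A⁻¹`; dividing by `2 √det A` leaves half of one root of
the determinant. -/
lemma hasFDerivAt_sqrt_det (hA : ∀ i j, HasFDerivAt (fun z => A z i j) (A' i j) y)
    (h0 : 0 < (A y).det) :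
    ∃ L : E →L[ℝ] ℝ, HasFDerivAt (fun z => Real.sqrt (A z).det) L y ∧
      ∀ c, L c = 1 / 2 * Real.sqrt (A y).det *
        ((A y)⁻¹ * Matrix.of fun i j => A' i j c).trace := by
  obtain ⟨L, hL, hLc⟩ := hasFDerivAt_matrix_det hA
  refine ⟨_, hL.sqrt h0.ne', fun c => ?_⟩
  rw [Matrix.inv_def, Ring.inverse_eq_inv', Matrix.smul_mul, Matrix.trace_smul, smul_eq_mul]
  change 1 / (2 * Real.sqrt (A y).det) * L c = _
  rw [hLc]
  have h1 : Real.sqrt (A y).det ≠ 0 := (Real.sqrt_pos.2 h0).ne'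
  have h2 : (A y).det = Real.sqrt (A y).det * Real.sqrt (A y).det :=
    (Real.mul_self_sqrt h0.le).symm
  generalize ((A y).adjugate * Matrix.of fun i j => A' i j c).trace = t
  have h3 : ((A y).det)⁻¹ = (Real.sqrt (A y).det)⁻¹ * (Real.sqrt (A y).det)⁻¹ := by
    rw [← mul_inv, ← h2]
  rw [h3]
  field_simp

/-- Obtained by differentiating `A⁻¹ A = 1`, which holds near `y` because the determinant stays
non-zero there. -/
lemma fderiv_matrix_inv (hA : ∀ i j, ContDiffAt ℝ ∞ (fun z => A z i j) y)
    (h0 : (A y).det ≠ 0) (c : E) :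
    (Matrix.of fun i j => fderiv ℝ (fun z => (A z)⁻¹ i j) y c) =
      - ((A y)⁻¹ * (Matrix.of fun i j => fderiv ℝ (fun z => A z i j) y c) * (A y)⁻¹) := by
  have hI := contDiffAt_matrix_inv hA h0
  have hev : ∀ᶠ z in nhds y, (A z).det ≠ 0 :=
    (contDiffAt_matrix_det hA).continuousAt.eventually_ne h0
  have key : (Matrix.of fun i j => fderiv ℝ (fun z => (A z)⁻¹ i j) y c) * A y +
      (A y)⁻¹ * (Matrix.of fun i j => fderiv ℝ (fun z => A z i j) y c) = 0 := by
    ext i j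
    have h1 : HasFDerivAt (fun z => ∑ k, (A z)⁻¹ i k * A z k j)
        (∑ k, ((A y)⁻¹ i k • fderiv ℝ (fun z => A z k j) y +
          A y k j • fderiv ℝ (fun z => (A z)⁻¹ i k) y)) y :=
      HasFDerivAt.fun_sum fun k _ => ((hI i k).differentiableAt (by simp)).hasFDerivAt.mul
        ((hA k j).differentiableAt (by simp)).hasFDerivAt
    have h2 : (fun z => ∑ k, (A z)⁻¹ i k * A z k j) =ᶠ[nhds y]
        fun _ => (1 : Matrix ι ι ℝ) i j := by
      filter_upwards [hev] with z hz
      rw [← Matrix.mul_apply, Matrix.nonsing_inv_mul _ (isUnit_iff_ne_zero.2 hz)]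
    have h3 := h1.unique ((hasFDerivAt_const _ y).congr_of_eventuallyEq h2)
    have h4 := congrArg (fun L : E →L[ℝ] ℝ => L c) h3
    simp only [sum_apply, add_apply, smul_apply, smul_eq_mul, zero_apply,
      Finset.sum_add_distrib] at h4
    simp only [Matrix.add_apply, Matrix.mul_apply, Matrix.of_apply, Matrix.zero_apply]
    rw [← h4, add_comm]
    simp only [mul_comm]
  have hu : IsUnit (A y).det := isUnit_iff_ne_zero.2 h0
  have := congrArg (· * (A y)⁻¹) (eq_neg_of_add_eq_zero_left key)
  simpa [Matrix.mul_assoc, Matrix.mul_nonsing_inv _ hu] using this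

end MatrixCalculus

/-! ### Gram matrices of bilinear forms and traces in orthogonal bases. -/

section Gram

variable {n : ℕ}

/-- The matrix of a bilinear form in the standard basis. -/
def gram (B : Model n →L[ℝ] Model n →L[ℝ] ℝ) : Matrix (Fin n) (Fin n) ℝ :=
  Matrix.of fun i j => B (stdBasis i) (stdBasis j)

variable {H B : Model n →L[ℝ] Model n →L[ℝ] ℝ}

@[simp] lemma gram_apply (i j : Fin n) : gram B i j = B (stdBasis i) (stdBasis j) := rfl

lemma eq_sum_stdBasis (a : Model n) : a = ∑ i, a i • stdBasis i := by
  simpa using ((EuclideanSpace.basisFun (Fin n) ℝ).sum_repr a).symm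

lemma bilin_eq_sum (a b : Model n) : B a b = ∑ i, ∑ j, a i * gram B i j * b j := by
  conv_lhs => rw [eq_sum_stdBasis a, eq_sum_stdBasis b]
  simp only [map_sum, map_smul, sum_apply, smul_apply, smul_eq_mul, Finset.mul_sum, gram_apply]
  rw [Finset.sum_comm]
  exact Finset.sum_congr rfl fun i _ => Finset.sum_congr rfl fun j _ => by ring

lemma gram_det_pos (hs : ∀ a b, H a b = H b a) (hp : ∀ a, a ≠ 0 → 0 < H a a) :
    0 < (gram H).det := by
  refine Matrix.PosDef.det_pos (Matrix.PosDef.of_dotProduct_mulVec_pos ?_ fun x hx => ?_)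
  · ext i j
    simpa [gram] using hs _ _
  · have h1 := hp (WithLp.toLp 2 x) (by simpa using hx)
    rw [bilin_eq_sum] at h1
    simpa [dotProduct, Matrix.mulVec, Finset.mul_sum, mul_assoc] using h1

/-- The vector representing a linear form with respect to a positive definite bilinear form. -/
lemma gram_inv_apply (hs : ∀ a b, H a b = H b a) (hp : ∀ a, a ≠ 0 → 0 < H a a)
    (f : Model n →L[ℝ] ℝ) (a : Model n) :
    H (∑ b, (∑ a, (gram H)⁻¹ b a * f (stdBasis a)) • stdBasis b) a = f a := by
  have key : ∀ j, H (∑ b, (∑ a, (gram H)⁻¹ b a * f (stdBasis a)) • stdBasis b) (stdBasis j) =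
      f (stdBasis j) := by
    intro j
    have h1 : H (∑ b, (∑ a, (gram H)⁻¹ b a * f (stdBasis a)) • stdBasis b) (stdBasis j) =
        ((gram H).mulVec ((gram H)⁻¹.mulVec fun a => f (stdBasis a))) j := by
      rw [hs, map_sum]
      simp only [map_smul, smul_eq_mul]
      refine Finset.sum_congr rfl fun b _ => ?_
      rw [mul_comm]
      rfl
    rw [h1, Matrix.mulVec_mulVec, Matrix.mul_nonsing_inv _
      (isUnit_iff_ne_zero.2 (gram_det_pos hs hp).ne'), Matrix.one_mulVec]
  conv_lhs => rw [eq_sum_stdBasis a]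
  conv_rhs => rw [eq_sum_stdBasis a]
  simp only [map_sum, map_smul] at key ⊢
  simp only [key]

lemma eq_of_forall_form_eq {E : Type*} [NormedAddCommGroup E] [NormedSpace ℝ E]
    {H : E →L[ℝ] E →L[ℝ] ℝ} (hp : ∀ a, a ≠ 0 → 0 < H a a)
    {a b : E} (hab : ∀ c, H a c = H b c) : a = b := by
  by_contra hne
  have h1 := hp (a - b) (sub_ne_zero.2 hne)
  have h2 : H (a - b) = 0 := by
    ext c
    rw [map_sub, sub_apply, hab, sub_self, zero_apply]
  rw [h2] at h1
  exact h1.ne rfl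

/-- The trace of a bilinear form `B` with respect to `H`, in an orthogonal basis of `H`. -/
lemma trace_gram_eq_sum (e : Fin n → Model n) (d : Fin n → ℝ) (hd : ∀ i, d i ≠ 0)
    (he : ∀ i j, H (e i) (e j) = if i = j then d i else 0) :
    ((gram H)⁻¹ * gram B).trace = ∑ i, 1 / d i * B (e i) (e i) := by
  -- The columns of `P` are the vectors `e i`, so that conjugation by `P` passes from the standard
  -- basis to `e`.
  let P : Matrix (Fin n) (Fin n) ℝ := Matrix.of fun k i => e i k
  have hP : ∀ (K : Model n →L[ℝ] Model n →L[ℝ] ℝ) i j,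
      (P.transpose * gram K * P) i j = K (e i) (e j) := by
    intro K i j
    rw [bilin_eq_sum, Matrix.mul_apply]
    simp only [Matrix.mul_apply, Finset.sum_mul, P, Matrix.transpose_apply, Matrix.of_apply]
    rw [Finset.sum_comm]
  have hD : P.transpose * gram H * P = Matrix.diagonal d := by
    ext i j
    rw [hP, he, Matrix.diagonal_apply]
  -- Independence of the `e i` is not assumed: it follows from `det (Pᵀ H P) = ∏ d i ≠ 0`.
  have hdet : P.det ≠ 0 := by
    intro h0
    have h1 := congrArg Matrix.det hD
    rw [Matrix.det_mul, h0, mul_zero, Matrix.det_diagonal] at h1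
    exact Finset.prod_ne_zero_iff.2 (fun i _ => hd i) h1.symm
  have hu : IsUnit P.det := isUnit_iff_ne_zero.2 hdet
  have hinv : (gram H)⁻¹ = P * Matrix.diagonal (fun i => 1 / d i) * P.transpose := by
    refine Matrix.inv_eq_left_inv ?_
    have h2 : P * Matrix.diagonal (fun i => 1 / d i) * P.transpose * gram H * P = P := by
      rw [Matrix.mul_assoc, Matrix.mul_assoc, ← Matrix.mul_assoc P.transpose, hD, Matrix.mul_assoc,
        Matrix.diagonal_mul_diagonal]
      have : (fun i => 1 / d i * d i) = fun _ => 1 := by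
        ext i; exact one_div_mul_cancel (hd i)
      rw [this, Matrix.diagonal_one, Matrix.mul_one]
    have h3 := congrArg (· * P⁻¹) h2
    simpa only [Matrix.mul_assoc, Matrix.mul_nonsing_inv _ hu, Matrix.mul_one] using h3
  rw [hinv, Matrix.mul_assoc, Matrix.mul_assoc, Matrix.trace_mul_comm, Matrix.mul_assoc,
    Matrix.trace]
  refine Finset.sum_congr rfl fun i _ => ?_
  rw [Matrix.diag_apply, Matrix.diagonal_mul, hP]

end Gram

/-! ### The first variation of the density, and its divergence part, in coordinates. -/

section FirstVariation

variable {n : ℕ} {U : Set (Model n)} {G : Model n → Model n →L[ℝ] Model n →L[ℝ] ℝ}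
  {Γ : Model n → Model n →L[ℝ] Model n →L[ℝ] Model n} {V W : Model n → Model n} {y : Model n}

/-- The volume density of the metric induced by the section `V`. -/
def flatDensity (G : Model n → Model n →L[ℝ] Model n →L[ℝ] ℝ)
    (Γ : Model n → Model n →L[ℝ] Model n →L[ℝ] Model n) (V : Model n → Model n)
    (y : Model n) : ℝ :=
  Real.sqrt (gram (flatInduced G Γ V y)).det

/-- The first variation of the volume density of `V` in the direction `W`. -/
def flatFirstVar (G : Model n → Model n →L[ℝ] Model n →L[ℝ] ℝ)
    (Γ : Model n → Model n →L[ℝ] Model n →L[ℝ] Model n) (V W : Model n → Model n)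
    (y : Model n) : ℝ :=
  flatDensity G Γ V y * ((gram (flatInduced G Γ V y))⁻¹ *
    gram ((G y).bilinearComp (flatNabla Γ V y) (flatNabla Γ W y))).trace

/-- The vector field whose divergence is the difference of the first variation and the
Euler-Lagrange expression. -/
def flatFlux (G : Model n → Model n →L[ℝ] Model n →L[ℝ] ℝ)
    (Γ : Model n → Model n →L[ℝ] Model n →L[ℝ] Model n) (V W : Model n → Model n)
    (b : Fin n) (y : Model n) : ℝ :=
  flatDensity G Γ V y * ∑ a, (gram (flatInduced G Γ V y))⁻¹ b a *
    G y (flatNabla Γ V y (stdBasis a)) (W y)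

/-- The vector `Z` with `H(Z, ·) = G(∇V ·, u)`, where `H` is the induced metric. -/
def fluxVector (G : Model n → Model n →L[ℝ] Model n →L[ℝ] ℝ)
    (Γ : Model n → Model n →L[ℝ] Model n →L[ℝ] Model n) (V : Model n → Model n)
    (y u : Model n) : Model n :=
  ∑ b, (∑ a, (gram (flatInduced G Γ V y))⁻¹ b a * G y (flatNabla Γ V y (stdBasis a)) u) •
    stdBasis b

/-- The bilinear form whose trace is the Euler-Lagrange expression. -/
def eulerLagrangeForm (G : Model n → Model n →L[ℝ] Model n →L[ℝ] ℝ)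
    (Γ : Model n → Model n →L[ℝ] Model n →L[ℝ] Model n) (V : Model n → Model n)
    (y u : Model n) : Model n →L[ℝ] Model n →L[ℝ] ℝ :=
  (-(1 / 2) : ℝ) • fderiv ℝ (flatInduced G Γ V) y (fluxVector G Γ V y u)
    + (ContinuousLinearMap.compL ℝ (Model n) (Model n →L[ℝ] ℝ) ℝ
        (ContinuousLinearMap.apply ℝ ℝ (fluxVector G Γ V y u))).comp
          (fderiv ℝ (flatInduced G Γ V) y).flip
    - (fderiv ℝ (fun z => ((G z).flip u).comp (flatNabla Γ V z)) y).flip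
    + (G y).bilinearComp (flatNabla Γ V y) ((Γ y).flip u)

/-- The Euler-Lagrange expression of the volume at `V`, evaluated on `u`. -/
def flatEulerLagrange (G : Model n → Model n →L[ℝ] Model n →L[ℝ] ℝ)
    (Γ : Model n → Model n →L[ℝ] Model n →L[ℝ] Model n) (V : Model n → Model n)
    (y u : Model n) : ℝ :=
  flatDensity G Γ V y *
    ((gram (flatInduced G Γ V y))⁻¹ * gram (eulerLagrangeForm G Γ V y u)).trace

namespace IsLeviCivitaOn

variable (h : IsLeviCivitaOn U G Γ) (hy : y ∈ U)
include h hy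

lemma det_gram_pos : 0 < (gram (flatInduced G Γ V y)).det :=
  gram_det_pos (h.flatInduced_symm hy) fun _ => h.flatInduced_pos hy

lemma flatInduced_fluxVector (u a : Model n) :
    flatInduced G Γ V y (fluxVector G Γ V y u) a = G y (flatNabla Γ V y a) u := by
  exact gram_inv_apply (h.flatInduced_symm hy) (fun _ => h.flatInduced_pos hy)
    (((G y).flip u).comp (flatNabla Γ V y)) a

lemma contDiffAt_gram (hV : ContDiffAt ℝ ∞ V y) (i j : Fin n) :
    ContDiffAt ℝ ∞ (fun z => gram (flatInduced G Γ V z) i j) y :=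
  ((contDiffAt_flatInduced (h.contDiffAt_metric hy) (h.contDiffAt_christoffel hy) hV).clm_apply
    contDiffAt_const).clm_apply contDiffAt_const

lemma contDiffAt_flatDensity (hV : ContDiffAt ℝ ∞ V y) :
    ContDiffAt ℝ ∞ (flatDensity G Γ V) y :=
  (contDiffAt_matrix_det (h.contDiffAt_gram hy hV)).sqrt (h.det_gram_pos hy).ne'

lemma contDiffAt_flatFlux (hV : ContDiffAt ℝ ∞ V y) (hW : ContDiffAt ℝ ∞ W y) (b : Fin n) :
    ContDiffAt ℝ ∞ (flatFlux G Γ V W b) y := by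
  refine (h.contDiffAt_flatDensity hy hV).mul (ContDiffAt.sum fun a _ => ?_)
  exact (contDiffAt_matrix_inv (h.contDiffAt_gram hy hV) (h.det_gram_pos hy).ne' b a).mul
    (((h.contDiffAt_metric hy).clm_apply ((contDiffAt_flatNabla (h.contDiffAt_christoffel hy)
      hV).clm_apply contDiffAt_const)).clm_apply hW)

lemma fderiv_gram (hV : ContDiffAt ℝ ∞ V y) (c : Model n) :
    (Matrix.of fun i j => fderiv ℝ (fun z => gram (flatInduced G Γ V z) i j) y c) =
      gram (fderiv ℝ (flatInduced G Γ V) y c) := by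
  ext i j
  have hH := ((contDiffAt_flatInduced (h.contDiffAt_metric hy) (h.contDiffAt_christoffel hy)
    hV).differentiableAt (by simp)).hasFDerivAt
  simp only [Matrix.of_apply, gram_apply]
  rw [((hH.clm_apply (hasFDerivAt_const (stdBasis i) y)).clm_apply
    (hasFDerivAt_const (stdBasis j) y)).fderiv]
  simp

lemma fderiv_flatDensity (hV : ContDiffAt ℝ ∞ V y) (c : Model n) :
    fderiv ℝ (flatDensity G Γ V) y c = 1 / 2 * flatDensity G Γ V y *
      ((gram (flatInduced G Γ V y))⁻¹ * gram (fderiv ℝ (flatInduced G Γ V) y c)).trace := by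
  obtain ⟨L, hL, hLc⟩ := hasFDerivAt_sqrt_det
    (fun i j => ((h.contDiffAt_gram hy hV i j).differentiableAt (by simp)).hasFDerivAt)
    (h.det_gram_pos hy)
  have : fderiv ℝ (flatDensity G Γ V) y = L := hL.fderiv
  rw [this, hLc, h.fderiv_gram hy hV]
  rfl

/-- The divergence of the flux is the first variation minus the Euler-Lagrange expression. -/
lemma sum_fderiv_flatFlux (hV : ContDiffAt ℝ ∞ V y) (hW : DifferentiableAt ℝ W y) :
    ∑ b, fderiv ℝ (flatFlux G Γ V W b) y (stdBasis b) =
      flatFirstVar G Γ V W y - flatEulerLagrange G Γ V y (W y) := by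
  set u := W y with hu
  set Hi := (gram (flatInduced G Γ V y))⁻¹ with hHi
  set Z := fluxVector G Γ V y u with hZ
  set D := flatDensity G Γ V y with hDdef
  have hG := ((h.contDiffAt_metric hy).differentiableAt (by simp)).hasFDerivAt
  have hC := ((contDiffAt_flatNabla (h.contDiffAt_christoffel hy) hV).differentiableAt
    (by simp)).hasFDerivAt
  have hD := ((h.contDiffAt_flatDensity hy hV).differentiableAt (by simp)).hasFDerivAt
  have hI (b a : Fin n) := ((contDiffAt_matrix_inv (h.contDiffAt_gram hy hV)
    (h.det_gram_pos hy).ne' b a).differentiableAt (by simp)).hasFDerivAt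
  have hN : DifferentiableAt ℝ (fun z => ((G z).flip u).comp (flatNabla Γ V z)) y := by
    have hf : ContDiff ℝ ∞ (fun L : Model n →L[ℝ] Model n →L[ℝ] ℝ => L.flip) :=
      (ContinuousLinearMap.flipₗᵢ ℝ (Model n) (Model n) ℝ).toContinuousLinearEquiv.contDiff
    have h1 : ContDiffAt ℝ ∞ (fun z => (G z).flip u) y :=
      (hf.contDiffAt.comp y (h.contDiffAt_metric hy)).clm_apply contDiffAt_const
    exact (h1.clm_comp (contDiffAt_flatNabla (h.contDiffAt_christoffel hy) hV)).differentiableAt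
      (by simp)
  have hNa (a b : Model n) :
      fderiv ℝ (fun z => ((G z).flip u).comp (flatNabla Γ V z)) y b a =
        fderiv ℝ (fun z => G z (flatNabla Γ V z a) u) y b := by
    have : fderiv ℝ (fun z => G z (flatNabla Γ V z a) u) y = _ :=
      (hN.hasFDerivAt.clm_apply (hasFDerivAt_const a y)).fderiv
    rw [this]
    simp
  -- The only place where the derivative of `W` enters. Everything else involves `W` through the
  -- frozen value `u`, which is what makes the Euler-Lagrange expression pointwise in `u`.
  have hGCW (a b : Fin n) :
      fderiv ℝ (fun z => G z (flatNabla Γ V z (stdBasis a)) (W z)) y (stdBasis b) =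
        fderiv ℝ (fun z => ((G z).flip u).comp (flatNabla Γ V z)) y (stdBasis b) (stdBasis a) +
          G y (flatNabla Γ V y (stdBasis a)) (fderiv ℝ W y (stdBasis b)) := by
    rw [hNa]
    have e1 := (hG.clm_apply (hC.clm_apply (hasFDerivAt_const (stdBasis a) y)))
    rw [(e1.clm_apply hW.hasFDerivAt).fderiv, (e1.clm_apply (hasFDerivAt_const u y)).fderiv]
    simp only [add_apply, ContinuousLinearMap.comp_apply, ContinuousLinearMap.flip_apply,
      map_zero, zero_add, zero_apply, ← hu]
    ring
  have hGd (a : Fin n) :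
      HasFDerivAt (fun z => G z (flatNabla Γ V z (stdBasis a)) (W z))
        (fderiv ℝ (fun z => G z (flatNabla Γ V z (stdBasis a)) (W z)) y) y :=
    ((hG.clm_apply (hC.clm_apply (hasFDerivAt_const (stdBasis a) y))).clm_apply
      hW.hasFDerivAt).differentiableAt.hasFDerivAt
  have hIc (c : Model n) (b a : Fin n) :
      fderiv ℝ (fun z => (gram (flatInduced G Γ V z))⁻¹ b a) y c =
        - (Hi * gram (fderiv ℝ (flatInduced G Γ V) y c) * Hi) b a := by
    have := fderiv_matrix_inv (h.contDiffAt_gram hy hV) (h.det_gram_pos hy).ne' c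
    rw [h.fderiv_gram hy hV] at this
    exact congrFun (congrFun this b) a
  have hflux (b : Fin n) : fderiv ℝ (flatFlux G Γ V W b) y (stdBasis b) =
      D * ∑ a, (Hi b a * (fderiv ℝ (fun z => ((G z).flip u).comp (flatNabla Γ V z)) y
          (stdBasis b) (stdBasis a) + G y (flatNabla Γ V y (stdBasis a))
            (fderiv ℝ W y (stdBasis b)))
        - G y (flatNabla Γ V y (stdBasis a)) u *
          (Hi * gram (fderiv ℝ (flatInduced G Γ V) y (stdBasis b)) * Hi) b a)
      + (∑ a, Hi b a * G y (flatNabla Γ V y (stdBasis a)) u) *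
        (1 / 2 * D * (Hi * gram (fderiv ℝ (flatInduced G Γ V) y (stdBasis b))).trace) := by
    have : fderiv ℝ (flatFlux G Γ V W b) y = _ :=
      (hD.mul (HasFDerivAt.fun_sum fun a (_ : a ∈ Finset.univ) => (hI b a).mul (hGd a))).fderiv
    rw [this]
    simp only [add_apply, smul_apply, sum_apply, smul_eq_mul, hGCW, hIc,
      h.fderiv_flatDensity hy hV]
    rw [← hDdef, ← hHi]
    simp only [mul_neg, sub_eq_add_neg, hu]
    rfl
  have hZb : ∀ b, (∑ a, Hi b a * G y (flatNabla Γ V y (stdBasis a)) u) = Z b := by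
    intro b
    simp [hZ, fluxVector, Finset.sum_apply, Pi.single_apply, hHi]
  -- The derivatives of the density combine into one derivative in the direction `Z`, by linearity
  -- in the direction.
  have t1 : ∑ b, Z b * (Hi * gram (fderiv ℝ (flatInduced G Γ V) y (stdBasis b))).trace =
      (Hi * gram (fderiv ℝ (flatInduced G Γ V) y Z)).trace := by
    have : gram (fderiv ℝ (flatInduced G Γ V) y Z) =
        ∑ b, Z b • gram (fderiv ℝ (flatInduced G Γ V) y (stdBasis b)) := by
      ext i j
      conv_lhs => rw [eq_sum_stdBasis Z]
      simp only [gram_apply, map_sum, map_smul, sum_apply, smul_apply, Matrix.sum_apply,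
        Matrix.smul_apply]
    rw [this, Matrix.mul_sum, Matrix.trace_sum]
    simp only [Matrix.mul_smul, Matrix.trace_smul, smul_eq_mul]
  -- The derivative of `H⁻¹` is `-H⁻¹ H' H⁻¹`; its right factor `H⁻¹`, contracted with `G(C·, u)`,
  -- is again `Z`.
  have t2 : ∑ b, ∑ a, G y (flatNabla Γ V y (stdBasis a)) u *
      (Hi * gram (fderiv ℝ (flatInduced G Γ V) y (stdBasis b)) * Hi) b a =
        ∑ b, ∑ c, Hi b c * fderiv ℝ (flatInduced G Γ V) y (stdBasis b) (stdBasis c) Z := by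
    refine Finset.sum_congr rfl fun b _ => ?_
    have e1 : ∀ c, fderiv ℝ (flatInduced G Γ V) y (stdBasis b) (stdBasis c) Z =
        ∑ d, Z d * gram (fderiv ℝ (flatInduced G Γ V) y (stdBasis b)) c d := by
      intro c
      conv_lhs => rw [eq_sum_stdBasis Z]
      simp only [gram_apply, map_sum, map_smul, smul_eq_mul]
    simp only [e1, ← hZb, Matrix.mul_apply, Finset.mul_sum, Finset.sum_mul]
    rw [Finset.sum_comm]
    rw [Finset.sum_congr rfl fun d _ => Finset.sum_comm]
    rw [Finset.sum_comm]
    refine Finset.sum_congr rfl fun c _ => Finset.sum_congr rfl fun d _ =>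
      Finset.sum_congr rfl fun a _ => ?_
    ring
  simp only [hflux, hZb]
  rw [flatFirstVar, flatEulerLagrange, ← hHi, ← hDdef]
  simp only [eulerLagrangeForm, ← hZ]
  simp only [Finset.sum_add_distrib, ← Finset.mul_sum, Finset.sum_sub_distrib, t2]
  have t1' : ∑ b, Z b * (1 / 2 * D *
      (Hi * gram (fderiv ℝ (flatInduced G Γ V) y (stdBasis b))).trace) =
      D * (1 / 2 * (Hi * gram (fderiv ℝ (flatInduced G Γ V) y Z)).trace) := by
    rw [← t1, Finset.mul_sum, Finset.mul_sum]
    exact Finset.sum_congr rfl fun b _ => by ring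
  have tr : ∀ B : Model n →L[ℝ] Model n →L[ℝ] ℝ,
      (Hi * gram B).trace = ∑ b, ∑ a, Hi b a * B (stdBasis a) (stdBasis b) := fun B => rfl
  rw [t1', ← mul_add, ← mul_sub]
  congr 1
  simp only [tr, add_apply, sub_apply, smul_apply, ContinuousLinearMap.comp_apply,
    ContinuousLinearMap.flip_apply, ContinuousLinearMap.bilinearComp_apply,
    ContinuousLinearMap.compL_apply, ContinuousLinearMap.apply_apply, flatNabla_apply, smul_eq_mul,
    mul_add, mul_sub, Finset.sum_add_distrib, Finset.sum_sub_distrib, map_add, Finset.mul_sum, hu]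
  have e3 : ∀ b a : Fin n, Hi b a * (-(1 / 2) * (fderiv ℝ (flatInduced G Γ V) y Z)
      (stdBasis a) (stdBasis b)) = - (1 / 2 * (Hi b a * (fderiv ℝ (flatInduced G Γ V) y Z)
      (stdBasis a) (stdBasis b))) := fun b a => by ring
  simp only [e3, Finset.sum_neg_distrib]
  abel

end IsLeviCivitaOn

end FirstVariation

/-! ### The Euler-Lagrange expression in an eigenframe, and the unit constraint. -/

section EulerLagrange

variable {n : ℕ} {U : Set (Model n)} {G : Model n → Model n →L[ℝ] Model n →L[ℝ] ℝ}
  {Γ : Model n → Model n →L[ℝ] Model n →L[ℝ] Model n} {V W : Model n → Model n} {y : Model n}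

namespace IsLeviCivitaOn

variable (h : IsLeviCivitaOn U G Γ) (hy : y ∈ U)
include h hy

lemma flatDensity_pos : 0 < flatDensity G Γ V y := Real.sqrt_pos.2 (h.det_gram_pos hy)

variable {e : Fin n → Model n} {l : Fin n → ℝ}

lemma eigenvalue_nonneg
    (hCe : ∀ i j, G y (flatNabla Γ V y (e i)) (flatNabla Γ V y (e j)) = if i = j then l i else 0)
    (i : Fin n) : 0 ≤ l i := by
  have h1 := hCe i i
  rw [if_pos rfl] at h1
  rw [← h1]
  by_cases h0 : flatNabla Γ V y (e i) = 0
  · simp [h0]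
  · exact (h.metric_pos y hy _ h0).le

/-- An eigenframe of `CᵗC` is also `H`-orthogonal, with `H(e_i, e_i) = 1 + λ_i²`; this is the origin
of the weights `c_i²`. -/
lemma trace_gram_flatInduced
    (hGe : ∀ i j, G y (e i) (e j) = if i = j then 1 else 0)
    (hCe : ∀ i j, G y (flatNabla Γ V y (e i)) (flatNabla Γ V y (e j)) = if i = j then l i else 0)
    (B : Model n →L[ℝ] Model n →L[ℝ] ℝ) :
    ((gram (flatInduced G Γ V y))⁻¹ * gram B).trace = ∑ i, 1 / (1 + l i) * B (e i) (e i) := by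
  refine trace_gram_eq_sum e (fun i => 1 + l i) (fun i => ?_) fun i j => ?_
  · have := h.eigenvalue_nonneg hy hCe i
    positivity
  · rw [flatInduced_apply, hGe, hCe]
    split_ifs <;> simp

/-- The vector `Z = Cᵗ u'` is the flux vector of `u' + C Z`, by non-degeneracy of `H`. The trace is
then expanded in the eigenframe, and `eulerLagrange_quadratic` applies to each summand. -/
lemma flatEulerLagrange_eq (hV : ContDiffAt ℝ ∞ V y)
    (hGe : ∀ i j, G y (e i) (e j) = if i = j then 1 else 0)
    (hCe : ∀ i j, G y (flatNabla Γ V y (e i)) (flatNabla Γ V y (e j)) = if i = j then l i else 0)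
    {Z u' : Model n} (hZ : ∀ a, G y Z a = G y (flatNabla Γ V y a) u') :
    flatEulerLagrange G Γ V y (u' + flatNabla Γ V y Z) =
      - flatDensity G Γ V y * G y (∑ i, (1 / (1 + l i)) • flatTension Γ V y (e i)) u' := by
  have hZ' : fluxVector G Γ V y (u' + flatNabla Γ V y Z) = Z := by
    refine eq_of_forall_form_eq (H := flatInduced G Γ V y) (fun a ha => h.flatInduced_pos hy ha)
      fun a => ?_
    rw [h.flatInduced_fluxVector hy, flatInduced_apply, hZ, map_add,
      h.metric_symm y hy (flatNabla Γ V y Z)]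
  have hN (a b u : Model n) :
      fderiv ℝ (fun z => ((G z).flip u).comp (flatNabla Γ V z)) y b a =
        fderiv ℝ (fun z => G z (flatNabla Γ V z a) u) y b := by
    have hf : ContDiff ℝ ∞ (fun L : Model n →L[ℝ] Model n →L[ℝ] ℝ => L.flip) :=
      (ContinuousLinearMap.flipₗᵢ ℝ (Model n) (Model n) ℝ).toContinuousLinearEquiv.contDiff
    have h1 : ContDiffAt ℝ ∞ (fun z => (G z).flip u) y :=
      (hf.contDiffAt.comp y (h.contDiffAt_metric hy)).clm_apply contDiffAt_const
    have h2 := (h1.clm_comp (contDiffAt_flatNabla (h.contDiffAt_christoffel hy)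
      hV)).differentiableAt (by simp)
    have : fderiv ℝ (fun z => G z (flatNabla Γ V z a) u) y = _ :=
      (h2.hasFDerivAt.clm_apply (hasFDerivAt_const a y)).fderiv
    rw [this]
    simp
  rw [flatEulerLagrange, h.trace_gram_flatInduced hy hGe hCe, neg_mul, ← mul_neg, map_sum, sum_apply,
    ← Finset.sum_neg_distrib]
  congr 1
  refine Finset.sum_congr rfl fun i _ => ?_
  rw [map_smul, smul_apply, smul_eq_mul, ← mul_neg, ← h.eulerLagrange_quadratic hy hV hZ]
  congr 1
  simp only [eulerLagrangeForm, hZ', add_apply, sub_apply, smul_apply,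
    ContinuousLinearMap.comp_apply, ContinuousLinearMap.flip_apply, hN,
    ContinuousLinearMap.bilinearComp_apply, ContinuousLinearMap.compL_apply,
    ContinuousLinearMap.apply_apply, smul_eq_mul]

lemma nabla_unit (hV : ContDiffAt ℝ ∞ V y) (hu : ∀ᶠ z in nhds y, G z (V z) (V z) = 1)
    (a : Model n) : G y (flatNabla Γ V y a) (V y) = 0 := by
  have hG := ((h.contDiffAt_metric hy).differentiableAt (by simp)).hasFDerivAt
  have hV' := (hV.differentiableAt (by simp)).hasFDerivAt
  have h1 := ((hG.clm_apply hV').clm_apply hV').unique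
    ((hasFDerivAt_const (1 : ℝ) y).congr_of_eventuallyEq hu)
  have h2 := congrArg (fun L : Model n →L[ℝ] ℝ => L a) h1
  simp only [add_apply, ContinuousLinearMap.comp_apply, ContinuousLinearMap.flip_apply, zero_apply,
    h.compat y hy] at h2
  rw [h.metric_symm y hy (V y) (fderiv ℝ V y a), h.metric_symm y hy (V y) (Γ y a (V y))] at h2
  rw [flatNabla_apply, map_add, add_apply]
  linarith

/-- Differentiate `G(∇_a V, V) = 0` in the direction `a`. All terms of the form `∇V(·)`, including
the curvature term, are orthogonal to `V` and drop out. -/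
lemma tension_unit (hV : ContDiffAt ℝ ∞ V y) (hVU : ContDiffOn ℝ ∞ V U)
    (hu : ∀ z ∈ U, G z (V z) (V z) = 1) (a : Model n) :
    G y (flatTension Γ V y a) (V y) = - G y (flatNabla Γ V y a) (flatNabla Γ V y a) := by
  have hG := ((h.contDiffAt_metric hy).differentiableAt (by simp)).hasFDerivAt
  have hV' := (hV.differentiableAt (by simp)).hasFDerivAt
  have hC := ((contDiffAt_flatNabla (h.contDiffAt_christoffel hy) hV).differentiableAt
    (by simp)).hasFDerivAt.clm_apply (hasFDerivAt_const a y)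
  have hn : ∀ z ∈ U, ∀ a, G z (flatNabla Γ V z a) (V z) = 0 := fun z hz a =>
    h.nabla_unit hz (hVU.contDiffAt (h.mem_nhds hz)) (Filter.eventually_of_mem (h.mem_nhds hz) hu) a
  have hev : (fun z => G z (flatNabla Γ V z a) (V z)) =ᶠ[nhds y] fun _ => 0 :=
    Filter.eventually_of_mem (h.mem_nhds hy) fun z hz => hn z hz a
  have h1 := ((hG.clm_apply hC).clm_apply hV').unique
    ((hasFDerivAt_const (0 : ℝ) y).congr_of_eventuallyEq hev)
  have h2 := congrArg (fun L : Model n →L[ℝ] ℝ => L a) h1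
  simp only [add_apply, ContinuousLinearMap.comp_apply, ContinuousLinearMap.flip_apply, zero_apply,
    h.compat y hy, map_zero, zero_add] at h2
  have h3 := hn y hy (Γ y a a)
  have h4 := hn y hy (flatCurv Γ y (V y) (flatNabla Γ V y a) a)
  rw [flatTension, map_sub, sub_apply, h4, flatNabla₂, map_sub, sub_apply, h3, map_add, add_apply]
  have h5 : G y (flatNabla Γ V y a) (flatNabla Γ V y a) = G y (flatNabla Γ V y a) (fderiv ℝ V y a)
      + G y (flatNabla Γ V y a) (Γ y a (V y)) := by
    conv_lhs => rw [flatNabla_apply a, map_add]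
    rfl
  linarith

/-- The Euler-Lagrange expression vanishes on `V^⊥` if and only if the minimality equation
holds. -/
lemma eulerLagrange_iff (hVU : ContDiffOn ℝ ∞ V U) (hu : ∀ z ∈ U, G z (V z) (V z) = 1)
    (hGe : ∀ i j, G y (e i) (e j) = if i = j then 1 else 0)
    (hCe : ∀ i j, G y (flatNabla Γ V y (e i)) (flatNabla Γ V y (e j)) =
      if i = j then l i else 0) :
    (∀ u, G y u (V y) = 0 → flatEulerLagrange G Γ V y u = 0) ↔
      ∑ i, (1 / (1 + l i)) • flatTension Γ V y (e i) = (-∑ i, l i / (1 + l i)) • V y := by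
  have hV : ContDiffAt ℝ ∞ V y := hVU.contDiffAt (h.mem_nhds hy)
  have hn := h.nabla_unit hy hV (Filter.eventually_of_mem (h.mem_nhds hy) hu)
  constructor
  · intro hEL
    set T := ∑ i, (1 / (1 + l i)) • flatTension Γ V y (e i) with hT
    have hTV : G y T (V y) = -∑ i, l i / (1 + l i) := by
      rw [hT, map_sum, sum_apply, ← Finset.sum_neg_distrib]
      refine Finset.sum_congr rfl fun i _ => ?_
      rw [map_smul, smul_apply, h.tension_unit hy hV hVU hu, hCe, if_pos rfl, smul_eq_mul]
      ring
    -- The component of `T` orthogonal to `V` serves as its own test vector: the Euler-Lagrange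
    -- equation on `u' + C Cᵗ u'` forces `G(u', u') = 0`.
    set u' := T - G y T (V y) • V y with hu'
    have hu'V : G y u' (V y) = 0 := by
      rw [hu', map_sub, sub_apply, map_smul, smul_apply, hu y hy, smul_eq_mul, mul_one, sub_self]
    obtain ⟨Z, hZ⟩ : ∃ Z, ∀ a, G y Z a = G y (flatNabla Γ V y a) u' :=
      ⟨_, gram_inv_apply (h.metric_symm y hy) (h.metric_pos y hy)
        (((G y).flip u').comp (flatNabla Γ V y))⟩
    have h1 := hEL (u' + flatNabla Γ V y Z) (by rw [map_add, add_apply, hu'V, hn, add_zero])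
    rw [h.flatEulerLagrange_eq hy hV hGe hCe hZ, ← hT] at h1
    have h2 : G y T u' = 0 :=
      (mul_eq_zero.1 h1).resolve_left (neg_ne_zero.2 (h.flatDensity_pos hy).ne')
    have h3 : G y u' u' = 0 := by
      conv_lhs => rw [hu', map_sub, map_smul, ← hu']
      rw [h.metric_symm y hy u' T, h2, hu'V, smul_zero, sub_zero]
    have h4 : u' = 0 := by
      by_contra h0
      exact (h.metric_pos y hy u' h0).ne' h3
    rw [← hTV, ← sub_eq_zero]
    exact h4
  · intro hT u huV
    -- For given `u` the equation `u = u' + C Cᵗ u'` is solved by `u' = u - C Z`, with `Z` the flux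
    -- vector of `u`.
    set Z := fluxVector G Γ V y u
    have hZ : ∀ a, G y Z a = G y (flatNabla Γ V y a) (u - flatNabla Γ V y Z) := by
      intro a
      have := h.flatInduced_fluxVector (V := V) hy u a
      rw [flatInduced_apply] at this
      rw [map_sub, h.metric_symm y hy _ (flatNabla Γ V y Z), ← this]
      ring
    have h1 := h.flatEulerLagrange_eq hy hV hGe hCe hZ
    rw [sub_add_cancel, hT] at h1
    rw [h1, map_smul, smul_apply, h.metric_symm y hy (V y), map_sub, sub_apply, huV, hn]
    simp

end IsLeviCivitaOn

end EulerLagrange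

/-! ### Existence of the Levi-Civita connection in coordinates. -/

section Existence

variable {E : Type*} [NormedAddCommGroup E] [NormedSpace ℝ E]

/-- The Koszul formula for a symmetric metric connection at a point. -/
lemma koszul {H : E →L[ℝ] E →L[ℝ] ℝ} {D : E →L[ℝ] E →L[ℝ] E →L[ℝ] ℝ} {B : E → E → E}
    (hH : ∀ a b, H a b = H b a) (hs : ∀ a b, B a b = B b a)
    (hc : ∀ c a b, D c a b = H (B c a) b + H a (B c b)) (a b c : E) :
    H (B a b) c = 1 / 2 * (D a b c + D b a c - D c a b) := by
  rw [hc, hc, hc, hs b a, hs c a, hs c b, hH b, hH a]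
  ring

variable {n : ℕ} {U : Set (Model n)} {G : Model n → Model n →L[ℝ] Model n →L[ℝ] ℝ}

/-- The combination of derivatives of the metric in the Koszul formula. -/
def koszulForm (G : Model n → Model n →L[ℝ] Model n →L[ℝ] ℝ) (y v : Model n) :
    Model n →L[ℝ] Model n →L[ℝ] ℝ :=
  (1 / 2 : ℝ) • ((ContinuousLinearMap.compL ℝ (Model n) (Model n →L[ℝ] ℝ) ℝ
      (ContinuousLinearMap.apply ℝ ℝ v)).comp (fderiv ℝ G y) +
    (ContinuousLinearMap.compL ℝ (Model n) (Model n →L[ℝ] ℝ) ℝ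
      (ContinuousLinearMap.apply ℝ ℝ v)).comp (fderiv ℝ G y).flip - fderiv ℝ G y v)

lemma koszulForm_apply (y v a b : Model n) : koszulForm G y v a b =
    1 / 2 * (fderiv ℝ G y a b v + fderiv ℝ G y b a v - fderiv ℝ G y v a b) := rfl

/-- The Christoffel map of a metric on an open set of a vector space. -/
def flatChristoffel (G : Model n → Model n →L[ℝ] Model n →L[ℝ] ℝ) (y : Model n) :
    Model n →L[ℝ] Model n →L[ℝ] Model n :=
  ∑ l, (ContinuousLinearMap.compL ℝ (Model n) ℝ (Model n)
    (ContinuousLinearMap.toSpanSingleton ℝ (stdBasis l))).comp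
      (∑ k, (gram (G y))⁻¹ l k • koszulForm G y (stdBasis k))

lemma flatChristoffel_apply (y a b : Model n) : flatChristoffel G y a b =
    ∑ l, (∑ k, (gram (G y))⁻¹ l k * koszulForm G y (stdBasis k) a b) • stdBasis l := by
  simp [flatChristoffel, sum_apply, Finset.sum_smul, smul_smul]

/-- The coordinate formula is constructed so that the Koszul formula holds after pairing with `G`.
Symmetry and compatibility are then read off from it, using that derivatives of `G` are symmetric
forms. -/
lemma isLeviCivitaOn_flatChristoffel (hU : IsOpen U) (hG : ContDiffOn ℝ ∞ G U)
    (hs : ∀ y ∈ U, ∀ a b, G y a b = G y b a) (hp : ∀ y ∈ U, ∀ a, a ≠ 0 → 0 < G y a a) :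
    IsLeviCivitaOn U G (flatChristoffel G) := by
  have hDs : ∀ y ∈ U, ∀ c a b, fderiv ℝ G y c a b = fderiv ℝ G y c b a := by
    intro y hy c a b
    have hG' := ((hG.contDiffAt (hU.mem_nhds hy)).differentiableAt (by simp)).hasFDerivAt
    have key : ∀ a b : Model n, fderiv ℝ G y c a b = fderiv ℝ (fun z => G z a b) y c := by
      intro a b
      rw [((hG'.clm_apply (hasFDerivAt_const a y)).clm_apply (hasFDerivAt_const b y)).fderiv]
      simp
    rw [key, key]
    congr 1
    apply Filter.EventuallyEq.fderiv_eq
    filter_upwards [hU.mem_nhds hy] with z hz using hs z hz a b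
  have hK : ∀ y ∈ U, ∀ a b c, G y (flatChristoffel G y a b) c =
      1 / 2 * (fderiv ℝ G y a b c + fderiv ℝ G y b a c - fderiv ℝ G y c a b) := by
    intro y hy a b c
    have h1 := gram_inv_apply (hs y hy) (hp y hy) ((1 / 2 : ℝ) • (fderiv ℝ G y a b +
      fderiv ℝ G y b a - ((fderiv ℝ G y).flip a).flip b)) c
    rw [flatChristoffel_apply]
    exact h1
  refine ⟨hU, hG, ?_, hs, hp, ?_, ?_⟩
  · refine contDiffOn_clm_apply.2 fun a => contDiffOn_clm_apply.2 fun b => ?_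
    simp only [flatChristoffel_apply, koszulForm_apply]
    intro y hy
    have hGy := hG.contDiffAt (hU.mem_nhds hy)
    have hD : ContDiffAt ℝ ∞ (fderiv ℝ G) y := hGy.fderiv_right (by simp)
    have hDc (a b c : Model n) : ContDiffAt ℝ ∞ (fun z => fderiv ℝ G z a b c) y :=
      ((hD.clm_apply contDiffAt_const).clm_apply contDiffAt_const).clm_apply contDiffAt_const
    apply ContDiffAt.contDiffWithinAt
    apply ContDiffAt.sum
    intro l _
    apply ContDiffAt.fun_smul _ contDiffAt_const
    apply ContDiffAt.sum
    intro k _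
    have hI : ContDiffAt ℝ ∞ (fun z => (gram (G z))⁻¹ l k) y :=
      contDiffAt_matrix_inv (fun i j => (hGy.clm_apply contDiffAt_const).clm_apply contDiffAt_const)
        (gram_det_pos (hs y hy) (hp y hy)).ne' l k
    exact hI.mul (contDiffAt_const.mul (((hDc _ _ _).add (hDc _ _ _)).sub (hDc _ _ _)))
  · intro y hy a b
    refine eq_of_forall_form_eq (hp y hy) fun c => ?_
    rw [hK y hy, hK y hy, hDs y hy c a b]
    ring
  · intro y hy c a b
    rw [hs y hy a, hK y hy, hK y hy, hDs y hy c b a, hDs y hy a c b, hDs y hy b c a]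
    ring

end Existence

/-! ### Vector fields and metrics in the charts of the manifold. -/

section Charts

variable {n : ℕ} {M : Type*} [TopologicalSpace M] [ChartedSpace (Model n) M]
  [IsManifold 𝓘(ℝ, Model n) ∞ M]

/-- The isomorphism from the coordinate space of the chart centred at `x` to `T_q M`. -/
def toTangent (x q : M) : Model n →L[ℝ] Model n := tangentCoordChange 𝓘(ℝ, Model n) x q q

/-- The isomorphism from `T_q M` to the coordinate space of the chart centred at `x`. -/
def toChart (x q : M) : Model n →L[ℝ] Model n := tangentCoordChange 𝓘(ℝ, Model n) q x q

/-- The chart representation of a vector field. -/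
def chartRep (x : M) (v : VField n M) (y : Model n) : Model n :=
  toChart x ((extChartAt 𝓘(ℝ, Model n) x).symm y) (v ((extChartAt 𝓘(ℝ, Model n) x).symm y))

/-- The chart representation of a Riemannian metric. -/
def chartMetric (g : Metric n M) (x : M) (y : Model n) : Model n →L[ℝ] Model n →L[ℝ] ℝ :=
  ContinuousLinearMap.bilinearComp
    (show Model n →L[ℝ] Model n →L[ℝ] ℝ from g.inner ((extChartAt 𝓘(ℝ, Model n) x).symm y))
    (toTangent x ((extChartAt 𝓘(ℝ, Model n) x).symm y))
    (toTangent x ((extChartAt 𝓘(ℝ, Model n) x).symm y))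

lemma chartMetric_apply (g : Metric n M) (x : M) (y a b : Model n) :
    chartMetric g x y a b = g.inner ((extChartAt 𝓘(ℝ, Model n) x).symm y)
      (toTangent x ((extChartAt 𝓘(ℝ, Model n) x).symm y) a)
      (toTangent x ((extChartAt 𝓘(ℝ, Model n) x).symm y) b) := rfl

variable {x q p : M} {y : Model n}

/-- Vectors of `T_q M` are read in the preferred chart at `q`, so `toChart` and `toTangent` are
coordinate changes between that chart and the one at `x`, and the cocycle identity makes them
inverse to each other. -/
lemma toChart_toTangent (hq : q ∈ (extChartAt 𝓘(ℝ, Model n) x).source) (a : Model n) :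
    toChart x q (toTangent x q a) = a := by
  rw [toChart, toTangent, tangentCoordChange_comp ⟨⟨hq, mem_extChartAt_source q⟩, hq⟩,
    tangentCoordChange_self hq]

lemma toTangent_toChart (hq : q ∈ (extChartAt 𝓘(ℝ, Model n) x).source) (a : Model n) :
    toTangent x q (toChart x q a) = a := by
  rw [toChart, toTangent, tangentCoordChange_comp
    ⟨⟨mem_extChartAt_source q, hq⟩, mem_extChartAt_source q⟩,
    tangentCoordChange_self (mem_extChartAt_source q)]

lemma toTangent_self (p : M) (a : Model n) : toTangent p p a = a :=
  tangentCoordChange_self (mem_extChartAt_source p)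

lemma toChart_self (p : M) (a : Model n) : toChart p p a = a :=
  tangentCoordChange_self (mem_extChartAt_source p)

lemma chartRep_extChartAt (v : VField n M) (hq : q ∈ (extChartAt 𝓘(ℝ, Model n) x).source) :
    chartRep x v (extChartAt 𝓘(ℝ, Model n) x q) = toChart x q (v q) := by
  rw [chartRep, (extChartAt 𝓘(ℝ, Model n) x).left_inv hq]

lemma toTangent_chartRep (v : VField n M) (hy : y ∈ (extChartAt 𝓘(ℝ, Model n) x).target) :
    toTangent x ((extChartAt 𝓘(ℝ, Model n) x).symm y) (chartRep x v y) =
      v ((extChartAt 𝓘(ℝ, Model n) x).symm y) :=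
  toTangent_toChart ((extChartAt 𝓘(ℝ, Model n) x).map_target hy) _

lemma hasFDerivAt_chart_change {z : M} (hx : z ∈ (extChartAt 𝓘(ℝ, Model n) x).source)
    (hp : z ∈ (extChartAt 𝓘(ℝ, Model n) p).source) :
    HasFDerivAt (extChartAt 𝓘(ℝ, Model n) p ∘ (extChartAt 𝓘(ℝ, Model n) x).symm)
      (tangentCoordChange 𝓘(ℝ, Model n) x p z) (extChartAt 𝓘(ℝ, Model n) x z) := by
  have := hasFDerivWithinAt_tangentCoordChange (I := 𝓘(ℝ, Model n)) (x := x) (y := p) (z := z)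
    ⟨hx, hp⟩
  rwa [ModelWithCorners.range_eq_univ, hasFDerivWithinAt_univ] at this

lemma mfderiv_extChartAt_symm (hy : y ∈ (extChartAt 𝓘(ℝ, Model n) x).target) (a : Model n) :
    mfderiv 𝓘(ℝ, Model n) 𝓘(ℝ, Model n) (extChartAt 𝓘(ℝ, Model n) x).symm y a =
      toTangent x ((extChartAt 𝓘(ℝ, Model n) x).symm y) a := by
  have hq := (extChartAt 𝓘(ℝ, Model n) x).map_target hy
  have hd : MDifferentiableAt 𝓘(ℝ, Model n) 𝓘(ℝ, Model n) (extChartAt 𝓘(ℝ, Model n) x).symm y :=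
    ((contMDiffOn_extChartAt_symm (n := ∞) x).contMDiffAt
      ((isOpen_extChartAt_target x).mem_nhds hy)).mdifferentiableAt (by simp)
  have h1 := hasFDerivAt_chart_change hq
    (mem_extChartAt_source ((extChartAt 𝓘(ℝ, Model n) x).symm y))
  rw [(extChartAt 𝓘(ℝ, Model n) x).right_inv hy] at h1
  rw [hd.mfderiv, ModelWithCorners.range_eq_univ, fderivWithin_univ]
  have h2 : writtenInExtChartAt 𝓘(ℝ, Model n) 𝓘(ℝ, Model n) y (extChartAt 𝓘(ℝ, Model n) x).symm =
    extChartAt 𝓘(ℝ, Model n) ((extChartAt 𝓘(ℝ, Model n) x).symm y) ∘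
      (extChartAt 𝓘(ℝ, Model n) x).symm := by
    rw [writtenInExtChartAt, extChartAt_model_space_eq_id]
    rfl
  rw [h2]
  have h3 : extChartAt 𝓘(ℝ, Model n) y y = y := by rw [extChartAt_model_space_eq_id]; rfl
  rw [h3, h1.fderiv]
  rfl

lemma coordMatrix_inner (g : Metric n M) (hy : y ∈ (extChartAt 𝓘(ℝ, Model n) x).target) :
    coordMatrix (fun q X Y => g.inner q X Y) x y = gram (chartMetric g x y) := by
  ext i j
  simp only [coordMatrix, Matrix.of_apply, gram_apply, chartMetric_apply]
  rw [mfderiv_extChartAt_symm hy, mfderiv_extChartAt_symm hy]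

/-- Smoothness into the tangent bundle can be tested in the trivialization over any chart around the
base point, not only the preferred one. -/
lemma contMDiffAt_tangent_iff {I' : Type*} [NormedAddCommGroup I'] [NormedSpace ℝ I']
    {N H' : Type*} [TopologicalSpace H'] [TopologicalSpace N] [ChartedSpace H' N]
    {J : ModelWithCorners ℝ I' H'} {f : N → TangentBundle 𝓘(ℝ, Model n) M} {s : N}
    (hs : (f s).proj ∈ (extChartAt 𝓘(ℝ, Model n) x).source) :
    ContMDiffAt J 𝓘(ℝ, Model n).tangent ∞ f s ↔
      ContMDiffAt J 𝓘(ℝ, Model n) ∞ (fun t => (f t).proj) s ∧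
      ContMDiffAt J 𝓘(ℝ, Model n) ∞ (fun t => toChart x (f t).proj (f t).2) s := by
  have := (trivializationAt (Model n) (TangentSpace 𝓘(ℝ, Model n)) x).contMDiffAt_iff
    (IB := 𝓘(ℝ, Model n)) (IM := J) (n := ∞) (f := f) (x₀ := s) (by
      rw [TangentBundle.trivializationAt_source]; simpa [extChartAt_source] using hs)
  exact this

lemma contMDiffAt_toTangent (hq : q ∈ (extChartAt 𝓘(ℝ, Model n) x).source) (a : Model n) :
    ContMDiffAt 𝓘(ℝ, Model n) 𝓘(ℝ, Model n).tangent ∞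
      (fun z => (⟨z, toTangent x z a⟩ : TangentBundle 𝓘(ℝ, Model n) M)) q := by
  refine (contMDiffAt_tangent_iff (x := x) hq).2 ⟨contMDiffAt_id, ?_⟩
  refine (contMDiffAt_const (c := a)).congr_of_eventuallyEq ?_
  filter_upwards [(isOpen_extChartAt_source x).mem_nhds hq] with z hz
  exact toChart_toTangent hz a

lemma contMDiffAt_extChartAt_symm (hy : y ∈ (extChartAt 𝓘(ℝ, Model n) x).target) :
    ContMDiffAt 𝓘(ℝ, Model n) 𝓘(ℝ, Model n) ∞ (extChartAt 𝓘(ℝ, Model n) x).symm y :=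
  (contMDiffOn_extChartAt_symm x).contMDiffAt ((isOpen_extChartAt_target x).mem_nhds hy)

/-- In finite dimension it suffices to evaluate on constant vectors, and these come from smooth
local fields. -/
lemma contDiffOn_chartMetric (g : Metric n M) (x : M) :
    ContDiffOn ℝ ∞ (chartMetric g x) (extChartAt 𝓘(ℝ, Model n) x).target := by
  refine contDiffOn_clm_apply.2 fun a => contDiffOn_clm_apply.2 fun b => fun y hy => ?_
  have hq := (extChartAt 𝓘(ℝ, Model n) x).map_target hy
  have h1 := ContMDiffAt.clm_bundle_apply₂ (F₃ := ℝ) (E₃ := Bundle.Trivial M ℝ) (b := fun z : M => z)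
    (ψ := g.inner) (g.contMDiff.contMDiffAt) (contMDiffAt_toTangent hq a)
    (contMDiffAt_toTangent hq b)
  have h2 : ContMDiffAt 𝓘(ℝ, Model n) 𝓘(ℝ, ℝ) ∞
      (fun z : M => g.inner z (toTangent x z a) (toTangent x z b))
      ((extChartAt 𝓘(ℝ, Model n) x).symm y) := by
    rw [Bundle.contMDiffAt_totalSpace] at h1
    exact h1.2
  exact (h2.comp y (contMDiffAt_extChartAt_symm hy)).contDiffAt.contDiffWithinAt

/-- The Christoffel map of the Levi-Civita connection in the chart centred at `x`. -/
def chartChristoffel (g : Metric n M) (x : M) : Model n → Model n →L[ℝ] Model n →L[ℝ] Model n :=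
  flatChristoffel (chartMetric g x)

lemma isLeviCivitaOn_chart (g : Metric n M) (x : M) :
    IsLeviCivitaOn (extChartAt 𝓘(ℝ, Model n) x).target (chartMetric g x)
      (chartChristoffel g x) := by
  refine isLeviCivitaOn_flatChristoffel (isOpen_extChartAt_target x) (contDiffOn_chartMetric g x)
    ?_ ?_
  · intro y _ a b
    rw [chartMetric_apply, chartMetric_apply]
    exact g.symm _ _ _
  · intro y hy a ha
    rw [chartMetric_apply]
    refine g.pos _ _ fun h0 => ha ?_
    rw [← toChart_toTangent ((extChartAt 𝓘(ℝ, Model n) x).map_target hy) a]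
    exact (congrArg (toChart x _) h0).trans (map_zero _)

end Charts

/-! ### Naturality of the covariant derivative under changes of coordinates. -/

section Transformation

variable {E : Type*} [NormedAddCommGroup E] [NormedSpace ℝ E] {U U' : Set E}
  {G G' : E → E →L[ℝ] E →L[ℝ] ℝ} {Γ Γ' : E → E →L[ℝ] E →L[ℝ] E} {V V' : E → E} {y : E}

/-- Covariant derivatives are compatible with isometric changes of coordinates. -/
lemma IsLeviCivitaOn.fderiv_flatNabla_transform (h : IsLeviCivitaOn U G Γ)
    (h' : IsLeviCivitaOn U' G' Γ') {ψ : E → E} (hy : y ∈ U) (hy' : ψ y ∈ U')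
    (hψ : ContDiffAt ℝ ∞ ψ y)
    (hG : ∀ᶠ z in nhds y, ∀ a b, G z a b = G' (ψ z) (fderiv ℝ ψ z a) (fderiv ℝ ψ z b))
    (hsurj : Function.Surjective (fderiv ℝ ψ y))
    (hV : DifferentiableAt ℝ V y) (hV' : DifferentiableAt ℝ V' (ψ y))
    (hVV' : ∀ᶠ z in nhds y, V' (ψ z) = fderiv ℝ ψ z (V z)) (a : E) :
    fderiv ℝ ψ y (flatNabla Γ V y a) = flatNabla Γ' V' (ψ y) (fderiv ℝ ψ y a) := by
  have hψ' := (hψ.differentiableAt (by simp)).hasFDerivAt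
  have hD : ContDiffAt ℝ ∞ (fderiv ℝ ψ) y := hψ.fderiv_right (by simp)
  have hD' := (hD.differentiableAt (by simp)).hasFDerivAt
  have hG1 := ((h.contDiffAt_metric hy).differentiableAt (by simp)).hasFDerivAt
  have hG2 := ((h'.contDiffAt_metric hy').differentiableAt (by simp)).hasFDerivAt
  have hsymm : IsSymmSndFDerivAt ℝ ψ y := hψ.isSymmSndFDerivAt two_le_infty
  -- The expected image of the Christoffel map of the source under the differential of `ψ`: the
  -- transformation law of Christoffel symbols.
  let S : E → E → E := fun a b =>
    fderiv ℝ (fderiv ℝ ψ) y a b + Γ' (ψ y) (fderiv ℝ ψ y a) (fderiv ℝ ψ y b)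
  have hSs : ∀ a b, S a b = S b a := fun a b => by
    simp only [S, hsymm a b, h'.symm _ hy' (fderiv ℝ ψ y a)]
  have hGy := hG.self_of_nhds
  have hS : ∀ c a b, fderiv ℝ G y c a b = G' (ψ y) (S c a) (fderiv ℝ ψ y b) +
      G' (ψ y) (fderiv ℝ ψ y a) (S c b) := by
    intro c a b
    have e1 : fderiv ℝ G y c a b = fderiv ℝ (fun z => G z a b) y c := by
      rw [((hG1.clm_apply (hasFDerivAt_const a y)).clm_apply (hasFDerivAt_const b y)).fderiv]
      simp
    have e2 : (fun z => G z a b) =ᶠ[nhds y]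
        fun z => G' (ψ z) (fderiv ℝ ψ z a) (fderiv ℝ ψ z b) := hG.mono fun z hz => hz a b
    have e3 (v : E) := hD'.clm_apply (hasFDerivAt_const v y)
    have e4 : HasFDerivAt (fun z => G' (ψ z)) ((fderiv ℝ G' (ψ y)).comp (fderiv ℝ ψ y)) y :=
      hG2.comp y hψ'
    rw [e1, e2.fderiv_eq, ((e4.clm_apply (e3 a)).clm_apply (e3 b)).fderiv]
    simp only [add_apply, ContinuousLinearMap.comp_apply, ContinuousLinearMap.flip_apply,
      map_zero, zero_add, zero_apply, h'.compat _ hy', S, map_add]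
    ring
  -- Both sides satisfy the same Koszul formula, once the pulled-back metric is differentiated, and
  -- the differential of `ψ` supplies all test vectors.
  have hSΓ : ∀ a b, fderiv ℝ ψ y (Γ y a b) = S a b := by
    intro a b
    refine eq_of_forall_form_eq (h'.metric_pos _ hy') fun c => ?_
    obtain ⟨c, rfl⟩ := hsurj c
    have k1 := koszul (h.metric_symm y hy) (h.symm y hy) (h.compat y hy) a b c
    rw [hGy] at k1
    rw [k1, hS, hS, hS, hSs b a, hSs c a, hSs c b, h'.metric_symm _ hy' (fderiv ℝ ψ y b),
      h'.metric_symm _ hy' (fderiv ℝ ψ y a)]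
    ring
  have hV1 := (hV'.hasFDerivAt.comp y hψ').unique
    ((hD'.clm_apply hV.hasFDerivAt).congr_of_eventuallyEq hVV')
  have hV2 := congrArg (fun L : E →L[ℝ] E => L a) hV1
  simp only [add_apply, ContinuousLinearMap.comp_apply, ContinuousLinearMap.flip_apply] at hV2
  rw [flatNabla_apply, flatNabla_apply, map_add, hSΓ, hV2, hVV'.self_of_nhds]
  simp only [S]
  abel

end Transformation

/-! ### The connection operator and the covariant derivative in the centred chart. -/

section Nabla

variable {n : ℕ} {M : Type*} [TopologicalSpace M] [ChartedSpace (Model n) M]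
  [IsManifold 𝓘(ℝ, Model n) ∞ M] {x q p : M} {y : Model n} {v X : VField n M}

lemma contDiffAt_chartRep (hq : q ∈ (extChartAt 𝓘(ℝ, Model n) x).source)
    (hv : ContMDiffAt 𝓘(ℝ, Model n) 𝓘(ℝ, Model n).tangent ∞ (sectionMap v) q) :
    ContDiffAt ℝ ∞ (chartRep x v) (extChartAt 𝓘(ℝ, Model n) x q) := by
  have h1 := ((contMDiffAt_tangent_iff (x := x) hq).1 hv).2
  have hy := (extChartAt 𝓘(ℝ, Model n) x).map_source hq
  rw [← (extChartAt 𝓘(ℝ, Model n) x).left_inv hq] at h1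
  exact (h1.comp _ (contMDiffAt_extChartAt_symm hy)).contDiffAt

lemma contMDiffAt_of_chartRep (hq : q ∈ (extChartAt 𝓘(ℝ, Model n) x).source)
    (hv : ContDiffAt ℝ ∞ (chartRep x v) (extChartAt 𝓘(ℝ, Model n) x q)) :
    ContMDiffAt 𝓘(ℝ, Model n) 𝓘(ℝ, Model n).tangent ∞ (sectionMap v) q := by
  refine (contMDiffAt_tangent_iff (x := x) hq).2 ⟨contMDiffAt_id, ?_⟩
  have h1 : ContMDiffAt 𝓘(ℝ, Model n) 𝓘(ℝ, Model n) ∞ (extChartAt 𝓘(ℝ, Model n) x) q :=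
    contMDiffAt_extChartAt' (by simpa [extChartAt_source] using hq)
  refine (hv.contMDiffAt.comp q h1).congr_of_eventuallyEq ?_
  filter_upwards [(isOpen_extChartAt_source x).mem_nhds hq] with z hz
  exact (chartRep_extChartAt v hz).symm

lemma IsSmooth.contDiffOn_chartRep (hv : IsSmooth v) (x : M) :
    ContDiffOn ℝ ∞ (chartRep x v) (extChartAt 𝓘(ℝ, Model n) x).target := by
  intro y hy
  have hq := (extChartAt 𝓘(ℝ, Model n) x).map_target hy
  have := contDiffAt_chartRep hq hv.contMDiffAt
  rw [(extChartAt 𝓘(ℝ, Model n) x).right_inv hy] at this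
  exact this.contDiffWithinAt

lemma IsSmoothPath.contDiffAt_chartRep {w : ℝ → VField n M} (hw : IsSmoothPath w) (t : ℝ)
    (hy : y ∈ (extChartAt 𝓘(ℝ, Model n) x).target) :
    ContDiffAt ℝ ∞ (fun s : ℝ × Model n => chartRep x (w s.1) s.2) (t, y) := by
  have hq := (extChartAt 𝓘(ℝ, Model n) x).map_target hy
  have h1 := ((contMDiffAt_tangent_iff (x := x)
    (s := (t, (extChartAt 𝓘(ℝ, Model n) x).symm y)) hq).1 hw.contMDiffAt).2
  have h2 : ContMDiffAt 𝓘(ℝ, ℝ × Model n) (𝓘(ℝ, ℝ).prod 𝓘(ℝ, Model n)) ∞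
      (fun s : ℝ × Model n => (s.1, (extChartAt 𝓘(ℝ, Model n) x).symm s.2)) (t, y) :=
    ContMDiffAt.prodMk contDiffAt_fst.contMDiffAt
      (ContMDiffAt.comp (t, y) (contMDiffAt_extChartAt_symm hy) contDiffAt_snd.contMDiffAt)
  exact (h1.comp (t, y) h2).contDiffAt

lemma chartRep_mfderiv (hv : ContMDiffAt 𝓘(ℝ, Model n) 𝓘(ℝ, Model n).tangent ∞ (sectionMap v) p)
    (a : Model n) :
    (mfderiv 𝓘(ℝ, Model n) 𝓘(ℝ, Model n).tangent (sectionMap v) p a : Model n × Model n) =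
      (a, fderiv ℝ (chartRep p v) (extChartAt 𝓘(ℝ, Model n) p p) a) := by
  have hd := hv.mdifferentiableAt (by simp)
  have h1 : writtenInExtChartAt 𝓘(ℝ, Model n) 𝓘(ℝ, Model n).tangent p (sectionMap v) =ᶠ[nhds
      (extChartAt 𝓘(ℝ, Model n) p p)] fun y => (y, chartRep p v y) := by
    filter_upwards [(isOpen_extChartAt_target p).mem_nhds (mem_extChartAt_target p)] with y hy
    have e1 : writtenInExtChartAt 𝓘(ℝ, Model n) 𝓘(ℝ, Model n).tangent p (sectionMap v) y =
        (extChartAt 𝓘(ℝ, Model n) p ((extChartAt 𝓘(ℝ, Model n) p).symm y), chartRep p v y) := by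
      rw [writtenInExtChartAt, FiberBundle.extChartAt]
      rfl
    rw [e1, (extChartAt 𝓘(ℝ, Model n) p).right_inv hy]
  have h2 := ((contDiffAt_chartRep (x := p) (mem_extChartAt_source p) hv).differentiableAt
    (by simp)).hasFDerivAt
  have h3 := (hasFDerivAt_id (𝕜 := ℝ) (extChartAt 𝓘(ℝ, Model n) p p)).prodMk h2
  rw [hd.mfderiv, ModelWithCorners.range_eq_univ, fderivWithin_univ, h1.fderiv_eq]
  have h4 := h3.fderiv
  simp only [id] at h4
  rw [h4]
  rfl

/-- Near the centre of the chart `coordMatrix` is the Gram matrix of `chartMetric`, so both have the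
same value and first derivatives at the centre. -/
lemma christoffel_eq (g : Metric n M) (p : M) (l i j : Fin n) :
    christoffel g p l i j = ∑ k,
      (gram (chartMetric g p (extChartAt 𝓘(ℝ, Model n) p p)))⁻¹ l k *
        koszulForm (chartMetric g p) (extChartAt 𝓘(ℝ, Model n) p p) (stdBasis k) (stdBasis i)
          (stdBasis j) := by
  have hd : ∀ k i j, dMetric g p k i j = fderiv ℝ (chartMetric g p)
      (extChartAt 𝓘(ℝ, Model n) p p) (stdBasis k) (stdBasis i) (stdBasis j) := by
    intro k i j
    have h1 : (fun y => coordMatrix (fun q X Y => g.inner q X Y) p y i j) =ᶠ[nhds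
        (extChartAt 𝓘(ℝ, Model n) p p)] fun y => chartMetric g p y (stdBasis i) (stdBasis j) := by
      filter_upwards [(isOpen_extChartAt_target p).mem_nhds (mem_extChartAt_target p)] with y hy
      rw [coordMatrix_inner g hy]
      rfl
    have h2 := (((isLeviCivitaOn_chart g p).contDiffAt_metric
      (mem_extChartAt_target p)).differentiableAt (by simp)).hasFDerivAt
    rw [dMetric, h1.fderiv_eq, ((h2.clm_apply (hasFDerivAt_const (stdBasis i) _)).clm_apply
      (hasFDerivAt_const (stdBasis j) _)).fderiv]
    simp
  rw [christoffel, coordMatrix_inner g (mem_extChartAt_target p), Finset.mul_sum]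
  refine Finset.sum_congr rfl fun k _ => ?_
  rw [koszulForm_apply, hd, hd, hd]
  ring

lemma sum_christoffel (g : Metric n M) (p : M) (a u : Model n) :
    ∑ l, (∑ i, ∑ j, christoffel g p l i j * a i * u j) • (stdBasis l : Model n) =
      chartChristoffel g p (extChartAt 𝓘(ℝ, Model n) p p) a u := by
  rw [chartChristoffel, flatChristoffel_apply]
  refine Finset.sum_congr rfl fun l _ => ?_
  congr 1
  simp only [christoffel_eq, Finset.sum_mul]
  rw [Finset.sum_congr rfl fun i _ => Finset.sum_comm, Finset.sum_comm]
  refine Finset.sum_congr rfl fun k _ => ?_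
  rw [bilin_eq_sum, Finset.mul_sum]
  refine Finset.sum_congr rfl fun i _ => ?_
  rw [Finset.mul_sum]
  refine Finset.sum_congr rfl fun j _ => ?_
  rw [gram_apply]
  ring

lemma connector_eq (g : Metric n M) (w : TangentBundle 𝓘(ℝ, Model n) M) (ξ : Model n × Model n) :
    connector g w ξ =
      ξ.2 + chartChristoffel g w.proj (extChartAt 𝓘(ℝ, Model n) w.proj w.proj) ξ.1 w.2 :=
  congrArg (ξ.2 + ·) (sum_christoffel g w.proj ξ.1 w.2)

/-- Valid only at the centre `p` of the chart, because `nabla` uses a different chart at every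
point; `nabla_toTangent` removes this restriction. -/
lemma nabla_eq (g : Metric n M)
    (hv : ContMDiffAt 𝓘(ℝ, Model n) 𝓘(ℝ, Model n).tangent ∞ (sectionMap v) p) (a : Model n) :
    nabla g v p a = flatNabla (chartChristoffel g p) (chartRep p v)
      (extChartAt 𝓘(ℝ, Model n) p p) a := by
  have h1 : chartRep p v (extChartAt 𝓘(ℝ, Model n) p p) = v p := by
    rw [chartRep_extChartAt v (mem_extChartAt_source p)]
    exact toChart_self p _
  rw [flatNabla_apply, h1]
  refine (connector_eq g (sectionMap v p)
    (mfderiv 𝓘(ℝ, Model n) 𝓘(ℝ, Model n).tangent (sectionMap v) p a)).trans ?_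
  rw [chartRep_mfderiv hv a]
  rfl

end Nabla

/-! ### Covariant derivatives, brackets and curvature in a fixed chart. -/

section Covariant

variable {n : ℕ} {M : Type*} [TopologicalSpace M] [ChartedSpace (Model n) M]
  [IsManifold 𝓘(ℝ, Model n) ∞ M] {x q p : M} {y : Model n} {v X Y Z : VField n M} {U : Set M}

/-- Smooth vector fields on a set. -/
def IsSmoothOn (v : VField n M) (U : Set M) : Prop :=
  ContMDiffOn 𝓘(ℝ, Model n) 𝓘(ℝ, Model n).tangent ∞ (sectionMap v) U

lemma IsSmooth.isSmoothOn (hv : IsSmooth v) (U : Set M) : IsSmoothOn v U := hv.contMDiffOn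

lemma IsSmoothOn.contDiffAt (hv : IsSmoothOn v U) (hU : IsOpen U)
    (hy : y ∈ (extChartAt 𝓘(ℝ, Model n) x).target)
    (hyU : (extChartAt 𝓘(ℝ, Model n) x).symm y ∈ U) : ContDiffAt ℝ ∞ (chartRep x v) y := by
  have hq := (extChartAt 𝓘(ℝ, Model n) x).map_target hy
  have h1 := contDiffAt_chartRep hq (ContMDiffOn.contMDiffAt hv (hU.mem_nhds hyU))
  rwa [(extChartAt 𝓘(ℝ, Model n) x).right_inv hy] at h1

lemma eventually_mem_chart (hU : IsOpen U) (hy : y ∈ (extChartAt 𝓘(ℝ, Model n) x).target)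
    (hyU : (extChartAt 𝓘(ℝ, Model n) x).symm y ∈ U) :
    ∀ᶠ z in nhds y, z ∈ (extChartAt 𝓘(ℝ, Model n) x).target ∧
      (extChartAt 𝓘(ℝ, Model n) x).symm z ∈ U :=
  ((isOpen_extChartAt_target x).mem_nhds hy : _ ∈ nhds y) |> fun h1 =>
    (Filter.eventually_of_mem h1 fun _ h => h).and
      (((contMDiffAt_extChartAt_symm hy).continuousAt).eventually_mem (hU.mem_nhds hyU))

/-- The covariant derivative in an arbitrary chart. -/
lemma nabla_toTangent (g : Metric n M) (hU : IsOpen U) (hv : IsSmoothOn v U)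
    (hy : y ∈ (extChartAt 𝓘(ℝ, Model n) x).target)
    (hyU : (extChartAt 𝓘(ℝ, Model n) x).symm y ∈ U) (a : Model n) :
    nabla g v ((extChartAt 𝓘(ℝ, Model n) x).symm y)
        (toTangent x ((extChartAt 𝓘(ℝ, Model n) x).symm y) a) =
      toTangent x ((extChartAt 𝓘(ℝ, Model n) x).symm y)
        (flatNabla (chartChristoffel g x) (chartRep x v) y a) := by
  set p := (extChartAt 𝓘(ℝ, Model n) x).symm y with hp
  have hpx : p ∈ (extChartAt 𝓘(ℝ, Model n) x).source := (extChartAt 𝓘(ℝ, Model n) x).map_target hy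
  have hpy : extChartAt 𝓘(ℝ, Model n) x p = y := (extChartAt 𝓘(ℝ, Model n) x).right_inv hy
  have hvp : ContMDiffAt 𝓘(ℝ, Model n) 𝓘(ℝ, Model n).tangent ∞ (sectionMap v) p :=
    ContMDiffOn.contMDiffAt hv (hU.mem_nhds hyU)
  -- The transition from the fixed chart at `x` to the chart centred at the point itself, which is
  -- an isometry of the coordinate metrics.
  set ψ := extChartAt 𝓘(ℝ, Model n) p ∘ (extChartAt 𝓘(ℝ, Model n) x).symm with hψdef
  have hψy : ψ y = extChartAt 𝓘(ℝ, Model n) p p := rfl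
  have hψ : ∀ z ∈ (extChartAt 𝓘(ℝ, Model n) x).target,
      (extChartAt 𝓘(ℝ, Model n) x).symm z ∈ (extChartAt 𝓘(ℝ, Model n) p).source →
      fderiv ℝ ψ z =
        tangentCoordChange 𝓘(ℝ, Model n) x p ((extChartAt 𝓘(ℝ, Model n) x).symm z) := by
    intro z hz hzp
    have := hasFDerivAt_chart_change ((extChartAt 𝓘(ℝ, Model n) x).map_target hz) hzp
    rw [(extChartAt 𝓘(ℝ, Model n) x).right_inv hz] at this
    exact this.fderiv
  have hev := eventually_mem_chart (isOpen_extChartAt_source (I := 𝓘(ℝ, Model n)) p) hy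
    (mem_extChartAt_source p)
  have hψc : ContDiffAt ℝ ∞ ψ y :=
    (ContMDiffAt.comp y (contMDiffAt_extChartAt (x := p))
      (contMDiffAt_extChartAt_symm hy)).contDiffAt
  have h1 := (isLeviCivitaOn_chart g x).fderiv_flatNabla_transform (isLeviCivitaOn_chart g p)
    (V := chartRep x v) (V' := chartRep p v) hy (ψ := ψ) (mem_extChartAt_target p) hψc
    (by
      filter_upwards [hev] with z hz a b
      have hzx := (extChartAt 𝓘(ℝ, Model n) x).map_target hz.1
      rw [hψ z hz.1 hz.2, chartMetric_apply, chartMetric_apply]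
      have e1 : (extChartAt 𝓘(ℝ, Model n) p).symm (ψ z) = (extChartAt 𝓘(ℝ, Model n) x).symm z :=
        (extChartAt 𝓘(ℝ, Model n) p).left_inv hz.2
      have e2 : ∀ a, toTangent p ((extChartAt 𝓘(ℝ, Model n) x).symm z)
          (tangentCoordChange 𝓘(ℝ, Model n) x p ((extChartAt 𝓘(ℝ, Model n) x).symm z) a) =
          toTangent x ((extChartAt 𝓘(ℝ, Model n) x).symm z) a := fun a =>
        tangentCoordChange_comp ⟨⟨hzx, hz.2⟩, mem_extChartAt_source _⟩
      rw [e1, e2, e2])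
    (by
      rw [hψ y hy (mem_extChartAt_source p)]
      intro b
      exact ⟨toChart x p b, toTangent_toChart hpx b⟩)
    (by
      have := contDiffAt_chartRep hpx hvp
      rw [hpy] at this
      exact this.differentiableAt (by simp))
    ((contDiffAt_chartRep (mem_extChartAt_source p) hvp).differentiableAt (by simp))
    (by
      filter_upwards [hev] with z hz
      have hzx := (extChartAt 𝓘(ℝ, Model n) x).map_target hz.1
      have e1 : (extChartAt 𝓘(ℝ, Model n) p).symm (ψ z) = (extChartAt 𝓘(ℝ, Model n) x).symm z :=
        (extChartAt 𝓘(ℝ, Model n) p).left_inv hz.2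
      rw [hψ z hz.1 hz.2, chartRep, chartRep, e1]
      exact (tangentCoordChange_comp ⟨⟨mem_extChartAt_source _, hzx⟩, hz.2⟩).symm) a
  rw [hψ y hy (mem_extChartAt_source p)] at h1
  exact (nabla_eq g hvp (toTangent x p a)).trans h1.symm

lemma chartRep_nabla (g : Metric n M) (hU : IsOpen U) (hv : IsSmoothOn v U)
    (hy : y ∈ (extChartAt 𝓘(ℝ, Model n) x).target)
    (hyU : (extChartAt 𝓘(ℝ, Model n) x).symm y ∈ U) (X : VField n M) :
    toChart x ((extChartAt 𝓘(ℝ, Model n) x).symm y)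
      (nabla g v ((extChartAt 𝓘(ℝ, Model n) x).symm y)
        (X ((extChartAt 𝓘(ℝ, Model n) x).symm y))) =
      flatNabla (chartChristoffel g x) (chartRep x v) y (chartRep x X y) := by
  rw [← toTangent_chartRep X hy, nabla_toTangent g hU hv hy hyU]
  exact toChart_toTangent ((extChartAt 𝓘(ℝ, Model n) x).map_target hy) _

lemma chartRep_cov (g : Metric n M) (hU : IsOpen U) (hv : IsSmoothOn v U)
    (hy : y ∈ (extChartAt 𝓘(ℝ, Model n) x).target)
    (hyU : (extChartAt 𝓘(ℝ, Model n) x).symm y ∈ U) :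
    chartRep x (cov g X v) y = flatCov (chartChristoffel g x) (chartRep x X) (chartRep x v) y :=
  chartRep_nabla g hU hv hy hyU X

/-- Equality near `y`, and not only at `y`, is needed in order to differentiate once more. -/
lemma eventually_chartRep_cov (g : Metric n M) (hU : IsOpen U) (hv : IsSmoothOn v U)
    (hy : y ∈ (extChartAt 𝓘(ℝ, Model n) x).target)
    (hyU : (extChartAt 𝓘(ℝ, Model n) x).symm y ∈ U) :
    chartRep x (cov g X v) =ᶠ[nhds y]
      flatCov (chartChristoffel g x) (chartRep x X) (chartRep x v) :=
  (eventually_mem_chart hU hy hyU).mono fun _ hz => chartRep_cov g hU hv hz.1 hz.2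

lemma isSmoothOn_cov (g : Metric n M) (hU : IsOpen U) (hX : IsSmoothOn X U)
    (hv : IsSmoothOn v U) : IsSmoothOn (cov g X v) U := by
  intro q hq
  refine (contMDiffAt_of_chartRep (x := q) (mem_extChartAt_source q) ?_).contMDiffWithinAt
  have hy := mem_extChartAt_target (I := 𝓘(ℝ, Model n)) q
  have hyU : (extChartAt 𝓘(ℝ, Model n) q).symm (extChartAt 𝓘(ℝ, Model n) q q) ∈ U := by
    rwa [extChartAt_to_inv]
  exact (contDiffAt_flatCov ((isLeviCivitaOn_chart g q).contDiffAt_christoffel hy)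
    (hX.contDiffAt hU hy hyU) (hv.contDiffAt hU hy hyU)).congr_of_eventuallyEq
    (eventually_chartRep_cov g hU hv hy hyU)

lemma flatNabla_congr {E : Type*} [NormedAddCommGroup E] [NormedSpace ℝ E]
    {Γ : E → E →L[ℝ] E →L[ℝ] E} {V V' : E → E} {y : E} (h : V =ᶠ[nhds y] V') :
    flatNabla Γ V y = flatNabla Γ V' y := by
  rw [flatNabla, flatNabla, h.fderiv_eq, h.self_of_nhds]

lemma inverse_mfderiv_extChartAt_symm (hy : y ∈ (extChartAt 𝓘(ℝ, Model n) x).target) :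
    VectorField.mpullback 𝓘(ℝ, Model n) 𝓘(ℝ, Model n) (extChartAt 𝓘(ℝ, Model n) x).symm v y =
      chartRep x v y := by
  have hq := (extChartAt 𝓘(ℝ, Model n) x).map_target hy
  have h1 : (mfderiv 𝓘(ℝ, Model n) 𝓘(ℝ, Model n) (extChartAt 𝓘(ℝ, Model n) x).symm y :
      Model n →L[ℝ] Model n) = toTangent x ((extChartAt 𝓘(ℝ, Model n) x).symm y) := by
    refine ContinuousLinearMap.ext fun a => ?_
    exact mfderiv_extChartAt_symm hy a
  have h2 : ContinuousLinearMap.inverse (toTangent x ((extChartAt 𝓘(ℝ, Model n) x).symm y) :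
      Model n →L[ℝ] Model n) = toChart x ((extChartAt 𝓘(ℝ, Model n) x).symm y) := by
    refine ContinuousLinearMap.inverse_eq ?_ ?_
    · exact ContinuousLinearMap.ext (toTangent_toChart hq)
    · exact ContinuousLinearMap.ext (toChart_toTangent hq)
  have h3 : VectorField.mpullback 𝓘(ℝ, Model n) 𝓘(ℝ, Model n)
      (extChartAt 𝓘(ℝ, Model n) x).symm v y =
      ContinuousLinearMap.inverse (mfderiv 𝓘(ℝ, Model n) 𝓘(ℝ, Model n)
        (extChartAt 𝓘(ℝ, Model n) x).symm y : Model n →L[ℝ] Model n)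
        (v ((extChartAt 𝓘(ℝ, Model n) x).symm y)) := rfl
  rw [h3, h1]
  exact congrArg (fun L : Model n →L[ℝ] Model n =>
    L (v ((extChartAt 𝓘(ℝ, Model n) x).symm y))) h2

/-- The bracket is natural under pull-back by the inverse chart, and on the model space it is the
usual commutator. -/
lemma chartRep_mlieBracket (hU : IsOpen U) (hX : IsSmoothOn X U) (hY : IsSmoothOn Y U)
    (hy : y ∈ (extChartAt 𝓘(ℝ, Model n) x).target)
    (hyU : (extChartAt 𝓘(ℝ, Model n) x).symm y ∈ U) :
    chartRep x (VectorField.mlieBracket 𝓘(ℝ, Model n) X Y) y =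
      fderiv ℝ (chartRep x Y) y (chartRep x X y) - fderiv ℝ (chartRep x X) y (chartRep x Y y) := by
  have : IsManifold 𝓘(ℝ, Model n) (minSmoothness ℝ 2) M := IsManifold.of_le two_le_infty
  rw [← inverse_mfderiv_extChartAt_symm hy, VectorField.mpullback_mlieBracket (n := ∞)
    ((ContMDiffOn.contMDiffAt hX (hU.mem_nhds hyU)).mdifferentiableAt (by simp))
    ((ContMDiffOn.contMDiffAt hY (hU.mem_nhds hyU)).mdifferentiableAt (by simp))
    (contMDiffAt_extChartAt_symm hy) two_le_infty, ← VectorField.mlieBracketWithin_univ,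
    VectorField.mlieBracketWithin_eq_lieBracketWithin]
  have hev (v : VField n M) : VectorField.mpullback 𝓘(ℝ, Model n) 𝓘(ℝ, Model n)
      (extChartAt 𝓘(ℝ, Model n) x).symm v =ᶠ[nhds y] chartRep x v := by
    filter_upwards [(isOpen_extChartAt_target x).mem_nhds hy] with z hz
    exact inverse_mfderiv_extChartAt_symm hz
  exact (congrFun VectorField.lieBracketWithin_univ y).trans
    ((hev X).lieBracket_vectorField_eq (hev Y))

/-- The two second covariant derivatives give the curvature tensor by the Ricci identity. What
remains is `∇Z` applied to `∇_X Y - ∇_Y X - [X, Y]`, which vanishes because `Γ` is symmetric. -/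
lemma chartRep_curvature (g : Metric n M) (hU : IsOpen U) (hX : IsSmoothOn X U)
    (hY : IsSmoothOn Y U) (hZ : IsSmoothOn Z U)
    (hy : y ∈ (extChartAt 𝓘(ℝ, Model n) x).target)
    (hyU : (extChartAt 𝓘(ℝ, Model n) x).symm y ∈ U) :
    chartRep x (curvature g X Y Z) y =
      flatCurv (chartChristoffel g x) y (chartRep x X y) (chartRep x Y y) (chartRep x Z y) := by
  have hLC := isLeviCivitaOn_chart g x
  have hΓ := hLC.contDiffAt_christoffel hy
  have cX := hX.contDiffAt hU hy hyU
  have cY := hY.contDiffAt hU hy hyU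
  have cZ := hZ.contDiffAt hU hy hyU
  have e1 : chartRep x (curvature g X Y Z) y =
      chartRep x (cov g X (cov g Y Z)) y - chartRep x (cov g Y (cov g X Z)) y -
        flatNabla (chartChristoffel g x) (chartRep x Z) y
          (chartRep x (VectorField.mlieBracket 𝓘(ℝ, Model n) X Y) y) := by
    rw [← chartRep_nabla g hU hZ hy hyU]
    exact (map_sub (toChart x _) _ _).trans (congrArg (· - _) (map_sub (toChart x _) _ _))
  rw [e1, chartRep_cov g hU (isSmoothOn_cov g hU hY hZ) hy hyU,
    chartRep_cov g hU (isSmoothOn_cov g hU hX hZ) hy hyU, flatCov, flatCov,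
    flatNabla_congr (eventually_chartRep_cov g hU hZ hy hyU),
    flatNabla_congr (eventually_chartRep_cov g hU hZ hy hyU),
    flatNabla_flatCov hΓ cY cZ, flatNabla_flatCov hΓ cX cZ, chartRep_mlieBracket hU hX hY hy hyU,
    ← flatNabla₂_sub_comm hΓ cZ (hLC.symm y hy), flatNabla_apply (V := chartRep x Y),
    flatNabla_apply (V := chartRep x X), map_add, map_add, map_sub,
    hLC.symm y hy (chartRep x X y)]
  abel

/-- The terms of the minimality equation in a chart. -/
lemma chartRep_tension (g : Metric n M) (hU : IsOpen U) (hv : IsSmoothOn v U)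
    (hX : IsSmoothOn X U) (hy : y ∈ (extChartAt 𝓘(ℝ, Model n) x).target)
    (hyU : (extChartAt 𝓘(ℝ, Model n) x).symm y ∈ U) :
    toChart x ((extChartAt 𝓘(ℝ, Model n) x).symm y)
      (cov g X (cov g X v) ((extChartAt 𝓘(ℝ, Model n) x).symm y)
        - cov g (cov g X X) v ((extChartAt 𝓘(ℝ, Model n) x).symm y)
        - cov g (curvature g v (cov g X v) X) v ((extChartAt 𝓘(ℝ, Model n) x).symm y)) =
      flatTension (chartChristoffel g x) (chartRep x v) y (chartRep x X y) := by
  have hLC := isLeviCivitaOn_chart g x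
  have hΓ := hLC.contDiffAt_christoffel hy
  have cX := hX.contDiffAt hU hy hyU
  have cv := hv.contDiffAt hU hy hyU
  have e1 := (map_sub (toChart x ((extChartAt 𝓘(ℝ, Model n) x).symm y)) _ _).trans
    (congrArg (· - toChart x ((extChartAt 𝓘(ℝ, Model n) x).symm y)
      (cov g (curvature g v (cov g X v) X) v ((extChartAt 𝓘(ℝ, Model n) x).symm y)))
      (map_sub (toChart x ((extChartAt 𝓘(ℝ, Model n) x).symm y))
        (cov g X (cov g X v) ((extChartAt 𝓘(ℝ, Model n) x).symm y))
        (cov g (cov g X X) v ((extChartAt 𝓘(ℝ, Model n) x).symm y))))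
  refine e1.trans ?_
  change chartRep x (cov g X (cov g X v)) y - chartRep x (cov g (cov g X X) v) y -
    chartRep x (cov g (curvature g v (cov g X v) X) v) y = _
  -- Since `∇_X ∇_X v = ∇²_{X,X} v + ∇_{∇_X X} v`, the subtracted term removes the derivatives of
  -- `X`, and only its value at the point matters.
  rw [chartRep_cov g hU (isSmoothOn_cov g hU hX hv) hy hyU, chartRep_cov g hU hv hy hyU,
    chartRep_cov g hU hv hy hyU, flatCov, flatCov, flatCov,
    flatNabla_congr (eventually_chartRep_cov g hU hv hy hyU),
    flatNabla_flatCov hΓ cX cv, chartRep_cov g hU hX hy hyU,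
    chartRep_curvature g hU hv (isSmoothOn_cov g hU hX hv) hX hy hyU,
    chartRep_cov g hU hv hy hyU, flatTension, flatCov, flatCov]
  abel

end Covariant

/-! ### Simultaneous diagonalization of two quadratic forms. -/

section Diagonalization

/-- Simultaneous diagonalization of a positive definite and a symmetric bilinear form. -/
lemma exists_simultaneous_diagonalization {n : ℕ} {F : Type*} [AddCommGroup F] [Module ℝ F]
    [FiniteDimensional ℝ F] (hn : Module.finrank ℝ F = n) (G S : LinearMap.BilinForm ℝ F)
    (hG : ∀ a b, G a b = G b a) (hpos : ∀ a, a ≠ 0 → 0 < G a a) (hS : ∀ a b, S a b = S b a) :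
    ∃ (a : Fin n → F) (l : Fin n → ℝ), (∀ i j, G (a i) (a j) = if i = j then 1 else 0) ∧
      (∀ i b, S (a i) b = l i * G (a i) b) ∧ ∀ b, b = ∑ i, G (a i) b • a i := by
  let core : InnerProductSpace.Core ℝ F :=
    { inner := fun a b => G a b
      conj_inner_symm := fun a b => hG b a
      re_inner_nonneg := fun a => by
        by_cases h : a = 0
        · simp [h]
        · exact (hpos a h).le
      add_left := fun a b c => by simp
      smul_left := fun a b r => by simp
      definite := fun a ha => by
        by_contra h
        exact (hpos a h).ne' ha }
  let _ : NormedAddCommGroup F := core.toNormedAddCommGroup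
  let _ : InnerProductSpace ℝ F := InnerProductSpace.ofCore core.toCore
  have hnd : G.Nondegenerate := by
    constructor
    · intro a ha
      by_contra h
      exact (hpos a h).ne' (ha a)
    · intro a ha
      by_contra h
      exact (hpos a h).ne' (ha a)
  -- The operator representing `S` with respect to `G`; it is symmetric for the inner product `G`,
  -- so the spectral theorem applies.
  let T : F →ₗ[ℝ] F := (G.toDual hnd).symm.toLinearMap ∘ₗ S
  have hT : ∀ a b, G (T a) b = S a b := fun a b =>
    LinearMap.BilinForm.apply_toDual_symm_apply (hB := hnd) (S a) b
  have hTs : T.IsSymmetric := fun a b => by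
    change G (T a) b = G a (T b)
    rw [hT, hG a, hT, hS]
  refine ⟨hTs.eigenvectorBasis hn, hTs.eigenvalues hn, fun i j => ?_, fun i b => ?_,
    fun b => ((hTs.eigenvectorBasis hn).sum_repr' b).symm⟩
  · exact (orthonormal_iff_ite.1 (hTs.eigenvectorBasis hn).orthonormal) i j
  · rw [← hT, hTs.apply_eigenvectorBasis, map_smul]
    rfl

end Diagonalization

/-! ### Smooth orthonormal frames with prescribed values at a point. -/

section LocalFrame

variable {E : Type*} [NormedAddCommGroup E] [NormedSpace ℝ E] {n : ℕ} {U : Set E}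
  {G : E → E →L[ℝ] E →L[ℝ] ℝ} {y : E}

/-- The Gram-Schmidt process: extension of an orthonormal system at a point to a smooth
orthonormal system. -/
lemma exists_local_orthonormal_frame (hU : IsOpen U) (hG : ContDiffOn ℝ ∞ G U)
    (hs : ∀ z ∈ U, ∀ a b, G z a b = G z b a) (hy : y ∈ U) (a : Fin n → E)
    (ha : ∀ i j, G y (a i) (a j) = if i = j then 1 else 0) :
    ∃ (e : Fin n → E → E) (W : Set E), IsOpen W ∧ y ∈ W ∧ W ⊆ U ∧
      (∀ i, ContDiffOn ℝ ∞ (e i) W) ∧ (∀ i, e i y = a i) ∧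
      ∀ z ∈ W, ∀ i j, G z (e i z) (e j z) = if i = j then 1 else 0 := by
  suffices H : ∀ k : ℕ, ∃ (e : Fin n → E → E) (W : Set E), IsOpen W ∧ y ∈ W ∧ W ⊆ U ∧
      (∀ i, ContDiffOn ℝ ∞ (e i) W) ∧ (∀ i, e i y = a i) ∧
      ∀ z ∈ W, ∀ i j : Fin n, i.1 < k → j.1 < k →
        G z (e i z) (e j z) = if i = j then 1 else 0 by
    obtain ⟨e, W, h1, h2, h3, h4, h5, h6⟩ := H n
    exact ⟨e, W, h1, h2, h3, h4, h5, fun z hz i j => h6 z hz i j i.2 j.2⟩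
  intro k
  induction k with
  | zero =>
    exact ⟨fun i _ => a i, U, hU, hy, subset_rfl, fun i => contDiffOn_const, fun i => rfl,
      fun z _ i j hi => absurd hi (Nat.not_lt_zero _)⟩
  | succ k ih =>
    obtain ⟨e, W, hW, hyW, hWU, he, hea, heo⟩ := ih
    by_cases hk : k < n
    swap
    · exact ⟨e, W, hW, hyW, hWU, he, hea, fun z hz i j _ _ =>
        heo z hz i j (i.2.trans_le (not_lt.1 hk)) (j.2.trans_le (not_lt.1 hk))⟩
    set κ : Fin n := ⟨k, hk⟩ with hκ
    -- At `y` the vector `a κ` is already orthogonal to the previous ones, so the correction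
    -- vanishes there and the prescribed value is kept.
    let N : E → E := fun z =>
      a κ - ∑ j ∈ Finset.univ.filter (fun j : Fin n => j.1 < k), G z (a κ) (e j z) • e j z
    have hGW : ContDiffOn ℝ ∞ G W := hG.mono hWU
    have hN : ContDiffOn ℝ ∞ N W := by
      refine contDiffOn_const.sub (ContDiffOn.sum fun j _ => ?_)
      exact ((hGW.clm_apply contDiffOn_const).clm_apply (he j)).smul (he j)
    have hNy : N y = a κ := by
      have : ∀ j ∈ Finset.univ.filter (fun j : Fin n => j.1 < k),
          G y (a κ) (e j y) • e j y = 0 := by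
        intro j hj
        have hne : κ ≠ j := by
          rintro rfl
          exact lt_irrefl _ (Finset.mem_filter.1 hj).2
        rw [hea, ha, if_neg hne, zero_smul]
      simp only [N, Finset.sum_eq_zero this, sub_zero]
    have hNN : ContDiffOn ℝ ∞ (fun z => G z (N z) (N z)) W := (hGW.clm_apply hN).clm_apply hN
    -- The neighbourhood is shrunk so that `N` can be normalized smoothly.
    set W' := W ∩ (fun z => G z (N z) (N z)) ⁻¹' Set.Ioi 0 with hW'
    have hW'o : IsOpen W' := hNN.continuousOn.isOpen_inter_preimage hW isOpen_Ioi
    have hpos : ∀ z ∈ W', 0 < G z (N z) (N z) := fun z hz => hz.2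
    let f : E → E := fun z => (Real.sqrt (G z (N z) (N z)))⁻¹ • N z
    have hf : ContDiffOn ℝ ∞ f W' := by
      refine ContDiffOn.smul (ContDiffOn.inv ((hNN.mono Set.inter_subset_left).sqrt
        fun z hz => (hpos z hz).ne') fun z hz => ?_) (hN.mono Set.inter_subset_left)
      exact (Real.sqrt_pos.2 (hpos z hz)).ne'
    have hff : ∀ z ∈ W', G z (f z) (f z) = 1 := by
      intro z hz
      simp only [f, map_smul, smul_apply, smul_eq_mul]
      have h1 := Real.mul_self_sqrt (hpos z hz).le
      have h2 := (Real.sqrt_pos.2 (hpos z hz)).ne'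
      field_simp
      rw [sq, h1]
    have hNe : ∀ z ∈ W', ∀ j : Fin n, j.1 < k → G z (N z) (e j z) = 0 := by
      intro z hz j hj
      simp only [N, map_sub, sub_apply, map_sum, sum_apply, map_smul, smul_apply, smul_eq_mul]
      rw [Finset.sum_eq_single j]
      · rw [heo z hz.1 j j hj hj, if_pos rfl, mul_one, sub_self]
      · intro i hi hij
        rw [heo z hz.1 i j (Finset.mem_filter.1 hi).2 hj, if_neg hij, mul_zero]
      · intro h
        exact (h (Finset.mem_filter.2 ⟨Finset.mem_univ j, hj⟩)).elim
    have hfe : ∀ z ∈ W', ∀ j : Fin n, j.1 < k → G z (f z) (e j z) = 0 := by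
      intro z hz j hj
      simp only [f, map_smul, smul_apply, hNe z hz j hj, smul_zero]
    refine ⟨Function.update e κ f, W', hW'o, ⟨hyW, ?_⟩, Set.inter_subset_left.trans hWU, ?_, ?_, ?_⟩
    · rw [Set.mem_preimage, hNy, ha, if_pos rfl]
      exact zero_lt_one (α := ℝ)
    · intro i
      by_cases hi : i = κ
      · subst hi
        rw [Function.update_self]
        exact hf
      · rw [Function.update_of_ne hi]
        exact (he i).mono Set.inter_subset_left
    · intro i
      by_cases hi : i = κ
      · subst hi
        rw [Function.update_self]
        simp only [f, hNy, ha, if_pos, Real.sqrt_one, inv_one, one_smul]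
      · rw [Function.update_of_ne hi]
        exact hea i
    · intro z hz i j hi hj
      have hlt : ∀ i : Fin n, i.1 < k + 1 → i ≠ κ → i.1 < k := by
        intro i hi hne
        refine lt_of_le_of_ne (Nat.lt_succ_iff.1 hi) fun h => hne (Fin.ext h)
      by_cases hiκ : i = κ
      · by_cases hjκ : j = κ
        · rw [hiκ, hjκ, Function.update_self, if_pos rfl, hff z hz]
        · rw [hiκ, Function.update_self, Function.update_of_ne hjκ, if_neg (Ne.symm hjκ),
            hfe z hz j (hlt j hj hjκ)]
      · by_cases hjκ : j = κ
        · rw [hjκ, Function.update_self, Function.update_of_ne hiκ, if_neg hiκ,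
            hs z (hWU hz.1), hfe z hz i (hlt i hi hiκ)]
        · rw [Function.update_of_ne hiκ, Function.update_of_ne hjκ]
          exact heo z hz.1 i j (hlt i hi hiκ) (hlt j hj hjκ)

end LocalFrame

/-! ### Eigenframes, and the minimality equation in a chart. -/

section Eigenframe

variable {n : ℕ} {M : Type*} [TopologicalSpace M] [ChartedSpace (Model n) M]
  [IsManifold 𝓘(ℝ, Model n) ∞ M] {x q p : M} {y : Model n} {v : VField n M}

lemma chartMetric_toChart (g : Metric n M) (hy : y ∈ (extChartAt 𝓘(ℝ, Model n) x).target)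
    (X Y : TangentSpace 𝓘(ℝ, Model n) ((extChartAt 𝓘(ℝ, Model n) x).symm y)) :
    chartMetric g x y (toChart x ((extChartAt 𝓘(ℝ, Model n) x).symm y) X)
      (toChart x ((extChartAt 𝓘(ℝ, Model n) x).symm y) Y) =
      g.inner ((extChartAt 𝓘(ℝ, Model n) x).symm y) X Y := by
  rw [chartMetric_apply]
  have hq := (extChartAt 𝓘(ℝ, Model n) x).map_target hy
  erw [toTangent_toChart hq, toTangent_toChart hq]

lemma chartMetric_chartRep (g : Metric n M) (hy : y ∈ (extChartAt 𝓘(ℝ, Model n) x).target)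
    (X Y : VField n M) : chartMetric g x y (chartRep x X y) (chartRep x Y y) =
      g.inner ((extChartAt 𝓘(ℝ, Model n) x).symm y) (X ((extChartAt 𝓘(ℝ, Model n) x).symm y))
        (Y ((extChartAt 𝓘(ℝ, Model n) x).symm y)) :=
  chartMetric_toChart g hy _ _

lemma chartMetric_nabla (g : Metric n M) (hv : IsSmooth v)
    (hy : y ∈ (extChartAt 𝓘(ℝ, Model n) x).target) (a b : Model n) :
    chartMetric g x y (flatNabla (chartChristoffel g x) (chartRep x v) y a)
      (flatNabla (chartChristoffel g x) (chartRep x v) y b) =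
    g.inner ((extChartAt 𝓘(ℝ, Model n) x).symm y)
      (nabla g v _ (toTangent x ((extChartAt 𝓘(ℝ, Model n) x).symm y) a))
      (nabla g v _ (toTangent x ((extChartAt 𝓘(ℝ, Model n) x).symm y) b)) := by
  rw [chartMetric_apply, nabla_toTangent g isOpen_univ (hv.isSmoothOn _) hy (Set.mem_univ _),
    nabla_toTangent g isOpen_univ (hv.isSmoothOn _) hy (Set.mem_univ _)]

/-- At every point there is an eigenframe. -/
lemma exists_isEigenframeAt (g : Metric n M) (hv : IsSmooth v) (p : M) :
    ∃ e : Fin n → VField n M, IsEigenframeAt g v p e := by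
  set y := extChartAt 𝓘(ℝ, Model n) p p with hydef
  have hy : y ∈ (extChartAt 𝓘(ℝ, Model n) p).target := mem_extChartAt_target p
  have hyp : (extChartAt 𝓘(ℝ, Model n) p).symm y = p := extChartAt_to_inv p
  have hLC := isLeviCivitaOn_chart g p
  set C := flatNabla (chartChristoffel g p) (chartRep p v) y with hC
  let G : LinearMap.BilinForm ℝ (Model n) := LinearMap.mk₂ ℝ (fun a b => chartMetric g p y a b)
    (by simp) (by simp) (by simp) (by simp)
  let S : LinearMap.BilinForm ℝ (Model n) := LinearMap.mk₂ ℝ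
    (fun a b => chartMetric g p y (C a) (C b)) (by simp) (by simp) (by simp) (by simp)
  obtain ⟨a, l, hao, hal, -⟩ := exists_simultaneous_diagonalization (n := n) (by simp) G S
    (hLC.metric_symm y hy) (hLC.metric_pos y hy) (fun _ _ => hLC.metric_symm y hy _ _)
  obtain ⟨e, W, hWo, hyW, hWU, he, hea, heo⟩ := exists_local_orthonormal_frame hLC.isOpen
    hLC.contDiffOn_metric hLC.metric_symm hy a hao
  let f : Fin n → VField n M := fun i q => toTangent p q (e i (extChartAt 𝓘(ℝ, Model n) p q))
  have hf : ∀ i, ∀ z ∈ (extChartAt 𝓘(ℝ, Model n) p).target, chartRep p (f i) z = e i z := by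
    intro i z hz
    have := toChart_toTangent ((extChartAt 𝓘(ℝ, Model n) p).map_target hz)
      (e i (extChartAt 𝓘(ℝ, Model n) p ((extChartAt 𝓘(ℝ, Model n) p).symm z)))
    rw [(extChartAt 𝓘(ℝ, Model n) p).right_inv hz] at this
    rw [← this, chartRep]
    simp only [f]
    rw [(extChartAt 𝓘(ℝ, Model n) p).right_inv hz]
  refine ⟨f, ⟨(extChartAt 𝓘(ℝ, Model n) p).source ∩ extChartAt 𝓘(ℝ, Model n) p ⁻¹' W,
    (continuousOn_extChartAt p).isOpen_inter_preimage (isOpen_extChartAt_source p) hWo,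
    ⟨mem_extChartAt_source p, hyW⟩, fun i q hq => ?_, fun q hq i j => ?_⟩, fun i => ⟨?_, l i, ?_⟩⟩
  · refine (contMDiffAt_of_chartRep (x := p) hq.1 ?_).contMDiffWithinAt
    refine ((he i).contDiffAt (hWo.mem_nhds hq.2)).congr_of_eventuallyEq ?_
    filter_upwards [(isOpen_extChartAt_target p).mem_nhds
      ((extChartAt 𝓘(ℝ, Model n) p).map_source hq.1)] with z hz using hf i z hz
  · have hz := (extChartAt 𝓘(ℝ, Model n) p).map_source hq.1
    have h1 := chartMetric_chartRep g hz (f i) (f j)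
    rw [hf i _ hz, hf j _ hz, (extChartAt 𝓘(ℝ, Model n) p).left_inv hq.1, heo _ hq.2] at h1
    exact h1.symm
  · intro h0
    have h1 : chartRep p (f i) y = a i := by rw [hf i y hy, hea]
    have h2 : chartRep p (f i) y = 0 := by
      rw [chartRep_extChartAt (f i) (mem_extChartAt_source p), h0]
      exact map_zero _
    have h3 := hao i i
    rw [if_pos rfl, ← h1, h2, map_zero] at h3
    exact zero_ne_one h3
  · intro Y
    have h1 : f i p = a i := by
      have h2 : f i p = toTangent p p (e i y) := rfl
      rw [h2, hea]
      exact toTangent_self p (a i)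
    have h2 := hal i Y
    have h3 := chartMetric_nabla g hv hy (a i) Y
    have h4 := chartMetric_apply g p y (a i) Y
    have h5 : chartMetric g p y (C (a i)) (C Y) = l i * chartMetric g p y (a i) Y := h2
    rw [h3, h4, hyp] at h5
    rw [h1]
    erw [toTangent_self, toTangent_self] at h5
    exact h5

/-- The minimality equation in a chart. -/
lemma minimalUnitEquation_iff (g : Metric n M) (hv : IsSmooth v) (hu : IsUnitField g v)
    {e : Fin n → VField n M} (hy : y ∈ (extChartAt 𝓘(ℝ, Model n) x).target)
    (he : IsEigenframeAt g v ((extChartAt 𝓘(ℝ, Model n) x).symm y) e) :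
    MinimalUnitEquation g v e ((extChartAt 𝓘(ℝ, Model n) x).symm y) ↔
      ∀ u, chartMetric g x y u (chartRep x v y) = 0 →
        flatEulerLagrange (chartMetric g x) (chartChristoffel g x) (chartRep x v) y u = 0 := by
  obtain ⟨⟨U, hU, hyU, hes, heo⟩, hev⟩ := he
  have hq := (extChartAt 𝓘(ℝ, Model n) x).map_target hy
  have hLC := isLeviCivitaOn_chart g x
  have hnab : ∀ i, toTangent x ((extChartAt 𝓘(ℝ, Model n) x).symm y) (chartRep x (e i) y) =
      e i ((extChartAt 𝓘(ℝ, Model n) x).symm y) := fun i => toTangent_chartRep (e i) hy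
  rw [hLC.eulerLagrange_iff hy (e := fun i => chartRep x (e i) y)
    (l := fun i => lamSq g v e ((extChartAt 𝓘(ℝ, Model n) x).symm y) i)
    (hv.contDiffOn_chartRep x)
    (fun z hz => (chartMetric_chartRep g hz v v).trans (hu _))
    (fun i j => (chartMetric_chartRep g hy (e i) (e j)).trans (heo _ hyU i j))
    (fun i j => by
      rw [chartMetric_nabla g hv hy, hnab, hnab]
      -- Off the diagonal the eigenvector equation reduces the claim to orthonormality; on the
      -- diagonal the value is `lamSq` by definition, so `μ` need not be identified.
      obtain ⟨-, μ, hμ⟩ := hev i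
      split_ifs with hij
      · subst hij
        rfl
      · rw [hμ, heo _ hyU, if_neg hij, mul_zero])]
  have hT : ∀ i, flatTension (chartChristoffel g x) (chartRep x v) y (chartRep x (e i) y) =
      toChart x ((extChartAt 𝓘(ℝ, Model n) x).symm y) _ := fun i =>
    (chartRep_tension g hU (hv.isSmoothOn _) (hes i) hy hyU).symm
  simp only [hT]
  rw [MinimalUnitEquation]
  have hinj : Function.Injective (toChart x ((extChartAt 𝓘(ℝ, Model n) x).symm y)) :=
    (fun a b hab => by
      rw [← toTangent_toChart hq a, hab, toTangent_toChart hq])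
  refine hinj.eq_iff.symm.trans ?_
  refine Eq.congr ?_ (map_smul (toChart x ((extChartAt 𝓘(ℝ, Model n) x).symm y)) _ _)
  refine (map_sum (toChart x ((extChartAt 𝓘(ℝ, Model n) x).symm y)) _ _).trans ?_
  exact Finset.sum_congr rfl fun i _ =>
    map_smul (toChart x ((extChartAt 𝓘(ℝ, Model n) x).symm y)) _ _

end Eigenframe

/-! ### The density along a path of vector fields. -/

section TimeDependent

variable {n : ℕ} {U : Set (Model n)} {G : Model n → Model n →L[ℝ] Model n →L[ℝ] ℝ}
  {Γ : Model n → Model n →L[ℝ] Model n →L[ℝ] Model n} {V : Model n → Model n} {y : Model n}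
  {W : ℝ × Model n → Model n} {t : ℝ}

lemma hasFDerivAt_slice (hW : ContDiffAt ℝ ∞ W (t, y)) :
    HasFDerivAt (fun z => W (t, z))
      ((fderiv ℝ W (t, y)).comp (ContinuousLinearMap.inr ℝ ℝ (Model n))) y :=
  (hW.differentiableAt (by simp)).hasFDerivAt.comp y (hasFDerivAt_prodMk_right t y)

lemma hasDerivAt_slice {F : Type*} [NormedAddCommGroup F] [NormedSpace ℝ F]
    {W : ℝ × Model n → F} (hW : ContDiffAt ℝ ∞ W (t, y)) :
    HasDerivAt (fun s => W (s, y)) (fderiv ℝ W (t, y) (1, 0)) t := by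
  have h : HasFDerivAt (fun s => W (s, y)) _ t :=
    (hW.differentiableAt (by simp)).hasFDerivAt.comp t (hasFDerivAt_prodMk_left (𝕜 := ℝ) t y)
  exact h.hasDerivAt

lemma contDiffAt_velocity (hW : ContDiffAt ℝ ∞ W (t, y)) :
    ContDiffAt ℝ ∞ (fun z => fderiv ℝ W (t, z) (1, 0)) y := by
  have h1 : ContDiffAt ℝ ∞ (fderiv ℝ W) (t, y) := hW.fderiv_right (by simp)
  have h2 : ContDiffAt ℝ ∞ (fun z : Model n => (t, z)) y := contDiffAt_const.prodMk contDiffAt_id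
  exact (h1.comp y h2).clm_apply contDiffAt_const

lemma flatNabla_slice (hW : ContDiffAt ℝ ∞ W (t, y)) :
    flatNabla Γ (fun z => W (t, z)) y =
      (fderiv ℝ W (t, y)).comp (ContinuousLinearMap.inr ℝ ℝ (Model n)) +
        (Γ y).flip (W (t, y)) := by
  rw [flatNabla, (hasFDerivAt_slice hW).fderiv]

/-- The time derivative commutes with `∇` by symmetry of the second derivative of `W` on `(1, 0)`
and `(0, a)`; the Christoffel term is linear in the field. -/
lemma hasDerivAt_flatNabla (hW : ContDiffAt ℝ ∞ W (t, y))
    (hW' : ∀ᶠ s in nhds t, ContDiffAt ℝ ∞ W (s, y)) (a : Model n) :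
    HasDerivAt (fun s => flatNabla Γ (fun z => W (s, z)) y a)
      (flatNabla Γ (fun z => fderiv ℝ W (t, z) (1, 0)) y a) t := by
  have hD : ContDiffAt ℝ ∞ (fderiv ℝ W) (t, y) := hW.fderiv_right (by simp)
  have hD' := (hD.differentiableAt (by simp)).hasFDerivAt
  have hsymm : IsSymmSndFDerivAt ℝ W (t, y) := hW.isSymmSndFDerivAt two_le_infty
  have h1 : HasDerivAt (fun s => fderiv ℝ W (s, y) (0, a))
      (fderiv ℝ (fderiv ℝ W) (t, y) (1, 0) (0, a)) t := by
    have h3 : HasFDerivAt (fun z => fderiv ℝ W z (0, a)) _ (t, y) :=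
      hD'.clm_apply (hasFDerivAt_const ((0 : ℝ), a) (t, y))
    have h4 : HasFDerivAt (fun s => fderiv ℝ W (s, y) (0, a)) _ t :=
      HasFDerivAt.comp (g := fun z => fderiv ℝ W z (0, a)) t h3
        (hasFDerivAt_prodMk_left (𝕜 := ℝ) t y)
    refine h4.hasDerivAt.congr_deriv ?_
    change fderiv ℝ W (t, y) 0 + fderiv ℝ (fderiv ℝ W) (t, y) (1, 0) (0, a) = _
    rw [map_zero, zero_add]
  have h2 : HasDerivAt (fun s => Γ y a (W (s, y))) (Γ y a (fderiv ℝ W (t, y) (1, 0))) t :=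
    (Γ y a).hasFDerivAt.comp_hasDerivAt t (hasDerivAt_slice hW)
  have h3 : fderiv ℝ (fun z => fderiv ℝ W (t, z) (1, 0)) y a =
      fderiv ℝ (fderiv ℝ W) (t, y) (0, a) (1, 0) := by
    have := (hD'.clm_apply (hasFDerivAt_const ((1 : ℝ), (0 : Model n)) (t, y))).comp y
      (hasFDerivAt_prodMk_right (𝕜 := ℝ) t y)
    have h4 : fderiv ℝ (fun z => fderiv ℝ W (t, z) (1, 0)) y = _ := this.fderiv
    rw [h4]
    simp
  rw [flatNabla_apply, h3, hsymm]
  refine (h1.add h2).congr_of_eventuallyEq ?_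
  filter_upwards [hW'] with s hs
  rw [flatNabla_slice hs]
  rfl

namespace IsLeviCivitaOn

variable (h : IsLeviCivitaOn U G Γ) (hW : ContDiffOn ℝ ∞ W (Set.univ ×ˢ U)) (hy : y ∈ U)
include h hW hy

lemma contDiffAt_path (t : ℝ) : ContDiffAt ℝ ∞ W (t, y) :=
  hW.contDiffAt ((isOpen_univ.prod h.isOpen).mem_nhds ⟨Set.mem_univ _, hy⟩)

lemma contDiffAt_flatDensity_path (t : ℝ) :
    ContDiffAt ℝ ∞ (fun s : ℝ × Model n => flatDensity G Γ (fun z => W (s.1, z)) s.2) (t, y) := by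
  have hWt := h.contDiffAt_path hW hy t
  have hG : ContDiffAt ℝ ∞ (fun s : ℝ × Model n => G s.2) (t, y) :=
    (h.contDiffAt_metric hy).comp (t, y) contDiffAt_snd
  have hΓ : ContDiffAt ℝ ∞ (fun s : ℝ × Model n => Γ s.2) (t, y) :=
    (h.contDiffAt_christoffel hy).comp (t, y) contDiffAt_snd
  have hD : ContDiffAt ℝ ∞ (fderiv ℝ W) (t, y) := hWt.fderiv_right (by simp)
  have hC (a : Model n) : ContDiffAt ℝ ∞
      (fun s : ℝ × Model n => flatNabla Γ (fun z => W (s.1, z)) s.2 a) (t, y) := by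
    have h1 : ContDiffAt ℝ ∞ (fun s : ℝ × Model n => fderiv ℝ W s (0, a) + Γ s.2 a (W s)) (t, y) :=
      (hD.clm_apply contDiffAt_const).add ((hΓ.clm_apply contDiffAt_const).clm_apply hWt)
    refine h1.congr_of_eventuallyEq ?_
    filter_upwards [(isOpen_univ.prod h.isOpen).mem_nhds (⟨Set.mem_univ _, hy⟩ :
      (t, y) ∈ Set.univ ×ˢ U)] with s hs
    rw [flatNabla_slice (h.contDiffAt_path hW hs.2 s.1)]
    rfl
  refine (contDiffAt_matrix_det fun i j => ?_).sqrt (h.det_gram_pos hy).ne'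
  exact ((hG.clm_apply contDiffAt_const).clm_apply contDiffAt_const).add
    ((hG.clm_apply (hC _)).clm_apply (hC _))

/-- Differentiating `H` yields two cross terms, transposes of each other. They have the same trace
against the symmetric `H⁻¹`, and this absorbs the factor `1 / 2` of the square root. -/
lemma hasDerivAt_flatDensity (t : ℝ) :
    HasDerivAt (fun s => flatDensity G Γ (fun z => W (s, z)) y)
      (flatFirstVar G Γ (fun z => W (t, z)) (fun z => fderiv ℝ W (t, z) (1, 0)) y) t := by
  set V : Model n → Model n := fun z => W (t, z)
  set V' : Model n → Model n := fun z => fderiv ℝ W (t, z) (1, 0)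
  have hC := hasDerivAt_flatNabla (Γ := Γ) (h.contDiffAt_path hW hy t)
    (Filter.Eventually.of_forall (h.contDiffAt_path hW hy))
  have hA : ∀ i j : Fin n, HasDerivAt
      (fun s => gram (flatInduced G Γ (fun z => W (s, z)) y) i j)
      (gram ((G y).bilinearComp (flatNabla Γ V' y) (flatNabla Γ V y)) i j +
        gram ((G y).bilinearComp (flatNabla Γ V y) (flatNabla Γ V' y)) i j) t := by
    intro i j
    have h1 := (((G y).hasFDerivAt.comp_hasDerivAt t (hC (stdBasis i))).clm_apply
      (hC (stdBasis j))).const_add (G y (stdBasis i) (stdBasis j))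
    exact h1
  obtain ⟨L, hL, hLc⟩ := hasFDerivAt_sqrt_det (A := fun s =>
    gram (flatInduced G Γ (fun z => W (s, z)) y)) (fun i j => (hA i j).hasFDerivAt)
    (h.det_gram_pos hy)
  have h2 := hL.hasDerivAt
  rw [hLc] at h2
  refine (show HasDerivAt (fun s => flatDensity G Γ (fun z => W (s, z)) y) _ t from h2).congr_deriv ?_
  have h3 : (Matrix.of fun i j => ((ContinuousLinearMap.toSpanSingleton ℝ
      (gram ((G y).bilinearComp (flatNabla Γ V' y) (flatNabla Γ V y)) i j +
        gram ((G y).bilinearComp (flatNabla Γ V y) (flatNabla Γ V' y)) i j) : ℝ →L[ℝ] ℝ) 1)) =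
      gram ((G y).bilinearComp (flatNabla Γ V' y) (flatNabla Γ V y)) +
        gram ((G y).bilinearComp (flatNabla Γ V y) (flatNabla Γ V' y)) := by
    ext i j
    simp
  rw [h3, Matrix.mul_add, Matrix.trace_add]
  have h4 : gram ((G y).bilinearComp (flatNabla Γ V' y) (flatNabla Γ V y)) =
      (gram ((G y).bilinearComp (flatNabla Γ V y) (flatNabla Γ V' y))).transpose := by
    ext i j
    exact h.metric_symm y hy _ _
  have h5 : (gram (flatInduced G Γ V y)).transpose = gram (flatInduced G Γ V y) := by
    ext i j
    exact h.flatInduced_symm hy _ _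
  have h6 : ((gram (flatInduced G Γ V y))⁻¹ *
      gram ((G y).bilinearComp (flatNabla Γ V' y) (flatNabla Γ V y))).trace =
      ((gram (flatInduced G Γ V y))⁻¹ *
      gram ((G y).bilinearComp (flatNabla Γ V y) (flatNabla Γ V' y))).trace := by
    rw [h4, ← Matrix.trace_transpose, Matrix.transpose_mul, Matrix.transpose_transpose,
      Matrix.transpose_nonsing_inv, h5, Matrix.trace_mul_comm]
  change 1 / 2 * flatDensity G Γ V y * (((gram (flatInduced G Γ V y))⁻¹ * _).trace +
    ((gram (flatInduced G Γ V y))⁻¹ * _).trace) = flatDensity G Γ V y * _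
  rw [h6]
  ring

end IsLeviCivitaOn

end TimeDependent

/-! ### The pulled-back Sasaki metric. -/

section Induced

variable {n : ℕ} {M : Type*} [TopologicalSpace M] [ChartedSpace (Model n) M]
  [IsManifold 𝓘(ℝ, Model n) ∞ M] {x q p : M} {y : Model n} {v : VField n M}

/-- The horizontal part is the identity because the section composed with the projection is; the
vertical part is `∇v` by definition. -/
lemma inducedMetric_eq (g : Metric n M) (hv : IsSmooth v) (q : M)
    (X Y : TangentSpace 𝓘(ℝ, Model n) q) : inducedMetric g v q X Y =
      g.inner q X Y + g.inner q (nabla g v q X) (nabla g v q Y) := by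
  have h1 : ∀ X : TangentSpace 𝓘(ℝ, Model n) q,
      mfderiv 𝓘(ℝ, Model n).tangent 𝓘(ℝ, Model n)
        (fun w : TangentBundle 𝓘(ℝ, Model n) M => w.proj) (sectionMap v q)
        (mfderiv 𝓘(ℝ, Model n) 𝓘(ℝ, Model n).tangent (sectionMap v) q X) = X := by
    intro X
    have hp : MDifferentiableAt 𝓘(ℝ, Model n).tangent 𝓘(ℝ, Model n)
        (fun w : TangentBundle 𝓘(ℝ, Model n) M => w.proj) (sectionMap v q) :=
      (Bundle.contMDiff_proj (IB := 𝓘(ℝ, Model n)) (F := Model n) (n := ∞)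
        (TangentSpace 𝓘(ℝ, Model n) : M → Type _)).mdifferentiableAt (by simp)
    have hs : MDifferentiableAt 𝓘(ℝ, Model n) 𝓘(ℝ, Model n).tangent (sectionMap v) q :=
      hv.contMDiffAt.mdifferentiableAt (by simp)
    have h2 := mfderiv_comp_apply q hp hs X
    have h3 : mfderiv 𝓘(ℝ, Model n) 𝓘(ℝ, Model n)
      ((fun w : TangentBundle 𝓘(ℝ, Model n) M => w.proj) ∘ sectionMap v) q X = X := by
      change mfderiv 𝓘(ℝ, Model n) 𝓘(ℝ, Model n) (id : M → M) q X = X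
      rw [mfderiv_id]
      rfl
    exact h2.symm.trans h3
  have h4 : inducedMetric g v q X Y = g.inner q
      (mfderiv 𝓘(ℝ, Model n).tangent 𝓘(ℝ, Model n)
        (fun w : TangentBundle 𝓘(ℝ, Model n) M => w.proj) (sectionMap v q)
        (mfderiv 𝓘(ℝ, Model n) 𝓘(ℝ, Model n).tangent (sectionMap v) q X))
      (mfderiv 𝓘(ℝ, Model n).tangent 𝓘(ℝ, Model n)
        (fun w : TangentBundle 𝓘(ℝ, Model n) M => w.proj) (sectionMap v q)
        (mfderiv 𝓘(ℝ, Model n) 𝓘(ℝ, Model n).tangent (sectionMap v) q Y)) +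
      g.inner q (nabla g v q X) (nabla g v q Y) := rfl
  rw [h4]
  erw [h1, h1]

lemma coordMatrix_inducedMetric (g : Metric n M) (hv : IsSmooth v)
    (hy : y ∈ (extChartAt 𝓘(ℝ, Model n) x).target) :
    coordMatrix (inducedMetric g v) x y =
      gram (flatInduced (chartMetric g x) (chartChristoffel g x) (chartRep x v) y) := by
  ext i j
  simp only [coordMatrix, Matrix.of_apply, gram_apply, inducedMetric_eq g hv, flatInduced_apply]
  rw [mfderiv_extChartAt_symm hy, mfderiv_extChartAt_symm hy,
    ← chartMetric_nabla g hv hy]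
  rfl

end Induced

/-! ### Integrals of functions with compact support in an open set. -/

section Integrals

open MeasureTheory

variable {n : ℕ} {T K : Set (Model n)}

lemma integrableOn_of_continuousOn_of_eq_zero {f : Model n → ℝ} (hT : IsOpen T) (hK : IsCompact K)
    (hKT : K ⊆ T) (hf : ContinuousOn f T) (h0 : ∀ y ∈ T \ K, f y = 0) : IntegrableOn f T := by
  have h1 : IntegrableOn f K := (hf.mono hKT).integrableOn_compact hK
  exact h1.of_forall_sdiff_eq_zero hT.measurableSet h0

lemma contDiff_indicator {f : Model n → ℝ} (hT : IsOpen T) (hK : IsCompact K)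
    (hKT : K ⊆ T) (hf : ContDiffOn ℝ ∞ f T) (h0 : ∀ y ∈ T \ K, f y = 0) :
    ContDiff ℝ ∞ (T.indicator f) := by
  refine contDiff_iff_contDiffAt.2 fun y => ?_
  by_cases hy : y ∈ T
  · refine (hf.contDiffAt (hT.mem_nhds hy)).congr_of_eventuallyEq ?_
    filter_upwards [hT.mem_nhds hy] with z hz
    exact Set.indicator_of_mem hz f
  · refine (contDiffAt_const (c := (0 : ℝ))).congr_of_eventuallyEq ?_
    filter_upwards [hK.isClosed.isOpen_compl.mem_nhds fun h => hy (hKT h)] with z hz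
    by_cases hzT : z ∈ T
    · rw [Set.indicator_of_mem hzT, h0 z ⟨hzT, hz⟩]
    · exact Set.indicator_of_notMem hzT f

lemma hasCompactSupport_indicator {f : Model n → ℝ} (hK : IsCompact K)
    (h0 : ∀ y ∈ T \ K, f y = 0) : HasCompactSupport (T.indicator f) := by
  refine HasCompactSupport.intro hK fun y hy => ?_
  by_cases hyT : y ∈ T
  · rw [Set.indicator_of_mem hyT, h0 y ⟨hyT, hy⟩]
  · exact Set.indicator_of_notMem hyT f

/-- Integration by parts against the constant function `1`. -/
lemma integral_fderiv_eq_zero {f : Model n → ℝ} (hf : ContDiff ℝ ∞ f) (hc : HasCompactSupport f)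
    (a : Model n) : ∫ y, fderiv ℝ f y a = 0 := by
  have hf' : Continuous fun y => fderiv ℝ f y a :=
    (hf.continuous_fderiv (by simp)).clm_apply continuous_const
  have h := integral_mul_fderiv_eq_neg_fderiv_mul_of_integrable (μ := (volume : Measure (Model n)))
    (f := fun _ => (1 : ℝ)) (g := f) (v := a) (by simp)
    (by simpa using hf'.integrable_of_hasCompactSupport (hc.fderiv_apply ℝ a))
    (by simpa using hf.continuous.integrable_of_hasCompactSupport hc)
    (fun _ _ => differentiableAt_const _) (fun y _ => hf.contDiffAt.differentiableAt (by simp))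
  simpa using h

lemma setIntegral_fderiv_eq_zero {f : Model n → ℝ} (hT : IsOpen T) (hK : IsCompact K)
    (hKT : K ⊆ T) (hf : ContDiffOn ℝ ∞ f T) (h0 : ∀ y ∈ T \ K, f y = 0) (a : Model n) :
    ∫ y in T, fderiv ℝ f y a = 0 := by
  rw [← integral_fderiv_eq_zero (contDiff_indicator hT hK hKT hf h0)
    (hasCompactSupport_indicator hK h0) a, ← integral_indicator hT.measurableSet]
  congr 1
  ext y
  by_cases hy : y ∈ T
  · rw [Set.indicator_of_mem hy]
    have : T.indicator f =ᶠ[nhds y] f := by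
      filter_upwards [hT.mem_nhds hy] with z hz
      exact Set.indicator_of_mem hz f
    rw [this.fderiv_eq]
  · rw [Set.indicator_of_notMem hy]
    have : T.indicator f =ᶠ[nhds y] fun _ => 0 := by
      filter_upwards [hK.isClosed.isOpen_compl.mem_nhds fun h => hy (hKT h)] with z hz
      by_cases hzT : z ∈ T
      · rw [Set.indicator_of_mem hzT, h0 z ⟨hzT, hz⟩]
      · exact Set.indicator_of_notMem hzT f
    rw [this.fderiv_eq]
    simp

/-- Dominated convergence: all integrals reduce to the compact `K`, where the time derivative is
uniformly bounded for times within `1` of `t`. -/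
lemma hasDerivAt_setIntegral {F : ℝ × Model n → ℝ} (hT : IsOpen T) (hK : IsCompact K)
    (hKT : K ⊆ T) (hF : ContDiffOn ℝ ∞ F (Set.univ ×ˢ T)) (h0 : ∀ t, ∀ y ∈ T \ K, F (t, y) = 0)
    (t : ℝ) :
    HasDerivAt (fun s => ∫ y in T, F (s, y)) (∫ y in T, fderiv ℝ F (t, y) (1, 0)) t := by
  have hF' : ∀ s, ∀ y ∈ T, ContDiffAt ℝ ∞ F (s, y) := fun s y hy =>
    hF.contDiffAt ((isOpen_univ.prod hT).mem_nhds ⟨Set.mem_univ _, hy⟩)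
  have hd : ∀ s, ∀ y ∈ T, HasDerivAt (fun s => F (s, y)) (fderiv ℝ F (s, y) (1, 0)) s := by
    intro s y hy
    have h : HasFDerivAt (fun s => F (s, y)) _ s :=
      HasFDerivAt.comp (g := F) s ((hF' s y hy).differentiableAt (by simp)).hasFDerivAt
        (hasFDerivAt_prodMk_left (𝕜 := ℝ) s y)
    exact h.hasDerivAt
  have hcont : ContinuousOn (fun z => fderiv ℝ F z (1, 0)) (Set.univ ×ˢ T) :=
    (hF.continuousOn_fderiv_of_isOpen (isOpen_univ.prod hT) (by simp)).clm_apply continuousOn_const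
  have hslice : ∀ {f : ℝ × Model n → ℝ} (s : ℝ), ContinuousOn f (Set.univ ×ˢ T) →
      ContinuousOn (fun y => f (s, y)) K := fun s hf =>
    hf.comp (by fun_prop) fun y hy => ⟨Set.mem_univ _, hKT hy⟩
  have h1 : ∀ s, ∫ y in T, F (s, y) = ∫ y in K, F (s, y) := fun s =>
    (setIntegral_eq_of_subset_of_forall_sdiff_eq_zero hT.measurableSet hKT (h0 s)).symm ▸ rfl
  -- Off `K` the function vanishes at every time, so its time derivative vanishes as well, even at
  -- boundary points of `K`.
  have h2 : ∫ y in T, fderiv ℝ F (t, y) (1, 0) = ∫ y in K, fderiv ℝ F (t, y) (1, 0) := by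
    refine setIntegral_eq_of_subset_of_forall_sdiff_eq_zero hT.measurableSet hKT fun y hy => ?_
    have h3 := hd t y hy.1
    rw [show (fun s => F (s, y)) = fun _ => 0 from funext fun s => h0 s y hy] at h3
    exact h3.unique (hasDerivAt_const t _)
  obtain ⟨C, hC⟩ := (isCompact_Icc.prod hK).exists_bound_of_continuousOn
    (s := Set.Icc (t - 1) (t + 1) ×ˢ K) (hcont.mono (Set.prod_mono (Set.subset_univ _) hKT))
  simp only [h1, h2]
  refine (hasDerivAt_integral_of_dominated_loc_of_deriv_le (μ := volume.restrict K)
    (F' := fun s y => fderiv ℝ F (s, y) (1, 0)) (bound := fun _ => C)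
    (Icc_mem_nhds (sub_one_lt t) (lt_add_one t)) ?_ ?_ ?_ ?_ ?_ ?_).2
  · exact Filter.Eventually.of_forall fun s =>
      (hslice s hF.continuousOn).aestronglyMeasurable hK.isClosed.measurableSet
  · exact (hslice t hF.continuousOn).integrableOn_compact hK
  · exact (hslice t hcont).aestronglyMeasurable hK.isClosed.measurableSet
  · exact (ae_restrict_iff' hK.isClosed.measurableSet).2
      (Filter.Eventually.of_forall fun y hy s hs => hC (s, y) ⟨hs, hy⟩)
  · exact integrableOn_const hK.measure_lt_top.ne
  · exact (ae_restrict_iff' hK.isClosed.measurableSet).2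
      (Filter.Eventually.of_forall fun y hy s _ => hd s y (hKT hy))

end Integrals

/-! ### Integration by parts of the first variation in a chart. -/

section FirstVariation

open MeasureTheory

variable {n : ℕ} {U K : Set (Model n)} {G : Model n → Model n →L[ℝ] Model n →L[ℝ] ℝ}
  {Γ : Model n → Model n →L[ℝ] Model n →L[ℝ] Model n} {V W : Model n → Model n} {y : Model n}

lemma flatNabla_eq_zero (hW : ∀ᶠ z in nhds y, W z = 0) : flatNabla Γ W y = 0 := by
  ext1 a
  have h : W =ᶠ[nhds y] fun _ => 0 := hW
  rw [flatNabla_apply, h.fderiv_eq, h.eq_of_nhds]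
  simp

lemma flatFirstVar_eq_zero (hW : ∀ᶠ z in nhds y, W z = 0) : flatFirstVar G Γ V W y = 0 := by
  have : gram ((G y).bilinearComp (flatNabla Γ V y) (0 : Model n →L[ℝ] Model n)) = 0 := by
    ext i j
    simp
  rw [flatFirstVar, flatNabla_eq_zero hW, this]
  simp

lemma flatFirstVar_sum {ι : Type*} (s : Finset ι) {w : ι → Model n → Model n}
    (hw : ∀ i ∈ s, DifferentiableAt ℝ (w i) y) :
    flatFirstVar G Γ V (fun z => ∑ i ∈ s, w i z) y = ∑ i ∈ s, flatFirstVar G Γ V (w i) y := by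
  have h1 : gram ((G y).bilinearComp (flatNabla Γ V y) (flatNabla Γ (fun z => ∑ i ∈ s, w i z) y)) =
      ∑ i ∈ s, gram ((G y).bilinearComp (flatNabla Γ V y) (flatNabla Γ (w i) y)) := by
    ext k l
    rw [Matrix.sum_apply]
    simp only [gram_apply, ContinuousLinearMap.bilinearComp_apply, flatNabla_apply,
      fderiv_fun_sum hw, sum_apply, map_sum, ← Finset.sum_add_distrib, map_add]
  rw [flatFirstVar, h1, Finset.mul_sum, Matrix.trace_sum, Finset.mul_sum]
  rfl

lemma fluxVector_smul (c : ℝ) (u : Model n) :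
    fluxVector G Γ V y (c • u) = c • fluxVector G Γ V y u := by
  simp only [fluxVector, map_smul, smul_eq_mul, Finset.smul_sum, smul_smul, Finset.mul_sum]
  refine Finset.sum_congr rfl fun b _ => ?_
  congr 1
  exact Finset.sum_congr rfl fun a _ => by ring

/-- Homogeneity allows a test function to be pulled out in the fundamental lemma. -/
lemma flatEulerLagrange_smul (c : ℝ) (u : Model n) :
    flatEulerLagrange G Γ V y (c • u) = c * flatEulerLagrange G Γ V y u := by
  have h1 : fderiv ℝ (fun z => ((G z).flip (c • u)).comp (flatNabla Γ V z)) y =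
      c • fderiv ℝ (fun z => ((G z).flip u).comp (flatNabla Γ V z)) y := by
    have h0 : (fun z => ((G z).flip (c • u)).comp (flatNabla Γ V z)) =
        c • fun z => ((G z).flip u).comp (flatNabla Γ V z) := by
      ext z a
      simp
    rw [h0, fderiv_const_smul_field]
    rfl
  have h2 : gram (eulerLagrangeForm G Γ V y (c • u)) = c • gram (eulerLagrangeForm G Γ V y u) := by
    ext i j
    rw [eulerLagrangeForm, eulerLagrangeForm, h1, fluxVector_smul]
    simp only [gram_apply, Matrix.smul_apply, add_apply, sub_apply, smul_apply,
      ContinuousLinearMap.comp_apply, ContinuousLinearMap.flip_apply,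
      ContinuousLinearMap.bilinearComp_apply, ContinuousLinearMap.compL_apply,
      ContinuousLinearMap.apply_apply, map_smul, smul_eq_mul]
    ring
  rw [flatEulerLagrange, flatEulerLagrange, h2, Matrix.mul_smul, Matrix.trace_smul, smul_eq_mul]
  ring

namespace IsLeviCivitaOn

variable (h : IsLeviCivitaOn U G Γ)
include h

lemma contDiffAt_flatFirstVar (hy : y ∈ U) (hV : ContDiffAt ℝ ∞ V y) (hW : ContDiffAt ℝ ∞ W y) :
    ContDiffAt ℝ ∞ (flatFirstVar G Γ V W) y := by
  refine (h.contDiffAt_flatDensity hy hV).mul ?_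
  simp only [Matrix.trace, Matrix.diag, Matrix.mul_apply]
  refine ContDiffAt.sum fun i _ => ContDiffAt.sum fun j _ => ?_
  have hΓ := h.contDiffAt_christoffel hy
  exact (contDiffAt_matrix_inv (h.contDiffAt_gram hy hV) (h.det_gram_pos hy).ne' i j).mul
    (((h.contDiffAt_metric hy).clm_apply ((contDiffAt_flatNabla hΓ hV).clm_apply
      contDiffAt_const)).clm_apply ((contDiffAt_flatNabla hΓ hW).clm_apply contDiffAt_const))

/-- Smoothness is read off from the divergence identity, whose remaining terms are smooth, rather
than from the explicit formula. -/
lemma contDiffAt_flatEulerLagrange (hy : y ∈ U) (hV : ContDiffOn ℝ ∞ V U)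
    (hW : ContDiffOn ℝ ∞ W U) :
    ContDiffAt ℝ ∞ (fun z => flatEulerLagrange G Γ V z (W z)) y := by
  have hU := h.isOpen.mem_nhds hy
  have h1 : ContDiffAt ℝ ∞ (fun z => flatFirstVar G Γ V W z -
      ∑ b, fderiv ℝ (flatFlux G Γ V W b) z (stdBasis b)) y := by
    refine (h.contDiffAt_flatFirstVar hy (hV.contDiffAt hU) (hW.contDiffAt hU)).sub
      (ContDiffAt.sum fun b _ => ?_)
    exact ((h.contDiffAt_flatFlux hy (hV.contDiffAt hU) (hW.contDiffAt hU) b).fderiv_right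
      (by simp)).clm_apply contDiffAt_const
  refine h1.congr_of_eventuallyEq ?_
  filter_upwards [hU] with z hz
  have hz' := h.isOpen.mem_nhds hz
  rw [h.sum_fderiv_flatFlux hz (hV.contDiffAt hz') ((hW.contDiffAt hz').differentiableAt (by simp))]
  ring

/-- Integration by parts of the first variation. -/
lemma integral_flatFirstVar (hK : IsCompact K) (hKU : K ⊆ U) (hV : ContDiffOn ℝ ∞ V U)
    (hW : ContDiffOn ℝ ∞ W U) (h0 : ∀ y ∈ U \ K, W y = 0) :
    ∫ y in U, flatFirstVar G Γ V W y = ∫ y in U, flatEulerLagrange G Γ V y (W y) := by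
  have hV' : ∀ y ∈ U, ContDiffAt ℝ ∞ V y := fun y hy => hV.contDiffAt (h.isOpen.mem_nhds hy)
  have hW' : ∀ y ∈ U, ContDiffAt ℝ ∞ W y := fun y hy => hW.contDiffAt (h.isOpen.mem_nhds hy)
  have h0' : ∀ y ∈ U \ K, ∀ᶠ z in nhds y, W z = 0 := by
    intro y hy
    filter_upwards [(h.isOpen.sdiff hK.isClosed).mem_nhds hy] with z hz using h0 z hz
  have hflux : ∀ b, ContDiffOn ℝ ∞ (flatFlux G Γ V W b) U := fun b y hy =>
    (h.contDiffAt_flatFlux hy (hV' y hy) (hW' y hy) b).contDiffWithinAt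
  have hflux0 : ∀ b, ∀ y ∈ U \ K, flatFlux G Γ V W b y = 0 := by
    intro b y hy
    simp [flatFlux, h0 y hy]
  have h1 : ∀ b, IntegrableOn (fun y => fderiv ℝ (flatFlux G Γ V W b) y (stdBasis b)) U := by
    intro b
    refine integrableOn_of_continuousOn_of_eq_zero h.isOpen hK hKU
      (((hflux b).continuousOn_fderiv_of_isOpen h.isOpen (by simp)).clm_apply
        continuousOn_const) fun y hy => ?_
    have h2 : flatFlux G Γ V W b =ᶠ[nhds y] fun _ => 0 := by
      filter_upwards [(h.isOpen.sdiff hK.isClosed).mem_nhds hy] with z hz using hflux0 b z hz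
    rw [h2.fderiv_eq]
    simp
  have h2 : IntegrableOn (flatFirstVar G Γ V W) U :=
    integrableOn_of_continuousOn_of_eq_zero h.isOpen hK hKU
      (fun y hy => (h.contDiffAt_flatFirstVar hy (hV' y hy)
        (hW' y hy)).continuousAt.continuousWithinAt)
      fun y hy => flatFirstVar_eq_zero (h0' y hy)
  have h3 : ∫ y in U, flatEulerLagrange G Γ V y (W y) =
      ∫ y in U, (flatFirstVar G Γ V W y -
        ∑ b, fderiv ℝ (flatFlux G Γ V W b) y (stdBasis b)) := by
    refine setIntegral_congr_fun h.isOpen.measurableSet fun y hy => ?_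
    rw [h.sum_fderiv_flatFlux hy (hV' y hy) ((hW' y hy).differentiableAt (by simp))]
    ring
  -- The flux vanishes off `K` together with `W`, so each of its derivatives integrates to zero.
  rw [h3, integral_sub h2 (integrable_finsetSum _ fun b _ => h1 b),
    integral_finsetSum _ fun b _ => h1 b, Finset.sum_eq_zero fun b _ =>
      setIntegral_fderiv_eq_zero h.isOpen hK hKU (hflux b) (hflux0 b) _, sub_zero]

end IsLeviCivitaOn

end FirstVariation

/-! ### Transformation of the first variation under a linear change of coordinates. -/

section CoordinateChange

variable {n : ℕ}

/-- The matrix of a linear map in the standard basis. -/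
def stdMatrix (J : Model n →L[ℝ] Model n) : Matrix (Fin n) (Fin n) ℝ :=
  LinearMap.toMatrix (EuclideanSpace.basisFun (Fin n) ℝ).toBasis
    (EuclideanSpace.basisFun (Fin n) ℝ).toBasis (J : Model n →ₗ[ℝ] Model n)

lemma stdMatrix_apply (J : Model n →L[ℝ] Model n) (i j : Fin n) :
    stdMatrix J i j = J (stdBasis j) i := by
  simp [stdMatrix, LinearMap.toMatrix_apply]

lemma det_stdMatrix (J : Model n →L[ℝ] Model n) : (stdMatrix J).det = J.det :=
  LinearMap.det_toMatrix _ _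

lemma gram_comp (B : Model n →L[ℝ] Model n →L[ℝ] ℝ) (J : Model n →L[ℝ] Model n) :
    gram (B.bilinearComp J J) = (stdMatrix J).transpose * gram B * stdMatrix J := by
  ext i j
  rw [gram_apply, ContinuousLinearMap.bilinearComp_apply, bilin_eq_sum, Matrix.mul_apply,
    Finset.sum_comm]
  simp only [Matrix.mul_apply, Matrix.transpose_apply, stdMatrix_apply, Finset.sum_mul]

lemma sqrt_det_congr (P A : Matrix (Fin n) (Fin n) ℝ) :
    Real.sqrt (P.transpose * A * P).det = |P.det| * Real.sqrt A.det := by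
  rw [Matrix.det_mul, Matrix.det_mul, Matrix.det_transpose,
    show P.det * A.det * P.det = P.det ^ 2 * A.det by ring, Real.sqrt_mul (sq_nonneg _),
    Real.sqrt_sq_eq_abs]

lemma trace_inv_mul_congr {P : Matrix (Fin n) (Fin n) ℝ} (A B : Matrix (Fin n) (Fin n) ℝ)
    (hP : IsUnit P.det) :
    ((P.transpose * A * P)⁻¹ * (P.transpose * B * P)).trace = (A⁻¹ * B).trace := by
  have hP' : IsUnit P.transpose.det := by rwa [Matrix.det_transpose]
  rw [Matrix.mul_inv_rev, Matrix.mul_inv_rev, Matrix.trace_mul_comm]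
  calc (P.transpose * B * P * (P⁻¹ * (A⁻¹ * P.transpose⁻¹))).trace
      = (P.transpose * (B * (P * P⁻¹) * A⁻¹) * P.transpose⁻¹).trace := by
        simp only [Matrix.mul_assoc]
    _ = (A⁻¹ * B).trace := by
        rw [Matrix.mul_nonsing_inv P hP, Matrix.mul_one, Matrix.trace_mul_comm, ← Matrix.mul_assoc,
          Matrix.nonsing_inv_mul _ hP', Matrix.one_mul, Matrix.trace_mul_comm]

/-- Both Gram matrices are conjugated as `Pᵀ · P`: the trace is unchanged and the root of the
determinant gains the factor `|det J|`. -/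
lemma flatFirstVar_congr {G G' : Model n → Model n →L[ℝ] Model n →L[ℝ] ℝ}
    {Γ Γ' : Model n → Model n →L[ℝ] Model n →L[ℝ] Model n} {V V' W W' : Model n → Model n}
    {y y' : Model n} {J : Model n →L[ℝ] Model n} (hJ : IsUnit J.det)
    (hG : ∀ a b, G y a b = G' y' (J a) (J b))
    (hV : ∀ a, flatNabla Γ' V' y' (J a) = J (flatNabla Γ V y a))
    (hW : ∀ a, flatNabla Γ' W' y' (J a) = J (flatNabla Γ W y a)) :
    flatFirstVar G Γ V W y = |J.det| * flatFirstVar G' Γ' V' W' y' := by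
  have hH : flatInduced G Γ V y = (flatInduced G' Γ' V' y').bilinearComp J J := by
    ext a b
    rw [ContinuousLinearMap.bilinearComp_apply, flatInduced_apply, flatInduced_apply]
    simp only [hG, hV]
  have hB : (G y).bilinearComp (flatNabla Γ V y) (flatNabla Γ W y) =
      ((G' y').bilinearComp (flatNabla Γ' V' y') (flatNabla Γ' W' y')).bilinearComp J J := by
    ext a b
    simp only [ContinuousLinearMap.bilinearComp_apply, hG, hV, hW]
  have hdet : IsUnit (stdMatrix J).det := by rwa [det_stdMatrix]
  rw [flatFirstVar, flatFirstVar, flatDensity, flatDensity, hH, hB, gram_comp, gram_comp,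
    trace_inv_mul_congr _ _ hdet, sqrt_det_congr, det_stdMatrix, mul_assoc]

end CoordinateChange

/-! ### Compact sets and their images under charts. -/

section ChartImages

variable {n : ℕ} {M : Type*} [TopologicalSpace M] [ChartedSpace (Model n) M] {x : M} {y : Model n}

lemma isCompact_image_extChartAt {C : Set M} (hC : IsCompact C)
    (hCx : C ⊆ (extChartAt 𝓘(ℝ, Model n) x).source) :
    IsCompact (extChartAt 𝓘(ℝ, Model n) x '' C) :=
  hC.image_of_continuousOn ((continuousOn_extChartAt x).mono hCx)

lemma image_extChartAt_subset {C : Set M} (hCx : C ⊆ (extChartAt 𝓘(ℝ, Model n) x).source) :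
    extChartAt 𝓘(ℝ, Model n) x '' C ⊆ (extChartAt 𝓘(ℝ, Model n) x).target :=
  Set.image_subset_iff.2 fun _ hq => (extChartAt 𝓘(ℝ, Model n) x).map_source (hCx hq)

lemma symm_notMem_of_notMem_image {C : Set M} (hy : y ∈ (extChartAt 𝓘(ℝ, Model n) x).target \
    (extChartAt 𝓘(ℝ, Model n) x '' C)) : (extChartAt 𝓘(ℝ, Model n) x).symm y ∉ C :=
  fun h => hy.2 ⟨_, h, (extChartAt 𝓘(ℝ, Model n) x).right_inv hy.1⟩

lemma isCompact_image_extChartAt_symm {K : Set (Model n)} (hK : IsCompact K)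
    (hKT : K ⊆ (extChartAt 𝓘(ℝ, Model n) x).target) :
    IsCompact ((extChartAt 𝓘(ℝ, Model n) x).symm '' K) :=
  hK.image_of_continuousOn ((continuousOn_extChartAt_symm x).mono hKT)

lemma image_extChartAt_symm_subset {K : Set (Model n)}
    (hKT : K ⊆ (extChartAt 𝓘(ℝ, Model n) x).target) :
    (extChartAt 𝓘(ℝ, Model n) x).symm '' K ⊆ (extChartAt 𝓘(ℝ, Model n) x).source :=
  Set.image_subset_iff.2 fun _ hy => (extChartAt 𝓘(ℝ, Model n) x).map_target (hKT hy)

end ChartImages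

/-! ### Densities and the independence of their integrals of the charts. -/

section Density

open MeasureTheory

variable {n : ℕ} {M : Type*} [TopologicalSpace M] [ChartedSpace (Model n) M]
  [IsManifold 𝓘(ℝ, Model n) ∞ M] {x x' q : M} {y : Model n} {v w : VField n M}

/-- Families of functions on the charts that transform like densities. -/
def IsChartDensity (Φ : M → Model n → ℝ) : Prop :=
  ∀ x x' q : M, q ∈ (extChartAt 𝓘(ℝ, Model n) x).source →
    q ∈ (extChartAt 𝓘(ℝ, Model n) x').source →
    Φ x (extChartAt 𝓘(ℝ, Model n) x q) =
      |(tangentCoordChange 𝓘(ℝ, Model n) x x' q).det| * Φ x' (extChartAt 𝓘(ℝ, Model n) x' q)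

lemma toTangent_tangentCoordChange (hq : q ∈ (extChartAt 𝓘(ℝ, Model n) x).source)
    (hq' : q ∈ (extChartAt 𝓘(ℝ, Model n) x').source) (a : Model n) :
    toTangent x' q (tangentCoordChange 𝓘(ℝ, Model n) x x' q a) = toTangent x q a :=
  tangentCoordChange_comp ⟨⟨hq, hq'⟩, mem_extChartAt_source q⟩

lemma isUnit_det_tangentCoordChange (hq : q ∈ (extChartAt 𝓘(ℝ, Model n) x).source)
    (hq' : q ∈ (extChartAt 𝓘(ℝ, Model n) x').source) :
    IsUnit (tangentCoordChange 𝓘(ℝ, Model n) x x' q).det := by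
  have h : (tangentCoordChange 𝓘(ℝ, Model n) x' x q : Model n →ₗ[ℝ] Model n) *
      (tangentCoordChange 𝓘(ℝ, Model n) x x' q : Model n →ₗ[ℝ] Model n) = 1 := by
    ext1 a
    exact (tangentCoordChange_comp ⟨⟨hq, hq'⟩, hq⟩).trans (tangentCoordChange_self hq)
  have h2 := congrArg LinearMap.det h
  rw [map_mul, map_one] at h2
  exact IsUnit.of_mul_eq_one_right _ h2

lemma chartMetric_tangentCoordChange (g : Metric n M)
    (hq : q ∈ (extChartAt 𝓘(ℝ, Model n) x).source)
    (hq' : q ∈ (extChartAt 𝓘(ℝ, Model n) x').source) (a b : Model n) :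
    chartMetric g x (extChartAt 𝓘(ℝ, Model n) x q) a b =
      chartMetric g x' (extChartAt 𝓘(ℝ, Model n) x' q)
        (tangentCoordChange 𝓘(ℝ, Model n) x x' q a)
        (tangentCoordChange 𝓘(ℝ, Model n) x x' q b) := by
  rw [chartMetric_apply, chartMetric_apply, (extChartAt 𝓘(ℝ, Model n) x).left_inv hq,
    (extChartAt 𝓘(ℝ, Model n) x').left_inv hq', toTangent_tangentCoordChange hq hq',
    toTangent_tangentCoordChange hq hq']

lemma nabla_toTangent_extChartAt (g : Metric n M) (hv : IsSmooth v)
    (hq : q ∈ (extChartAt 𝓘(ℝ, Model n) x).source) (a : Model n) :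
    nabla g v q (toTangent x q a) = toTangent x q (flatNabla (chartChristoffel g x) (chartRep x v)
      (extChartAt 𝓘(ℝ, Model n) x q) a) := by
  have h1 := nabla_toTangent g isOpen_univ (hv.isSmoothOn _)
    ((extChartAt 𝓘(ℝ, Model n) x).map_source hq) (Set.mem_univ _) a
  rw [(extChartAt 𝓘(ℝ, Model n) x).left_inv hq] at h1
  exact h1

lemma flatNabla_tangentCoordChange (g : Metric n M) (hv : IsSmooth v)
    (hq : q ∈ (extChartAt 𝓘(ℝ, Model n) x).source)
    (hq' : q ∈ (extChartAt 𝓘(ℝ, Model n) x').source) (a : Model n) :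
    flatNabla (chartChristoffel g x') (chartRep x' v) (extChartAt 𝓘(ℝ, Model n) x' q)
        (tangentCoordChange 𝓘(ℝ, Model n) x x' q a) =
      tangentCoordChange 𝓘(ℝ, Model n) x x' q
        (flatNabla (chartChristoffel g x) (chartRep x v) (extChartAt 𝓘(ℝ, Model n) x q) a) := by
  have h1 := nabla_toTangent_extChartAt g hv hq' (tangentCoordChange 𝓘(ℝ, Model n) x x' q a)
  rw [toTangent_tangentCoordChange hq hq'] at h1
  have h2 := h1.symm.trans (nabla_toTangent_extChartAt g hv hq a)
  have h3 := congrArg (toChart x' q) h2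
  rw [← toTangent_tangentCoordChange hq hq'] at h3
  exact ((toChart_toTangent hq' _).symm.trans h3).trans (toChart_toTangent hq' _)

lemma isChartDensity_flatFirstVar (g : Metric n M) (hv : IsSmooth v) (hw : IsSmooth w) :
    IsChartDensity fun x => flatFirstVar (chartMetric g x) (chartChristoffel g x) (chartRep x v)
      (chartRep x w) := by
  intro x x' q hq hq'
  refine flatFirstVar_congr (isUnit_det_tangentCoordChange hq hq')
    (chartMetric_tangentCoordChange g hq hq') (flatNabla_tangentCoordChange g hv hq hq')
    (flatNabla_tangentCoordChange g hw hq hq')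

lemma contDiffOn_comp_symm {f : M → ℝ} (hf : ContMDiff 𝓘(ℝ, Model n) 𝓘(ℝ, ℝ) ∞ f) (x : M) :
    ContDiffOn ℝ ∞ (fun y => f ((extChartAt 𝓘(ℝ, Model n) x).symm y))
      (extChartAt 𝓘(ℝ, Model n) x).target := fun _ hy =>
  ((hf.contMDiffAt.comp _ (contMDiffAt_extChartAt_symm hy)).contDiffAt).contDiffWithinAt

/-- The factor `f` vanishes off the first chart and the density vanishes off the second one, so both
integrals live on the overlap, where the change of variables formula applies. -/
lemma integral_chart_overlap {Φ : M → Model n → ℝ} (hΦ : IsChartDensity Φ) (x x' : M) {f : M → ℝ}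
    (hf : ∀ q ∉ (extChartAt 𝓘(ℝ, Model n) x).source, f q = 0)
    (h0 : ∀ q ∈ (extChartAt 𝓘(ℝ, Model n) x).source, q ∉ (extChartAt 𝓘(ℝ, Model n) x').source →
      Φ x (extChartAt 𝓘(ℝ, Model n) x q) = 0) :
    ∫ y in (extChartAt 𝓘(ℝ, Model n) x).target,
        f ((extChartAt 𝓘(ℝ, Model n) x).symm y) * Φ x y =
      ∫ y in (extChartAt 𝓘(ℝ, Model n) x').target,
        f ((extChartAt 𝓘(ℝ, Model n) x').symm y) * Φ x' y := by
  set e := extChartAt 𝓘(ℝ, Model n) x with he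
  set e' := extChartAt 𝓘(ℝ, Model n) x' with he'
  have hopen : ∀ z z' : M, IsOpen ((extChartAt 𝓘(ℝ, Model n) z).target ∩
      (extChartAt 𝓘(ℝ, Model n) z).symm ⁻¹' (extChartAt 𝓘(ℝ, Model n) z').source) := fun z z' =>
    (continuousOn_extChartAt_symm z).isOpen_inter_preimage (isOpen_extChartAt_target z)
      (isOpen_extChartAt_source z')
  set S := e.target ∩ e.symm ⁻¹' e'.source with hS
  set S' := e'.target ∩ e'.symm ⁻¹' e.source with hS'
  have himage : (e' ∘ e.symm) '' S = S' := by
    ext z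
    constructor
    · rintro ⟨y, ⟨hy, hy'⟩, rfl⟩
      refine ⟨e'.map_source hy', ?_⟩
      change e'.symm (e' (e.symm y)) ∈ e.source
      rw [e'.left_inv hy']
      exact e.map_target hy
    · rintro ⟨hz, hz'⟩
      refine ⟨e (e'.symm z), ⟨e.map_source hz', ?_⟩, ?_⟩
      · change e.symm (e (e'.symm z)) ∈ e'.source
        rw [e.left_inv hz']
        exact e'.map_target hz
      · change e' (e.symm (e (e'.symm z))) = z
        rw [e.left_inv hz', e'.right_inv hz]
  have hinj : Set.InjOn (e' ∘ e.symm) S := fun y hy z hz hyz =>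
    e.symm.injOn hy.1 hz.1 (e'.injOn hy.2 hz.2 hyz)
  have hder : ∀ y ∈ S, HasFDerivWithinAt (e' ∘ e.symm)
      (tangentCoordChange 𝓘(ℝ, Model n) x x' (e.symm y)) S y := by
    intro y hy
    have := hasFDerivAt_chart_change (e.map_target hy.1) hy.2
    rw [← he, e.right_inv hy.1] at this
    exact this.hasFDerivWithinAt
  have h1 := integral_image_eq_integral_abs_det_fderiv_smul volume (hopen x x').measurableSet hder
    hinj fun z => f (e'.symm z) * Φ x' z
  rw [himage] at h1
  have h2 : ∫ y in e'.target, f (e'.symm y) * Φ x' y = ∫ y in S', f (e'.symm y) * Φ x' y := by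
    refine setIntegral_eq_of_subset_of_forall_sdiff_eq_zero
      (isOpen_extChartAt_target x').measurableSet Set.inter_subset_left fun y hy => ?_
    rw [hf _ fun h => hy.2 ⟨hy.1, h⟩, zero_mul]
  have h3 : ∫ y in e.target, f (e.symm y) * Φ x y = ∫ y in S, f (e.symm y) * Φ x y := by
    refine setIntegral_eq_of_subset_of_forall_sdiff_eq_zero
      (isOpen_extChartAt_target x).measurableSet Set.inter_subset_left fun y hy => ?_
    have := h0 (e.symm y) (e.map_target hy.1) fun h => hy.2 ⟨hy.1, h⟩
    rw [e.right_inv hy.1] at this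
    rw [this, mul_zero]
  rw [h2, h3, h1]
  refine setIntegral_congr_fun (hopen x x').measurableSet fun y hy => ?_
  have h4 := hΦ x x' (e.symm y) (e.map_target hy.1) hy.2
  rw [← he, ← he', e.right_inv hy.1] at h4
  change f (e.symm y) * Φ x y = _ • (f (e'.symm (e' (e.symm y))) * Φ x' (e' (e.symm y)))
  rw [e'.left_inv hy.2, h4, smul_eq_mul]
  ring

variable [T2Space M] [CompactSpace M]

lemma tsupport_chartPartition (x : M) :
    tsupport (chartPartition n M x) ⊆ (extChartAt 𝓘(ℝ, Model n) x).source := by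
  rw [extChartAt_source]
  exact (SmoothPartitionOfUnity.exists_isSubordinate_chartAt_source
    𝓘(ℝ, Model n) M).choose_spec x

lemma chartPartition_eq_zero (hq : q ∉ (extChartAt 𝓘(ℝ, Model n) x).source) :
    chartPartition n M x q = 0 :=
  image_eq_zero_of_notMem_tsupport fun h => hq (tsupport_chartPartition x h)

variable (n M) in
lemma exists_finset_chartPartition :
    ∃ s : Finset M, (∀ x, x ∉ s → ∀ q, chartPartition n M x q = 0) ∧
      ∀ q, ∑ x ∈ s, chartPartition n M x q = 1 := by
  have hf := (chartPartition n M).locallyFinite.finite_nonempty_of_compact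
  have h0 : ∀ x, x ∉ hf.toFinset → ∀ q, chartPartition n M x q = 0 := by
    intro x hx q
    by_contra hne
    exact hx (hf.mem_toFinset.2 ⟨q, hne⟩)
  refine ⟨hf.toFinset, h0, fun q => ?_⟩
  rw [← (chartPartition n M).sum_eq_one (Set.mem_univ q)]
  refine (finsum_eq_sum_of_support_subset _ fun x hx => ?_).symm
  by_contra hxs
  exact hx (h0 x hxs q)

lemma finsum_eq_sum_chartPartition {s : Finset M}
    (hs : ∀ x, x ∉ s → ∀ q, chartPartition n M x q = 0) (Φ : M → Model n → ℝ) :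
    ∑ᶠ x : M, ∫ y in (extChartAt 𝓘(ℝ, Model n) x).target,
        chartPartition n M x ((extChartAt 𝓘(ℝ, Model n) x).symm y) * Φ x y =
      ∑ x ∈ s, ∫ y in (extChartAt 𝓘(ℝ, Model n) x).target,
        chartPartition n M x ((extChartAt 𝓘(ℝ, Model n) x).symm y) * Φ x y := by
  refine finsum_eq_sum_of_support_subset _ fun x hx => ?_
  by_contra hxs
  refine hx ?_
  simp [hs x hxs]

/-- The integral of a density supported in a chart is computed in this chart. -/
lemma finsum_integral_chartDensity {Φ : M → Model n → ℝ} (hΦ : IsChartDensity Φ)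
    (hc : ContinuousOn (Φ x') (extChartAt 𝓘(ℝ, Model n) x').target) {C : Set M} (hC : IsCompact C)
    (hCx : C ⊆ (extChartAt 𝓘(ℝ, Model n) x').source)
    (h0 : ∀ x, ∀ q ∈ (extChartAt 𝓘(ℝ, Model n) x).source, q ∉ C →
      Φ x (extChartAt 𝓘(ℝ, Model n) x q) = 0) :
    ∑ᶠ x : M, ∫ y in (extChartAt 𝓘(ℝ, Model n) x).target,
        chartPartition n M x ((extChartAt 𝓘(ℝ, Model n) x).symm y) * Φ x y =
      ∫ y in (extChartAt 𝓘(ℝ, Model n) x').target, Φ x' y := by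
  obtain ⟨s, hs0, hs1⟩ := exists_finset_chartPartition n M
  -- Each summand is moved to the chart at `x'`; there the partition functions add up to `1`.
  rw [finsum_eq_sum_chartPartition hs0, Finset.sum_congr rfl fun x _ =>
    integral_chart_overlap hΦ x x' (f := chartPartition n M x)
      (fun q hq => chartPartition_eq_zero hq) fun q hq hq' => h0 x q hq fun h => hq' (hCx h),
    ← integral_finsetSum]
  · refine setIntegral_congr_fun (isOpen_extChartAt_target x').measurableSet fun y _ => ?_
    change ∑ x ∈ s, _ * Φ x' y = Φ x' y
    rw [← Finset.sum_mul, hs1, one_mul]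
  · intro x _
    refine integrableOn_of_continuousOn_of_eq_zero (isOpen_extChartAt_target x')
      (isCompact_image_extChartAt hC hCx) (image_extChartAt_subset hCx)
      ((contDiffOn_comp_symm (chartPartition n M x).contMDiff x').continuousOn.mul hc)
      fun y hy => ?_
    have h := h0 x' _ ((extChartAt 𝓘(ℝ, Model n) x').map_target hy.1)
      (symm_notMem_of_notMem_image hy)
    rw [(extChartAt 𝓘(ℝ, Model n) x').right_inv hy.1] at h
    rw [h, mul_zero]

end Density

/-! ### Initial velocities of paths of vector fields. -/

section Velocity

variable {n : ℕ} {M : Type*} [TopologicalSpace M] [ChartedSpace (Model n) M]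

/-- The curve in `T_p M` defined by a path of vector fields. -/
def curveAt (w : ℝ → VField n M) (p : M) : ℝ → Model n := fun t => w t p

/-- The initial velocity of a path of vector fields. -/
def velocity (w : ℝ → VField n M) : VField n M := fun p => deriv (curveAt w p) 0

lemma velocity_one_add_smul (v : VField n M) : velocity (fun (t : ℝ) p => (1 + t) • v p) = v := by
  ext1 p
  let a : Model n := v p
  have h1 : HasDerivAt (fun t : ℝ => (1 + t) • a) a 0 := by
    simpa using ((hasDerivAt_id (0 : ℝ)).const_add 1).smul_const a
  exact h1.deriv

end Velocity

/-! ### Smooth fields and smooth paths tested in charts. -/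

section SmoothPaths

variable {n : ℕ} {M : Type*} [TopologicalSpace M] [ChartedSpace (Model n) M]
  [IsManifold 𝓘(ℝ, Model n) ∞ M] {x p q : M} {y : Model n} {v : VField n M} {w : ℝ → VField n M}

lemma chartRep_smul (f : M → ℝ) (v : VField n M) (x : M) (y : Model n) :
    chartRep x (fun p => f p • v p) y =
      f ((extChartAt 𝓘(ℝ, Model n) x).symm y) • chartRep x v y :=
  map_smul (toChart x _) _ _

lemma chartRep_sum {ι : Type*} (s : Finset ι) (v : ι → VField n M) (x : M) (y : Model n) :
    chartRep x (fun p => ∑ i ∈ s, v i p) y = ∑ i ∈ s, chartRep x (v i) y :=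
  map_sum (toChart x _) _ _

lemma IsSmooth.of_chartRep
    (h : ∀ x, ContDiffOn ℝ ∞ (chartRep x v) (extChartAt 𝓘(ℝ, Model n) x).target) :
    IsSmooth v := fun q =>
  contMDiffAt_of_chartRep (mem_extChartAt_source q) ((h q).contDiffAt
    ((isOpen_extChartAt_target q).mem_nhds (mem_extChartAt_target q)))

lemma IsSmooth.smul {f : M → ℝ} (hf : ContMDiff 𝓘(ℝ, Model n) 𝓘(ℝ, ℝ) ∞ f) (hv : IsSmooth v) :
    IsSmooth fun p => f p • v p := by
  refine IsSmooth.of_chartRep fun x => ?_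
  rw [show chartRep x (fun p => f p • v p) = _ from funext (chartRep_smul f v x)]
  exact (contDiffOn_comp_symm hf x).smul (hv.contDiffOn_chartRep x)

lemma IsSmoothPath.contDiffOn_chartRep (hw : IsSmoothPath w) (x : M) :
    ContDiffOn ℝ ∞ (fun s : ℝ × Model n => chartRep x (w s.1) s.2)
      (Set.univ ×ˢ (extChartAt 𝓘(ℝ, Model n) x).target) := fun s hs =>
  (hw.contDiffAt_chartRep s.1 hs.2).contDiffWithinAt

lemma IsSmoothPath.of_chartRep (h : ∀ x, ContDiffOn ℝ ∞
    (fun s : ℝ × Model n => chartRep x (w s.1) s.2)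
      (Set.univ ×ˢ (extChartAt 𝓘(ℝ, Model n) x).target)) : IsSmoothPath w := by
  rintro ⟨t, q⟩
  have hq := mem_extChartAt_source (I := 𝓘(ℝ, Model n)) q
  refine (contMDiffAt_tangent_iff (x := q) hq).2 ⟨contMDiffAt_snd, ?_⟩
  have h1 : ContDiffAt ℝ ∞ (fun s : ℝ × Model n => chartRep q (w s.1) s.2)
      (t, extChartAt 𝓘(ℝ, Model n) q q) :=
    (h q).contDiffAt ((isOpen_univ.prod (isOpen_extChartAt_target q)).mem_nhds
      ⟨Set.mem_univ _, mem_extChartAt_target q⟩)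
  have h2 : ContMDiffAt (𝓘(ℝ, ℝ).prod 𝓘(ℝ, Model n)) 𝓘(ℝ, ℝ × Model n) ∞
      (fun s : ℝ × M => (s.1, extChartAt 𝓘(ℝ, Model n) q s.2)) (t, q) :=
    contMDiffAt_fst.prodMk_space (contMDiffAt_extChartAt.comp (t, q) contMDiffAt_snd)
  refine (h1.contMDiffAt.comp (t, q) h2).congr_of_eventuallyEq ?_
  filter_upwards [continuousAt_snd.preimage_mem_nhds
    ((isOpen_extChartAt_source (I := 𝓘(ℝ, Model n)) q).mem_nhds hq)] with s hs
  exact (chartRep_extChartAt (w s.1) hs).symm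

lemma IsSmoothPath.isSmooth (hw : IsSmoothPath w) (t : ℝ) : IsSmooth (w t) :=
  IsSmooth.of_chartRep fun x =>
    (hw.contDiffOn_chartRep x).comp (f := fun y => (t, y)) (by fun_prop) fun _ hy =>
      ⟨Set.mem_univ _, hy⟩

lemma hasDerivAt_path (hw : IsSmoothPath w) (hy : y ∈ (extChartAt 𝓘(ℝ, Model n) x).target) :
    HasDerivAt (curveAt w ((extChartAt 𝓘(ℝ, Model n) x).symm y))
      (toTangent x ((extChartAt 𝓘(ℝ, Model n) x).symm y)
        (fderiv ℝ (fun s : ℝ × Model n => chartRep x (w s.1) s.2) (0, y) (1, 0))) 0 := by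
  have h1 := hasDerivAt_slice (hw.contDiffAt_chartRep 0 hy)
  have h2 := (toTangent x ((extChartAt 𝓘(ℝ, Model n) x).symm y)).hasFDerivAt.comp_hasDerivAt 0 h1
  refine h2.congr_of_eventuallyEq (Filter.Eventually.of_forall fun t => ?_)
  exact (toTangent_chartRep (w t) hy).symm

lemma chartRep_velocity (hw : IsSmoothPath w) (hy : y ∈ (extChartAt 𝓘(ℝ, Model n) x).target) :
    chartRep x (velocity w) y =
      fderiv ℝ (fun s : ℝ × Model n => chartRep x (w s.1) s.2) (0, y) (1, 0) := by
  have h1 : velocity w ((extChartAt 𝓘(ℝ, Model n) x).symm y) = _ := (hasDerivAt_path hw hy).deriv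
  exact (congrArg (toChart x _) h1).trans
    (toChart_toTangent ((extChartAt 𝓘(ℝ, Model n) x).map_target hy) _)

lemma hasDerivAt_velocity (hw : IsSmoothPath w) (p : M) :
    HasDerivAt (curveAt w p) (velocity w p) 0 := by
  have h1 := hasDerivAt_path hw (mem_extChartAt_target (I := 𝓘(ℝ, Model n)) p)
  rw [(extChartAt 𝓘(ℝ, Model n) p).left_inv (mem_extChartAt_source p)] at h1
  exact h1.differentiableAt.hasDerivAt

lemma isSmooth_velocity (hw : IsSmoothPath w) : IsSmooth (velocity w) := by
  refine IsSmooth.of_chartRep fun x y hy => ?_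
  refine ((contDiffAt_velocity (hw.contDiffAt_chartRep 0 hy)).congr_of_eventuallyEq
    ?_).contDiffWithinAt
  filter_upwards [(isOpen_extChartAt_target x).mem_nhds hy] with z hz using chartRep_velocity hw hz

lemma inner_velocity (g : Metric n M) (hw : IsSmoothPath w) (hu : ∀ t, IsUnitField g (w t))
    (p : M) : g.inner p (velocity w p) (w 0 p) = 0 := by
  let B : Model n →L[ℝ] Model n →L[ℝ] ℝ := g.inner p
  have h1 := hasDerivAt_velocity hw p
  have h2 := (B.hasFDerivAt.comp_hasDerivAt 0 h1).clm_apply h1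
  have h3 : HasDerivAt (fun t => B (w t p) (w t p)) 0 0 := by
    rw [show (fun t => B (w t p) (w t p)) = fun _ => 1 from funext fun t => hu t p]
    exact hasDerivAt_const 0 1
  have h4 := h2.unique h3
  have h5 : B (w 0 p) (velocity w p) = B (velocity w p) (w 0 p) := g.symm p _ _
  change B (velocity w p) (w 0 p) = 0
  change B (velocity w p) (w 0 p) + B (w 0 p) (velocity w p) = 0 at h4
  linarith

end SmoothPaths

/-! ### The first variation of the total volume; sufficiency of the Euler-Lagrange equation. -/

section GlobalVariation

open MeasureTheory

variable {n : ℕ} {M : Type*} [TopologicalSpace M] [ChartedSpace (Model n) M]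
  [IsManifold 𝓘(ℝ, Model n) ∞ M] {x p q : M} {y : Model n} {v : VField n M}

lemma flatFirstVar_chartRep_eq_zero [T2Space M] (g : Metric n M) {w : VField n M} {C : Set M}
    (hC : IsCompact C) (h0 : ∀ q ∉ C, w q = 0) (hq : q ∈ (extChartAt 𝓘(ℝ, Model n) x).source)
    (hqC : q ∉ C) :
    flatFirstVar (chartMetric g x) (chartChristoffel g x) (chartRep x v) (chartRep x w)
      (extChartAt 𝓘(ℝ, Model n) x q) = 0 := by
  refine flatFirstVar_eq_zero ?_
  have h1 := continuousAt_extChartAt_symm' hq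
  have h2 : Cᶜ ∈ nhds ((extChartAt 𝓘(ℝ, Model n) x).symm (extChartAt 𝓘(ℝ, Model n) x q)) := by
    rw [(extChartAt 𝓘(ℝ, Model n) x).left_inv hq]
    exact hC.isClosed.isOpen_compl.mem_nhds hqC
  filter_upwards [h1.preimage_mem_nhds h2] with z hz
  exact (congrArg (toChart x _) (h0 _ hz)).trans (map_zero _)

lemma flatFirstVar_congr_right {G : Model n → Model n →L[ℝ] Model n →L[ℝ] ℝ}
    {Γ : Model n → Model n →L[ℝ] Model n →L[ℝ] Model n} {V W W' : Model n → Model n}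
    (h : W =ᶠ[nhds y] W') : flatFirstVar G Γ V W y = flatFirstVar G Γ V W' y := by
  have h1 : flatNabla Γ W y = flatNabla Γ W' y := by
    exact flatNabla_congr h
  rw [flatFirstVar, flatFirstVar, h1]

/-- The Euler-Lagrange equation of the volume among unit fields. -/
def IsCriticalField (g : Metric n M) (v : VField n M) : Prop :=
  ∀ x, ∀ y ∈ (extChartAt 𝓘(ℝ, Model n) x).target, ∀ u,
    chartMetric g x y u (chartRep x v y) = 0 →
      flatEulerLagrange (chartMetric g x) (chartChristoffel g x) (chartRep x v) y u = 0

variable [T2Space M] [CompactSpace M]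

lemma isCompact_tsupport_chartPartition (x : M) : IsCompact (tsupport (chartPartition n M x)) :=
  (isClosed_tsupport _).isCompact

lemma contDiffOn_chartPartition (x x' : M) :
    ContDiffOn ℝ ∞ (fun y => chartPartition n M x ((extChartAt 𝓘(ℝ, Model n) x').symm y))
      (extChartAt 𝓘(ℝ, Model n) x').target :=
  contDiffOn_comp_symm (chartPartition n M x).contMDiff x'

lemma chartPartition_eq_zero_of_notMem (hy : y ∈ (extChartAt 𝓘(ℝ, Model n) x).target \
    (extChartAt 𝓘(ℝ, Model n) x '' tsupport (chartPartition n M x))) :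
    chartPartition n M x ((extChartAt 𝓘(ℝ, Model n) x).symm y) = 0 :=
  image_eq_zero_of_notMem_tsupport (symm_notMem_of_notMem_image hy)

/-- The first variation of the volume of `v` in the direction `w`. -/
def volumeVariation (g : Metric n M) (v w : VField n M) : ℝ :=
  ∑ᶠ x : M, ∫ y in (extChartAt 𝓘(ℝ, Model n) x).target,
    chartPartition n M x ((extChartAt 𝓘(ℝ, Model n) x).symm y) *
      flatFirstVar (chartMetric g x) (chartChristoffel g x) (chartRep x v) (chartRep x w) y

lemma fieldVolume_eq (g : Metric n M) (hv : IsSmooth v) :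
    fieldVolume g v = ∑ᶠ x : M, ∫ y in (extChartAt 𝓘(ℝ, Model n) x).target,
      chartPartition n M x ((extChartAt 𝓘(ℝ, Model n) x).symm y) *
        flatDensity (chartMetric g x) (chartChristoffel g x) (chartRep x v) y := by
  refine finsum_congr fun x => setIntegral_congr_fun (isOpen_extChartAt_target x).measurableSet
    fun y hy => ?_
  change _ * Real.sqrt _ = _ * Real.sqrt _
  rw [coordMatrix_inducedMetric g hv hy]

/-- By compactness only finitely many partition functions are non-zero. Each summand is
differentiated under the integral sign, the partition function providing the compact support. -/
lemma hasDerivAt_fieldVolume (g : Metric n M) {w : ℝ → VField n M} (hw : IsSmoothPath w) :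
    HasDerivAt (fun t => fieldVolume g (w t)) (volumeVariation g (w 0) (velocity w)) 0 := by
  obtain ⟨s, hs, -⟩ := exists_finset_chartPartition n M
  have h1 : (fun t => fieldVolume g (w t)) = fun t => ∑ x ∈ s,
      ∫ y in (extChartAt 𝓘(ℝ, Model n) x).target,
        chartPartition n M x ((extChartAt 𝓘(ℝ, Model n) x).symm y) *
          flatDensity (chartMetric g x) (chartChristoffel g x) (chartRep x (w t)) y := by
    ext t
    rw [fieldVolume_eq g (hw.isSmooth t), finsum_eq_sum_chartPartition hs]
  rw [h1, volumeVariation, finsum_eq_sum_chartPartition hs]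
  refine HasDerivAt.fun_sum fun x _ => ?_
  have hLC := isLeviCivitaOn_chart g x
  have hT := isOpen_extChartAt_target (I := 𝓘(ℝ, Model n)) x
  have hF : ∀ t, ∀ y ∈ (extChartAt 𝓘(ℝ, Model n) x).target, ContDiffAt ℝ ∞
      (fun s : ℝ × Model n => chartPartition n M x ((extChartAt 𝓘(ℝ, Model n) x).symm s.2) *
        flatDensity (chartMetric g x) (chartChristoffel g x) (chartRep x (w s.1)) s.2) (t, y) :=
    fun t y hy => ContDiffAt.mul (((contDiffOn_chartPartition x x).contDiffAt
      (hT.mem_nhds hy)).comp (t, y) (f := Prod.snd) contDiffAt_snd)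
      (hLC.contDiffAt_flatDensity_path (hw.contDiffOn_chartRep x) hy t)
  have h2 := hasDerivAt_setIntegral hT
    (isCompact_image_extChartAt (isCompact_tsupport_chartPartition x) (tsupport_chartPartition x))
    (image_extChartAt_subset (tsupport_chartPartition x))
    (fun s hs => (hF s.1 s.2 hs.2).contDiffWithinAt) (fun t y hy => by
      rw [chartPartition_eq_zero_of_notMem hy, zero_mul]) 0
  refine h2.congr_deriv (setIntegral_congr_fun hT.measurableSet fun y hy => ?_)
  have h3 := hasDerivAt_slice (hF 0 y hy)
  have h4 := (hLC.hasDerivAt_flatDensity (hw.contDiffOn_chartRep x) hy 0).const_mul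
    (chartPartition n M x ((extChartAt 𝓘(ℝ, Model n) x).symm y))
  refine (h3.unique h4).trans (congrArg _ ?_)
  refine flatFirstVar_congr_right ?_
  filter_upwards [hT.mem_nhds hy] with z hz using (chartRep_velocity hw hz).symm

lemma integrableOn_chartPartition_mul (g : Metric n M) {w : VField n M} (hv : IsSmooth v)
    (hw : IsSmooth w) (x : M) :
    IntegrableOn (fun y => chartPartition n M x ((extChartAt 𝓘(ℝ, Model n) x).symm y) *
      flatFirstVar (chartMetric g x) (chartChristoffel g x) (chartRep x v) (chartRep x w) y)
      (extChartAt 𝓘(ℝ, Model n) x).target := by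
  have hT := isOpen_extChartAt_target (I := 𝓘(ℝ, Model n)) x
  refine integrableOn_of_continuousOn_of_eq_zero hT
    (isCompact_image_extChartAt (isCompact_tsupport_chartPartition x) (tsupport_chartPartition x))
    (image_extChartAt_subset (tsupport_chartPartition x))
    ((contDiffOn_chartPartition x x).continuousOn.mul fun y hy => ?_) fun y hy => by
      rw [chartPartition_eq_zero_of_notMem hy, zero_mul]
  exact ((isLeviCivitaOn_chart g x).contDiffAt_flatFirstVar hy
    ((hv.contDiffOn_chartRep x).contDiffAt (hT.mem_nhds hy))
    ((hw.contDiffOn_chartRep x).contDiffAt (hT.mem_nhds hy))).continuousAt.continuousWithinAt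

lemma volumeVariation_sum (g : Metric n M) {ι : Type*} (s : Finset ι) {w : ι → VField n M}
    (hv : IsSmooth v) (hw : ∀ i, IsSmooth (w i)) :
    volumeVariation g v (fun p => ∑ i ∈ s, w i p) = ∑ i ∈ s, volumeVariation g v (w i) := by
  obtain ⟨r, hr, -⟩ := exists_finset_chartPartition n M
  simp only [volumeVariation, finsum_eq_sum_chartPartition hr]
  rw [Finset.sum_comm]
  refine Finset.sum_congr rfl fun x _ => ?_
  have hT := isOpen_extChartAt_target (I := 𝓘(ℝ, Model n)) x
  rw [← integral_finsetSum _ fun i _ => integrableOn_chartPartition_mul g hv (hw i) x]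
  refine setIntegral_congr_fun hT.measurableSet fun y hy => ?_
  rw [← Finset.mul_sum, show chartRep x (fun p => ∑ i ∈ s, w i p) = _ from
    funext (chartRep_sum s w x), flatFirstVar_sum s fun i _ =>
      (((hw i).contDiffOn_chartRep x).contDiffAt (hT.mem_nhds hy)).differentiableAt (by simp)]

/-- For a direction supported in one chart the partition of unity disappears, as the first variation
is a density. Integration by parts then creates no derivatives of partition functions and no
boundary terms. -/
lemma volumeVariation_eq_integral (g : Metric n M) {w : VField n M} (hv : IsSmooth v)
    (hw : IsSmooth w) {C : Set M} (hC : IsCompact C)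
    (hCx : C ⊆ (extChartAt 𝓘(ℝ, Model n) x).source) (h0 : ∀ q ∉ C, w q = 0) :
    volumeVariation g v w = ∫ y in (extChartAt 𝓘(ℝ, Model n) x).target,
      flatEulerLagrange (chartMetric g x) (chartChristoffel g x) (chartRep x v) y
        (chartRep x w y) := by
  have hT := isOpen_extChartAt_target (I := 𝓘(ℝ, Model n)) x
  have hLC := isLeviCivitaOn_chart g x
  rw [volumeVariation, finsum_integral_chartDensity (isChartDensity_flatFirstVar g hv hw)
    (x' := x) (fun y hy => (hLC.contDiffAt_flatFirstVar hy
      ((hv.contDiffOn_chartRep x).contDiffAt (hT.mem_nhds hy))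
      ((hw.contDiffOn_chartRep x).contDiffAt (hT.mem_nhds hy))).continuousAt.continuousWithinAt)
    hC hCx fun z q hq hqC => flatFirstVar_chartRep_eq_zero g hC h0 hq hqC]
  refine hLC.integral_flatFirstVar (isCompact_image_extChartAt hC hCx) (image_extChartAt_subset hCx)
    (hv.contDiffOn_chartRep x) (hw.contDiffOn_chartRep x) fun y hy => ?_
  exact (congrArg (toChart x _) (h0 _ (symm_notMem_of_notMem_image hy))).trans (map_zero _)

/-- The partition of unity splits `w` into pieces supported in charts. Each piece is still
orthogonal to `v`, so its Euler-Lagrange integrand vanishes pointwise. -/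
lemma IsCriticalField.volumeVariation_eq_zero {g : Metric n M} (h : IsCriticalField g v)
    {w : VField n M} (hv : IsSmooth v) (hw : IsSmooth w)
    (hwv : ∀ p, g.inner p (w p) (v p) = 0) : volumeVariation g v w = 0 := by
  obtain ⟨s, -, hs⟩ := exists_finset_chartPartition n M
  have h1 : w = fun p => ∑ x ∈ s, chartPartition n M x p • w p := by
    ext1 p
    rw [← Finset.sum_smul, hs, one_smul]
  have hsm : ∀ x, IsSmooth fun p => chartPartition n M x p • w p := fun x =>
    hw.smul (chartPartition n M x).contMDiff
  rw [h1, volumeVariation_sum g s hv hsm]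
  refine Finset.sum_eq_zero fun x _ => ?_
  rw [volumeVariation_eq_integral g hv (hsm x) (isCompact_tsupport_chartPartition x)
    (tsupport_chartPartition x) fun q hq => by
      rw [image_eq_zero_of_notMem_tsupport hq, zero_smul]]
  refine setIntegral_eq_zero_of_forall_eq_zero fun y hy => h x y hy _ ?_
  rw [chartRep_smul, map_smul, smul_apply, smul_eq_mul]
  have h2 := chartMetric_chartRep g hy w v
  rw [hwv] at h2
  rw [h2, mul_zero]

lemma IsCriticalField.isMinimalUnit {g : Metric n M} (h : IsCriticalField g v) (hv : IsSmooth v)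
    (hu : IsUnitField g v) : IsMinimalUnit g v := by
  refine ⟨hv, hu, fun w hw hwu hw0 => ?_⟩
  have h1 := hasDerivAt_fieldVolume g hw
  have h2 := inner_velocity g hw hwu
  rw [hw0] at h1 h2
  rwa [h.volumeVariation_eq_zero hv (isSmooth_velocity hw) h2] at h1

end GlobalVariation

/-! ### Construction of unit paths, scaling paths and locally supported fields. -/

section Paths

variable {n : ℕ} {M : Type*} [TopologicalSpace M] [ChartedSpace (Model n) M]
  [IsManifold 𝓘(ℝ, Model n) ∞ M] {x p q : M} {y : Model n} {v w : VField n M}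

/-- The path of unit fields through `v` in the direction of a field orthogonal to `v`. -/
def unitPath (g : Metric n M) (v w : VField n M) (t : ℝ) : VField n M := fun p =>
  (Real.sqrt (1 + t ^ 2 * g.inner p (w p) (w p)))⁻¹ • (v p + t • w p)

lemma inner_self_nonneg (g : Metric n M) (p : M) (X : TangentSpace 𝓘(ℝ, Model n) p) :
    0 ≤ g.inner p X X := by
  by_cases h : X = 0
  · rw [h, map_zero]
  · exact (g.pos p X h).le

lemma one_add_sq_mul_inner_pos (g : Metric n M) (t : ℝ) (X : TangentSpace 𝓘(ℝ, Model n) p) :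
    0 < 1 + t ^ 2 * g.inner p X X := by
  have := mul_nonneg (sq_nonneg t) (inner_self_nonneg g p X)
  linarith

lemma unitPath_zero (g : Metric n M) (v w : VField n M) : unitPath g v w 0 = v := by
  ext1 p
  simp [unitPath]

lemma isUnitField_unitPath (g : Metric n M) (hu : IsUnitField g v)
    (hwv : ∀ p, g.inner p (w p) (v p) = 0) (t : ℝ) : IsUnitField g (unitPath g v w t) := by
  intro p
  let B : Model n →L[ℝ] Model n →L[ℝ] ℝ := g.inner p
  have key : ∀ (a b : Model n) (c : ℝ), B a a = 1 → B b a = 0 → B a b = 0 →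
      B (c • (a + t • b)) (c • (a + t • b)) = c ^ 2 * (1 + t ^ 2 * B b b) := by
    intro a b c h1 h2 h3
    simp only [map_smul, map_add, smul_apply, add_apply, smul_eq_mul, h1, h2, h3]
    ring
  have h0 := one_add_sq_mul_inner_pos g t (w p)
  refine (key (v p) (w p) _ (hu p) (hwv p) ((g.symm p _ _).trans (hwv p))).trans ?_
  change (Real.sqrt (1 + t ^ 2 * g.inner p (w p) (w p)))⁻¹ ^ 2 *
    (1 + t ^ 2 * g.inner p (w p) (w p)) = 1
  rw [inv_pow, Real.sq_sqrt h0.le, inv_mul_cancel₀ h0.ne']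

lemma chartRep_unitPath (g : Metric n M) (hy : y ∈ (extChartAt 𝓘(ℝ, Model n) x).target) (t : ℝ) :
    chartRep x (unitPath g v w t) y =
      (Real.sqrt (1 + t ^ 2 * chartMetric g x y (chartRep x w y) (chartRep x w y)))⁻¹ •
        (chartRep x v y + t • chartRep x w y) := by
  rw [chartMetric_chartRep g hy]
  refine (map_smul (toChart x _) _ _).trans (congrArg _ ?_)
  exact (map_add (toChart x _) _ _).trans (congrArg _ (map_smul (toChart x _) _ _))

lemma isSmoothPath_unitPath (g : Metric n M) (hv : IsSmooth v) (hw : IsSmooth w) :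
    IsSmoothPath (unitPath g v w) := by
  refine IsSmoothPath.of_chartRep fun x => ?_
  have hT := isOpen_extChartAt_target (I := 𝓘(ℝ, Model n)) x
  have hpull : ∀ {F : Type} [NormedAddCommGroup F] [NormedSpace ℝ F] {f : Model n → F},
      ContDiffOn ℝ ∞ f (extChartAt 𝓘(ℝ, Model n) x).target →
      ContDiffOn ℝ ∞ (fun s : ℝ × Model n => f s.2)
        (Set.univ ×ˢ (extChartAt 𝓘(ℝ, Model n) x).target) := fun hf =>
    hf.comp contDiffOn_snd fun s hs => hs.2
  have h1 := hpull (hw.contDiffOn_chartRep x)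
  have h2 : ContDiffOn ℝ ∞ (fun s : ℝ × Model n => 1 + s.1 ^ 2 *
      chartMetric g x s.2 (chartRep x w s.2) (chartRep x w s.2))
      (Set.univ ×ˢ (extChartAt 𝓘(ℝ, Model n) x).target) :=
    contDiffOn_const.add ((contDiffOn_fst.pow 2).mul
      (((hpull (contDiffOn_chartMetric g x)).clm_apply h1).clm_apply h1))
  have h3 : ∀ s ∈ Set.univ ×ˢ (extChartAt 𝓘(ℝ, Model n) x).target, (0 : ℝ) < 1 + s.1 ^ 2 *
      chartMetric g x s.2 (chartRep x w s.2) (chartRep x w s.2) := by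
    intro s hs
    rw [chartMetric_chartRep g hs.2]
    exact one_add_sq_mul_inner_pos g _ _
  refine (((h2.sqrt fun s hs => (h3 s hs).ne').inv fun s hs => (Real.sqrt_pos.2 (h3 s hs)).ne').smul
    ((hpull (hv.contDiffOn_chartRep x)).add (contDiffOn_fst.smul h1))).congr fun s hs => ?_
  exact chartRep_unitPath g hs.2 s.1

lemma velocity_unitPath (g : Metric n M) (v w : VField n M) : velocity (unitPath g v w) = w := by
  ext1 p
  let a : Model n := v p
  let b : Model n := w p
  set c : ℝ := g.inner p (w p) (w p)
  have h1 : HasDerivAt (fun t : ℝ => 1 + t ^ 2 * c) 0 0 := by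
    simpa using ((hasDerivAt_pow 2 (0 : ℝ)).mul_const c).const_add 1
  -- The normalizing factor is even in `t`, so it does not affect the velocity at `0`.
  have h2 : HasDerivAt (fun t : ℝ => (Real.sqrt (1 + t ^ 2 * c))⁻¹) 0 0 := by
    simpa using (h1.sqrt (by simp)).fun_inv (by simp)
  have h3 : HasDerivAt (fun t : ℝ => a + t • b) b 0 := by
    simpa using ((hasDerivAt_id (0 : ℝ)).smul_const b).const_add a
  have h4 : HasDerivAt (fun t : ℝ => (Real.sqrt (1 + t ^ 2 * c))⁻¹ • (a + t • b)) b 0 := by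
    simpa using h2.fun_smul h3
  exact h4.deriv

lemma isSmoothPath_one_add_smul (hv : IsSmooth v) :
    IsSmoothPath fun (t : ℝ) p => (1 + t) • v p := by
  refine IsSmoothPath.of_chartRep fun x => ?_
  have h1 : ContDiffOn ℝ ∞ (fun s : ℝ × Model n => chartRep x v s.2)
      (Set.univ ×ˢ (extChartAt 𝓘(ℝ, Model n) x).target) :=
    (hv.contDiffOn_chartRep x).comp contDiffOn_snd fun s hs => hs.2
  refine ((contDiffOn_const (c := (1 : ℝ))).add contDiffOn_fst |>.smul h1).congr fun s _ => ?_
  exact chartRep_smul (fun _ => 1 + s.1) v x s.2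

open Classical in
/-- The vector field with the chart representation `W`, extended by zero. -/
def extendField (x : M) (W : Model n → Model n) : VField n M := fun q =>
  if q ∈ (extChartAt 𝓘(ℝ, Model n) x).source then
    toTangent x q (W (extChartAt 𝓘(ℝ, Model n) x q)) else (0 : Model n)

lemma extendField_of_mem {W : Model n → Model n}
    (hq : q ∈ (extChartAt 𝓘(ℝ, Model n) x).source) :
    extendField x W q = toTangent x q (W (extChartAt 𝓘(ℝ, Model n) x q)) := if_pos hq

lemma extendField_of_notMem {W : Model n → Model n}
    (hq : q ∉ (extChartAt 𝓘(ℝ, Model n) x).source) : extendField x W q = 0 := if_neg hq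

lemma chartRep_extendField {W : Model n → Model n}
    (hy : y ∈ (extChartAt 𝓘(ℝ, Model n) x).target) : chartRep x (extendField x W) y = W y := by
  have hq := (extChartAt 𝓘(ℝ, Model n) x).map_target hy
  have h1 := (congrArg (toChart x _) (extendField_of_mem (W := W) hq)).trans (toChart_toTangent hq _)
  rw [(extChartAt 𝓘(ℝ, Model n) x).right_inv hy] at h1
  exact h1

variable {K : Set (Model n)} {W : Model n → Model n}

lemma extendField_eq_zero (h0 : ∀ y ∉ K, W y = 0)
    (hq : q ∉ (extChartAt 𝓘(ℝ, Model n) x).symm '' K) : extendField x W q = 0 := by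
  by_cases hqx : q ∈ (extChartAt 𝓘(ℝ, Model n) x).source
  · rw [extendField_of_mem hqx, h0 _ fun h => hq ⟨_, h, (extChartAt 𝓘(ℝ, Model n) x).left_inv hqx⟩]
    exact map_zero (toTangent x q)
  · exact extendField_of_notMem hqx

/-- At points outside the chart the field vanishes nearby: the image of `K` is compact, hence closed
in the Hausdorff space `M`. -/
lemma isSmooth_extendField [T2Space M] (hK : IsCompact K)
    (hKT : K ⊆ (extChartAt 𝓘(ℝ, Model n) x).target)
    (hW : ContDiffOn ℝ ∞ W (extChartAt 𝓘(ℝ, Model n) x).target) (h0 : ∀ y ∉ K, W y = 0) :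
    IsSmooth (extendField x W) := by
  have hT := isOpen_extChartAt_target (I := 𝓘(ℝ, Model n)) x
  intro q
  by_cases hq : q ∈ (extChartAt 𝓘(ℝ, Model n) x).source
  · have hy := (extChartAt 𝓘(ℝ, Model n) x).map_source hq
    refine contMDiffAt_of_chartRep hq ((hW.contDiffAt (hT.mem_nhds hy)).congr_of_eventuallyEq ?_)
    filter_upwards [hT.mem_nhds hy] with z hz using chartRep_extendField hz
  · have hC := (isCompact_image_extChartAt_symm hK hKT).isClosed
    have hqC : q ∉ (extChartAt 𝓘(ℝ, Model n) x).symm '' K :=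
      fun h => hq (image_extChartAt_symm_subset hKT h)
    refine contMDiffAt_of_chartRep (mem_extChartAt_source q)
      ((contDiffAt_const (c := (0 : Model n))).congr_of_eventuallyEq ?_)
    have h1 := continuousAt_extChartAt_symm (I := 𝓘(ℝ, Model n)) q
    have h2 : ((extChartAt 𝓘(ℝ, Model n) x).symm '' K)ᶜ ∈
        nhds ((extChartAt 𝓘(ℝ, Model n) q).symm (extChartAt 𝓘(ℝ, Model n) q q)) := by
      rw [(extChartAt 𝓘(ℝ, Model n) q).left_inv (mem_extChartAt_source q)]
      exact hC.isOpen_compl.mem_nhds hqC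
    filter_upwards [h1.preimage_mem_nhds h2] with z hz
    exact (congrArg (toChart q _) (extendField_eq_zero h0 hz)).trans (map_zero _)

end Paths

/-! ### Necessity of the Euler-Lagrange equation. -/

section Critical

open MeasureTheory

variable {n : ℕ} {M : Type*} [TopologicalSpace M] [ChartedSpace (Model n) M]
  [IsManifold 𝓘(ℝ, Model n) ∞ M] [T2Space M] [CompactSpace M] {v : VField n M}

lemma IsMinimalUnit.volumeVariation_eq_zero {g : Metric n M} (h : IsMinimalUnit g v)
    {w : VField n M} (hw : IsSmooth w) (hwv : ∀ p, g.inner p (w p) (v p) = 0) :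
    volumeVariation g v w = 0 := by
  have h1 := hasDerivAt_fieldVolume g (isSmoothPath_unitPath g h.1 hw)
  rw [unitPath_zero, velocity_unitPath] at h1
  exact h1.unique (h.2.2 _ (isSmoothPath_unitPath g h.1 hw) (isUnitField_unitPath g h.2.1 hwv)
    (unitPath_zero g v w))

/-- The scalings `(1 + t) v` form an admissible path among all smooth fields and have velocity `v`.
-/
lemma IsMinimal.volumeVariation_self {g : Metric n M} (h : IsMinimal g v) :
    volumeVariation g v v = 0 := by
  have h0 : (fun p => (1 + (0 : ℝ)) • v p) = v := by
    ext1 p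
    rw [add_zero, one_smul]
  have h1 := hasDerivAt_fieldVolume g (isSmoothPath_one_add_smul h.1)
  rw [h0, velocity_one_add_smul] at h1
  exact h1.unique (h.2 _ (isSmoothPath_one_add_smul h.1) h0)

lemma IsMinimalUnit.isCriticalField {g : Metric n M} (h : IsMinimalUnit g v) :
    IsCriticalField g v := by
  intro x y hy u hu
  have hT := isOpen_extChartAt_target (I := 𝓘(ℝ, Model n)) x
  have hLC := isLeviCivitaOn_chart g x
  have hV := h.1.contDiffOn_chartRep x
  set V := chartRep x v with hVdef
  -- The constant vector `u` projected onto `V^⊥` at every point; at `y` it is `u` itself, since `u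
  -- ⊥ V y`.
  set W : Model n → Model n := fun z => u - chartMetric g x z u (V z) • V z with hW
  have hWs : ContDiffOn ℝ ∞ W (extChartAt 𝓘(ℝ, Model n) x).target :=
    contDiffOn_const.sub ((((contDiffOn_chartMetric g x).clm_apply contDiffOn_const).clm_apply
      hV).smul hV)
  have hWV : ∀ z ∈ (extChartAt 𝓘(ℝ, Model n) x).target, chartMetric g x z (W z) (V z) = 0 := by
    intro z hz
    have h1 : chartMetric g x z (V z) (V z) = 1 :=
      (chartMetric_chartRep g hz v v).trans (h.2.1 _)
    simp only [hW, map_sub, map_smul, sub_apply, smul_apply, smul_eq_mul, h1]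
    ring
  have hf : ContinuousOn (fun z => flatEulerLagrange (chartMetric g x) (chartChristoffel g x) V z
      (W z)) (extChartAt 𝓘(ℝ, Model n) x).target := fun z hz =>
    (hLC.contDiffAt_flatEulerLagrange hz hV hWs).continuousAt.continuousWithinAt
  -- Fundamental lemma: the test function `η` is realized by the global field extending `η W` by
  -- zero, which is orthogonal to `v` and hence the velocity of a path of unit fields.
  have hae := hT.ae_eq_zero_of_integral_contDiff_smul_eq_zero (μ := volume)
    (hf.locallyIntegrableOn hT.measurableSet) fun η hη hηc hηT => by
      set K := tsupport η
      set W' : Model n → Model n := fun z => η z • W z with hW'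
      have hW's : ContDiffOn ℝ ∞ W' (extChartAt 𝓘(ℝ, Model n) x).target := hη.contDiffOn.smul hWs
      have h0 : ∀ z ∉ K, W' z = 0 := fun z hz => by
        rw [hW']
        simp only
        rw [image_eq_zero_of_notMem_tsupport hz, zero_smul]
      have hsm := isSmooth_extendField hηc hηT hW's h0
      have horth : ∀ q, g.inner q (extendField x W' q) (v q) = 0 := by
        intro q
        by_cases hq : q ∈ (extChartAt 𝓘(ℝ, Model n) x).source
        · have hz := (extChartAt 𝓘(ℝ, Model n) x).map_source hq
          have h1 := chartMetric_chartRep g hz (extendField x W') v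
          rw [chartRep_extendField hz, (extChartAt 𝓘(ℝ, Model n) x).left_inv hq] at h1
          rw [← h1, hW']
          simp only
          rw [map_smul, smul_apply, smul_eq_mul, hWV _ hz, mul_zero]
        · rw [extendField_of_notMem hq, map_zero]
          rfl
      have h2 := volumeVariation_eq_integral g h.1 hsm (isCompact_image_extChartAt_symm hηc hηT)
        (image_extChartAt_symm_subset hηT) fun q hq => extendField_eq_zero h0 hq
      rw [h.volumeVariation_eq_zero hsm horth] at h2
      rw [← setIntegral_eq_integral_of_forall_compl_eq_zero
        (s := (extChartAt 𝓘(ℝ, Model n) x).target) fun z hz => by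
          rw [image_eq_zero_of_notMem_tsupport fun h => hz (hηT h), zero_smul], h2]
      refine setIntegral_congr_fun hT.measurableSet fun z hz => ?_
      rw [chartRep_extendField hz, hW', flatEulerLagrange_smul, smul_eq_mul]
  -- Continuity upgrades vanishing almost everywhere to vanishing at `y`.
  have h1 := Measure.eqOn_open_of_ae_eq ((ae_restrict_iff' hT.measurableSet).2 hae) hT hf
    continuousOn_const hy
  have h2 : W y = u := by simp [hW, hu]
  rw [← h2]
  exact h1

lemma isMinimalUnit_iff_isCriticalField {g : Metric n M} (hv : IsSmooth v)
    (hu : IsUnitField g v) : IsMinimalUnit g v ↔ IsCriticalField g v :=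
  ⟨fun h => h.isCriticalField, fun h => h.isMinimalUnit hv hu⟩

end Critical

/-! ### Comparison of frames, and parallelism of fields that are minimal in both senses. -/

section Parallel

open MeasureTheory

variable {n : ℕ} {U : Set (Model n)} {G : Model n → Model n →L[ℝ] Model n →L[ℝ] ℝ}
  {Γ : Model n → Model n →L[ℝ] Model n →L[ℝ] Model n} {V : Model n → Model n} {y : Model n}

/-- The first variation of the volume of `V` in the direction `V` is non-negative, and vanishes
only where `V` is parallel. -/
lemma IsLeviCivitaOn.flatFirstVar_self (h : IsLeviCivitaOn U G Γ) (hy : y ∈ U) :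
    0 ≤ flatFirstVar G Γ V V y ∧ (flatFirstVar G Γ V V y = 0 → flatNabla Γ V y = 0) := by
  set C := flatNabla Γ V y with hC
  let G' : LinearMap.BilinForm ℝ (Model n) := LinearMap.mk₂ ℝ (fun a b => G y a b)
    (by simp) (by simp) (by simp) (by simp)
  let S : LinearMap.BilinForm ℝ (Model n) := LinearMap.mk₂ ℝ
    (fun a b => G y (C a) (C b)) (by simp) (by simp) (by simp) (by simp)
  obtain ⟨a, l, hao, hal, hab⟩ := exists_simultaneous_diagonalization (n := n) (by simp) G' S
    (h.metric_symm y hy) (h.metric_pos y hy) (fun _ _ => h.metric_symm y hy _ _)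
  have hCe : ∀ i j, G y (C (a i)) (C (a j)) = if i = j then l i else 0 := by
    intro i j
    have h1 : G y (C (a i)) (C (a j)) = l i * G' (a i) (a j) := hal i (a j)
    rw [h1, hao]
    split_ifs <;> simp
  have hl := h.eigenvalue_nonneg hy hCe
  -- In an eigenframe the variation is a positive multiple of `∑ λ_i² / (1 + λ_i²)`.
  have h1 : flatFirstVar G Γ V V y = flatDensity G Γ V y * ∑ i, 1 / (1 + l i) * l i := by
    rw [flatFirstVar, h.trace_gram_flatInduced hy hao hCe]
    congr 1
    refine Finset.sum_congr rfl fun i _ => ?_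
    have h2 := hCe i i
    rw [if_pos rfl] at h2
    exact congrArg _ h2
  have hD := h.flatDensity_pos (V := V) hy
  have hterm : ∀ i, 0 ≤ 1 / (1 + l i) * l i := fun i => by
    have := hl i
    positivity
  refine ⟨h1 ▸ mul_nonneg hD.le (Finset.sum_nonneg fun i _ => hterm i), fun h0 => ?_⟩
  rw [h1] at h0
  have h2 := (Finset.sum_eq_zero_iff_of_nonneg fun i _ => hterm i).1
    ((mul_eq_zero.1 h0).resolve_left hD.ne')
  have h3 : ∀ i, C (a i) = 0 := by
    intro i
    have h4 : l i = 0 := (mul_eq_zero.1 (h2 i (Finset.mem_univ i))).resolve_left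
      (by have := hl i; positivity)
    have h5 := hCe i i
    rw [if_pos rfl, h4] at h5
    by_contra hne
    exact (h.metric_pos y hy _ hne).ne' h5
  ext1 b
  rw [hab b, map_sum]
  simp [h3]

variable {M : Type*} [TopologicalSpace M] [ChartedSpace (Model n) M]
  [IsManifold 𝓘(ℝ, Model n) ∞ M] {v : VField n M}

/-- Being critical is a frame-free condition, equivalent at each point to the equation in any one
eigenframe. The predicate `P` covers both arbitrary eigenframes and those adapted to `v`; its
solvability at every point is what links "all" to "some". -/
lemma isCriticalField_iff (g : Metric n M) (hv : IsSmooth v) (hu : IsUnitField g v)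
    {P : M → (Fin n → VField n M) → Prop} (hP : ∀ p e, P p e → IsEigenframeAt g v p e)
    (hex : ∀ p, ∃ e, P p e) :
    (IsCriticalField g v ↔ ∀ p e, P p e → MinimalUnitEquation g v e p) ∧
      (IsCriticalField g v ↔ ∀ p, ∃ e, P p e ∧ MinimalUnitEquation g v e p) := by
  have h1 : IsCriticalField g v → ∀ p e, P p e → MinimalUnitEquation g v e p := by
    intro h p e he
    have hy := mem_extChartAt_target (I := 𝓘(ℝ, Model n)) p
    have h2 := minimalUnitEquation_iff g hv hu (e := e) hy
    rw [(extChartAt 𝓘(ℝ, Model n) p).left_inv (mem_extChartAt_source p)] at h2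
    exact (h2 (hP p e he)).2 (h p _ hy)
  have h2 : (∀ p, ∃ e, P p e ∧ MinimalUnitEquation g v e p) → IsCriticalField g v := by
    intro h x y hy
    obtain ⟨e, he, heq⟩ := h ((extChartAt 𝓘(ℝ, Model n) x).symm y)
    exact (minimalUnitEquation_iff g hv hu hy (hP _ e he)).1 heq
  have h3 : (∀ p e, P p e → MinimalUnitEquation g v e p) →
      ∀ p, ∃ e, P p e ∧ MinimalUnitEquation g v e p := fun h p =>
    (hex p).imp fun e he => ⟨he, h p e he⟩
  exact ⟨⟨h1, fun h => h2 (h3 h)⟩, ⟨fun h => h3 (h1 h), h2⟩⟩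

variable [T2Space M] [CompactSpace M]

/-- A vanishing sum of integrals of non-negative functions forces each integrand to vanish, first
almost everywhere and then everywhere by continuity. -/
lemma isParallel_of_volumeVariation_self {g : Metric n M} (hv : IsSmooth v)
    (h : volumeVariation g v v = 0) : IsParallel g v := by
  obtain ⟨s, hs0, hs1⟩ := exists_finset_chartPartition n M
  have hnn : ∀ x, ∀ y ∈ (extChartAt 𝓘(ℝ, Model n) x).target,
      0 ≤ chartPartition n M x ((extChartAt 𝓘(ℝ, Model n) x).symm y) *
        flatFirstVar (chartMetric g x) (chartChristoffel g x) (chartRep x v) (chartRep x v) y :=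
    fun x y hy => mul_nonneg ((chartPartition n M).nonneg x _)
      ((isLeviCivitaOn_chart g x).flatFirstVar_self hy).1
  rw [volumeVariation, finsum_eq_sum_chartPartition hs0, Finset.sum_eq_zero_iff_of_nonneg fun x _ =>
    setIntegral_nonneg (isOpen_extChartAt_target x).measurableSet (hnn x)] at h
  intro p X
  -- Some partition function is non-zero at `p`, so in its chart the first variation itself vanishes
  -- there.
  obtain ⟨x, hxs, hx⟩ : ∃ x ∈ s, chartPartition n M x p ≠ 0 := by
    by_contra! hne
    have := hs1 p
    rw [Finset.sum_eq_zero hne] at this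
    exact zero_ne_one this
  have hp : p ∈ (extChartAt 𝓘(ℝ, Model n) x).source := by
    by_contra hp
    exact hx (chartPartition_eq_zero hp)
  have hy := (extChartAt 𝓘(ℝ, Model n) x).map_source hp
  have hT := isOpen_extChartAt_target (I := 𝓘(ℝ, Model n)) x
  have hLC := isLeviCivitaOn_chart g x
  have h1 := (setIntegral_eq_zero_iff_of_nonneg_ae
    ((ae_restrict_iff' hT.measurableSet).2 (Filter.Eventually.of_forall (hnn x)))
    (integrableOn_chartPartition_mul g hv hv x)).1 (h x hxs)
  have h2 := Measure.eqOn_open_of_ae_eq h1 hT ((contDiffOn_chartPartition x x).continuousOn.mul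
    fun y hy => (hLC.contDiffAt_flatFirstVar hy
      ((hv.contDiffOn_chartRep x).contDiffAt (hT.mem_nhds hy))
      ((hv.contDiffOn_chartRep x).contDiffAt (hT.mem_nhds hy))).continuousAt.continuousWithinAt)
    continuousOn_const hy
  simp only [(extChartAt 𝓘(ℝ, Model n) x).left_inv hp] at h2
  have h3 := (hLC.flatFirstVar_self hy).2 ((mul_eq_zero.1 h2).resolve_left hx)
  have h4 := nabla_toTangent_extChartAt g hv hp (toChart x p X)
  rw [h3] at h4
  exact ((congrArg (nabla g v p) (toTangent_toChart hp X)).symm.trans h4).trans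
    (map_zero (toTangent x p))

end Parallel

end UnitFields

end

theorem mainTheorem3 (m : ℕ) {M : Type*} [TopologicalSpace M]
    [ChartedSpace (UnitFields.Model (m + 1)) M]
    [IsManifold 𝓘(ℝ, UnitFields.Model (m + 1)) ∞ M] [T2Space M] [CompactSpace M]
    (g : UnitFields.Metric (m + 1) M) :
    (∀ v : UnitFields.VField (m + 1) M,
      UnitFields.IsSmooth v → UnitFields.IsUnitField g v →
        (UnitFields.IsMinimalUnit g v ↔
          ∀ (p : M) (e : Fin (m + 1) → UnitFields.VField (m + 1) M),
            UnitFields.IsEigenframeAt g v p e → UnitFields.MinimalUnitEquation g v e p) ∧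
        (UnitFields.IsMinimalUnit g v ↔
          ∀ p : M, ∃ e : Fin (m + 1) → UnitFields.VField (m + 1) M,
            UnitFields.IsEigenframeAt g v p e ∧ UnitFields.MinimalUnitEquation g v e p) ∧
        ((∀ p : M, ∃ e : Fin (m + 1) → UnitFields.VField (m + 1) M,
            UnitFields.IsEigenframeAt g v p e ∧ ∀ᶠ q in nhds p, e 0 q = v q) →
          (UnitFields.IsMinimalUnit g v ↔
            ∀ (p : M) (e : Fin (m + 1) → UnitFields.VField (m + 1) M),
              UnitFields.IsEigenframeAt g v p e → (∀ᶠ q in nhds p, e 0 q = v q) →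
                UnitFields.MinimalUnitEquation g v e p))) ∧
    (∀ v : UnitFields.VField (m + 1) M,
      UnitFields.IsMinimal g v → UnitFields.IsMinimalUnit g v →
        UnitFields.IsParallel g v ∧ UnitFields.IsUnitField g v) := by
  refine ⟨fun v hv hu => ?_, fun v hm hmu => ?_⟩
  · rw [UnitFields.isMinimalUnit_iff_isCriticalField hv hu]
    obtain ⟨ha, hb⟩ := UnitFields.isCriticalField_iff g hv hu (P := UnitFields.IsEigenframeAt g v)
      (fun _ _ h => h) (UnitFields.exists_isEigenframeAt g hv)
    refine ⟨ha, hb, fun hex => ?_⟩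
    -- For adapted frames existence is the extra hypothesis of (c), whereas unrestricted eigenframes
    -- always exist.
    have hc := (UnitFields.isCriticalField_iff g hv hu
      (P := fun p e => UnitFields.IsEigenframeAt g v p e ∧ ∀ᶠ q in nhds p, e 0 q = v q)
      (fun _ _ h => h.1) hex).1
    exact hc.trans ⟨fun h p e h1 h2 => h p e ⟨h1, h2⟩, fun h p e he => h p e he.1 he.2⟩
  · exact ⟨UnitFields.isParallel_of_volumeVariation_self hm.1 hm.volumeVariation_self, hmu.2.1⟩
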